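/- Let $n\ge 0$, let $m_0,\dots,m_n\ge 2$ be integers, $f=\sum_{i=0}^n x_i^{m_i}\in\mathbf C\{x\}=\mathbf C\{x_0,\dots,x_n\}$, $\Gamma=\prod_{i=0}^n\{0,1,\dots,m_i-2\}$, and let $F=f+\sum_{\nu\in\Gamma}x^\nu s_\nu$ be the standard miniversal deformation, with parameters $s=(s_\nu)_{\nu\in\Gamma}$. Let $\Omega^\bullet$ be the forms in $x$ with coefficients in $\mathbf C\{x\}$, $\omega_0=dx_0\wedge\cdots\wedge dx_n$, $u=\partial_t^{-1}$, and put $$\widehat G_f=H^{n+1}\bigl(\Omega^\bullet((u)),\,ud-df\wedge\bigr),\qquad \widehat G_F=H^{n+1}\bigl(\Omega^\bullet((u))[[s]],\,ud-dF\wedge\bigr)$$ ($d$ relative to the parameters $s$). Let $\widehat H''_f,\widehat H''_F$ be the same with $[[u]]$ in place of $((u))$, let $\widehat G_{f,\widehat S}$ be $\widehat G_F$ with $F$ replaced by the trivial deformation $f$, and write $[\cdot]$, $[\cdot]_F$ for classes in $\widehat H''_f$, $\widehat H''_F$. The actions are $t[h\omega_0]=[(Fh+u^2\partial_uh)\omega_0]$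 and $\partial_{s_\nu}[h\omega_0]=[(\partial_{s_\nu}h-u^{-1}(\partial_{s_\nu}F)h)\omega_0]$. Let $\Omega_f=\widehat H''_f/u\widehat H''_f$, $\Omega_F=\widehat H''_F/u\widehat H''_F$. A $\mathbf C$-linear section $\sigma_0:\Omega_f\to\widehat H''_f$ of the projection is *good* if $I_0=\operatorname{Im}\sigma_0$ satisfies $tI_0\subset I_0+uI_0$. A $\mathbf C[[s]]$-linear section $\sigma:\Omega_F\to\widehat H''_F$ is *good* if $I=\operatorname{Im}\sigma$ satisfies $tI\subset I+uI$ and $\partial_{s_\nu}I\subset I+u^{-1}I$ for all $\nu$. Given a good $\sigma_0$ and a nonzero $\bar\zeta_0\in\Omega_f$ which generates $\Omega_f$ over $\mathbf C\{x\}$ and is an eigenvector of $A_1$, where $t\sigma_0=\sigma_0A_0+u\sigma_0A_1$, the associated *formal primitive form* is $\zeta=\sigma^\nabla(\bar\zeta_0)\in\widehat H''_F$, where $\sigma$ is a good section extending $\sigma_0$ and $\sigma^\nabla:\Omega_f\to\widehat H''_F$ is a $\mathbf C$-linear map that restricts to $\sigma_0$ at $s=0$, with $\operatorname{Im}\sigma^\nabla\subset\operatorname{Im}\sigma$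 and $\partial_{s_\nu}\operatorname{Im}\sigma^\nabla\subset u^{-1}\operatorname{Im}\sigma$ for all $\nu$. For $a=(a_\nu)\in\mathbf N^\Gamma$ let $|a|=\sum_\nu a_\nu$, $p(a)_i=\sum_\nu\nu_ia_\nu$, $q(a)_i=\lfloor p(a)_i/m_i\rfloor$, $r(a)_i=p(a)_i-q(a)_im_i$, $e_a=\sum_iq(a)_i-|a|$, $s^a=\prod_\nu s_\nu^{a_\nu}$, and $A'_k=\{a:|a|\le k,\ e_a\ge0,\ r(a)\in\Gamma\}$. Then: 1. There is a unique section $\sigma_0$ of $\widehat H''_f\to\Omega_f$ with image $I_0=\sum_{\nu\in\Gamma}\mathbf C[x^\nu\omega_0]$ (the canonical section), and it is good. 2. There is a unique formal primitive form $\zeta\in\widehat H''_F$ associated with $\sigma_0$ and the class $\bar\zeta_0$ of $[\omega_0]$ in $\Omega_f$. It is the unique element of $\widehat H''_F$ with $$\Phi(\zeta)\equiv\iota([\omega_0])\quad\text{modulo}\quad\iota\bigl(u^{-1}I_0[u^{-1}]\bigr)[[s]],$$ where $\Phi=e^{(f-F)/u}:\widehat G_F\to\widehat G_{f,\widehat S}$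 and $\iota:\widehat G_f\to\widehat G_{f,\widehat S}$ is the canonical map. 3. There are $c_a\in\mathbf C$, independent of $k$, such that for every $k\ge0$, with $\mathfrak m_0$ the maximal ideal of $\mathbf C[[s]]$, $$\zeta\equiv\sum_{a\in A'_k}c_a\,\partial_t^{-e_a}\bigl[x^{r(a)}s^a\omega_0\bigr]_F\quad\text{modulo}\quad\mathfrak m_0^{k+1}\widehat H''_F .\tag{$*$}$$ 4. For every $k\ge 0$ and every family $(c_a)$ of complex numbers, $(*)$ holds if and only if $c_0=1$ and, for all $a\in A'_k\setminus\{0\}$, $$c_a=-\sum_{b\in A'_k,\ b<a}(-1)^{|a-b|}\frac{c_b}{(a-b)!}\prod_{i=0}^n\ \prod_{l=1}^{q(a,b)_i}\frac{r(b)_i+p(a-b)_i-l\,m_i+1}{m_i},\qquad q(a,b)_i=\Bigl\lfloor\frac{r(b)_i+p(a-b)_i}{m_i}\Bigr\rfloor,$$ where $b<a$ means $b_\nu\le a_\nu$ for all $\nu$ and $b\ne a$, and $(a-b)!=\prod_\nu(a_\nu-b_\nu)!$. In particular this recursion determines the coefficients $c_a$, $a\in A'_k$. -/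

import Mathlib

noncomputable section

namespace GaussManin

/-! ### Convergent power series -/

/-- Absolute convergence on some polydisc around the origin. -/
def IsConvergent {N : ℕ} (φ : MvPowerSeries (Fin N) ℂ) : Prop :=
  ∃ r : ℝ, 0 < r ∧
    Summable fun ν : Fin N →₀ ℕ => ‖MvPowerSeries.coeff ν φ‖ * r ^ ν.degree

theorem IsConvergent.mono {N : ℕ} {φ : MvPowerSeries (Fin N) ℂ} {r r' : ℝ} (hr' : 0 ≤ r')
    (h : r' ≤ r)
    (hs : Summable fun ν : Fin N →₀ ℕ => ‖MvPowerSeries.coeff ν φ‖ * r ^ ν.degree) :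
    Summable fun ν : Fin N →₀ ℕ => ‖MvPowerSeries.coeff ν φ‖ * r' ^ ν.degree :=
  Summable.of_nonneg_of_le (fun _ => by positivity) (fun _ => by gcongr) hs

theorem IsConvergent.add {N : ℕ} {φ ψ : MvPowerSeries (Fin N) ℂ} (hφ : IsConvergent φ)
    (hψ : IsConvergent ψ) : IsConvergent (φ + ψ) := by
  obtain ⟨r, hr, h⟩ := hφ
  obtain ⟨r', hr', h'⟩ := hψ
  have hm : 0 < min r r' := lt_min hr hr'
  refine ⟨min r r', hm, Summable.of_nonneg_of_le (fun _ => by positivity) (fun ν => ?_)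
    ((IsConvergent.mono hm.le (min_le_left _ _) h).add
      (IsConvergent.mono hm.le (min_le_right _ _) h'))⟩
  rw [← add_mul, map_add]
  gcongr
  exact norm_add_le _ _

theorem summable_cauchy {N : ℕ} {f g : (Fin N →₀ ℕ) → ℝ} (hf : Summable f) (hg : Summable g)
    (hf0 : 0 ≤ f) (hg0 : 0 ≤ g) : Summable fun n : Fin N →₀ ℕ =>
      ∑ kl ∈ Finset.HasAntidiagonal.antidiagonal n, f kl.1 * g kl.2 :=
  summable_sum_mul_antidiagonal_of_summable_mul (hf.mul_of_nonneg hg hf0 hg0)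

theorem IsConvergent.summable_mul {N : ℕ} {φ ψ : MvPowerSeries (Fin N) ℂ} {t : ℝ} (hm : 0 < t)
    (f g : (Fin N →₀ ℕ) → ℝ)
    (hf : ∀ ν, f ν = ‖MvPowerSeries.coeff ν φ‖ * t ^ ν.degree)
    (hg : ∀ ν, g ν = ‖MvPowerSeries.coeff ν ψ‖ * t ^ ν.degree) (hfs : Summable f)
    (hgs : Summable g) :
    Summable fun ν : Fin N →₀ ℕ => ‖MvPowerSeries.coeff ν (φ * ψ)‖ * t ^ ν.degree := by
  have hf0 : 0 ≤ f := fun ν => by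
    rw [hf]
    exact mul_nonneg (norm_nonneg _) (pow_nonneg hm.le _)
  have hg0 : 0 ≤ g := fun ν => by
    rw [hg]
    exact mul_nonneg (norm_nonneg _) (pow_nonneg hm.le _)
  refine Summable.of_nonneg_of_le
    (fun ν => mul_nonneg (norm_nonneg _) (pow_nonneg hm.le _)) (fun ν => ?_)
    (summable_cauchy hfs hgs hf0 hg0)
  rw [MvPowerSeries.coeff_mul]
  refine (mul_le_mul_of_nonneg_right (norm_sum_le _ _) (pow_nonneg hm.le _)).trans ?_
  rw [Finset.sum_mul]
  refine Finset.sum_le_sum fun p hp => le_of_eq ?_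
  have h4 := Finset.HasAntidiagonal.mem_antidiagonal.mp hp
  rw [← h4, map_add, pow_add, norm_mul, hf, hg]
  ring

theorem IsConvergent.mul {N : ℕ} {φ ψ : MvPowerSeries (Fin N) ℂ} (hφ : IsConvergent φ)
    (hψ : IsConvergent ψ) : IsConvergent (φ * ψ) := by
  obtain ⟨r, hr, h⟩ := hφ
  obtain ⟨r', hr', h'⟩ := hψ
  have hm : 0 < min r r' := lt_min hr hr'
  exact ⟨min r r', hm, IsConvergent.summable_mul hm _ _ (fun _ => rfl) (fun _ => rfl)
    (IsConvergent.mono hm.le (min_le_left _ _) h) (IsConvergent.mono hm.le (min_le_right _ _) h')⟩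

theorem IsConvergent.C {N : ℕ} (c : ℂ) : IsConvergent (MvPowerSeries.C (σ := Fin N) c) := by
  classical
  refine ⟨1, one_pos, summable_of_ne_finset_zero (s := {0}) fun ν hν => ?_⟩
  have : ν ≠ 0 := by simpa using hν
  simp [MvPowerSeries.coeff_C, this]

theorem IsConvergent.X {N : ℕ} (i : Fin N) : IsConvergent (MvPowerSeries.X i) := by
  classical
  refine ⟨1, one_pos, summable_of_ne_finset_zero (s := {Finsupp.single i 1}) fun ν hν => ?_⟩
  have : ν ≠ Finsupp.single i 1 := by simpa using hν
  simp [MvPowerSeries.coeff_X, this]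

theorem IsConvergent.pderiv {N : ℕ} {φ : MvPowerSeries (Fin N) ℂ} (hφ : IsConvergent φ)
    (i : Fin N) : IsConvergent (MvPowerSeries.pderiv ℂ i φ) := by
  obtain ⟨r, hr, h⟩ := hφ
  have hinj : Function.Injective fun ν : Fin N →₀ ℕ => ν + Finsupp.single i 1 :=
    add_left_injective _
  have h1 := (h.comp_injective hinj).mul_left (1 / r)
  refine ⟨r / 2, by positivity,
    Summable.of_nonneg_of_le (fun _ => by positivity) (fun ν => ?_) h1⟩
  simp only [Function.comp_apply, MvPowerSeries.coeff_pderiv, norm_mul, map_add,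
    Finsupp.degree_single, pow_succ, div_pow]
  have h2 : ‖((ν i : ℂ) + 1)‖ ≤ 2 ^ ν.degree := by
    have h3 : ν i + 1 ≤ 2 ^ ν.degree :=
      (Nat.succ_le_succ (Finsupp.le_degree i ν)).trans Nat.lt_two_pow_self
    have h4 : ‖((ν i : ℂ) + 1)‖ = ((ν i + 1 : ℕ) : ℝ) := by
      rw [← Nat.cast_succ, Complex.norm_natCast]
    rw [h4]
    exact_mod_cast h3
  rw [mul_comm ‖MvPowerSeries.coeff _ φ‖, mul_assoc]
  calc ‖((ν i : ℂ) + 1)‖ * (‖MvPowerSeries.coeff (ν + Finsupp.single i 1) φ‖ *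
        (r ^ ν.degree / 2 ^ ν.degree))
      ≤ 2 ^ ν.degree * (‖MvPowerSeries.coeff (ν + Finsupp.single i 1) φ‖ *
        (r ^ ν.degree / 2 ^ ν.degree)) := by gcongr
    _ = _ := by field_simp

/-- The ring `ℂ{x}` of convergent power series in `N` variables. -/
def convergentSeries (N : ℕ) : Subalgebra ℂ (MvPowerSeries (Fin N) ℂ) where
  carrier := {φ | IsConvergent φ}
  mul_mem' := IsConvergent.mul
  add_mem' := IsConvergent.add
  algebraMap_mem' := IsConvergent.C

abbrev Conv (N : ℕ) : Type := ↥(convergentSeries N)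

/-- The coordinate function `x_i`. -/
def Conv.X {N : ℕ} (i : Fin N) : Conv N := ⟨MvPowerSeries.X i, IsConvergent.X i⟩

/-- The partial derivative `∂/∂x_i` on `ℂ{x}`. -/
def Conv.pderiv {N : ℕ} (i : Fin N) : Derivation ℂ (Conv N) (Conv N) :=
  Derivation.mk'
    { toFun := fun φ => ⟨MvPowerSeries.pderiv ℂ i φ, φ.2.pderiv i⟩
      map_add' := fun _ _ => Subtype.ext (map_add (MvPowerSeries.pderiv ℂ i) _ _)
      map_smul' := fun c _ => Subtype.ext ((MvPowerSeries.pderiv ℂ i).map_smul c _) }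
    (fun φ ψ => Subtype.ext ((MvPowerSeries.pderiv ℂ i).leibniz φ.1 ψ.1))

/-! ### Coefficientwise extension of derivations -/

section Lift

variable {k R σ : Type} [CommRing k] [CommRing R] [Algebra k R]

/-- Apply a derivation to the coefficients of a power series in `s`. -/
def coeffwise (D : Derivation k R R) (h : MvPowerSeries σ R) : MvPowerSeries σ R :=
  fun a => D (MvPowerSeries.coeff a h)

theorem coeff_coeffwise (D : Derivation k R R) (h : MvPowerSeries σ R) (a : σ →₀ ℕ) :
    MvPowerSeries.coeff a (coeffwise D h) = D (MvPowerSeries.coeff a h) := rfl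

theorem coeffwise_add (D : Derivation k R R) (h h' : MvPowerSeries σ R) :
    coeffwise D (h + h') = coeffwise D h + coeffwise D h' := by
  ext a
  simp [coeff_coeffwise]

theorem coeffwise_mul (D : Derivation k R R) (h h' : MvPowerSeries σ R) :
    coeffwise D (h * h') = h * coeffwise D h' + h' * coeffwise D h := by
  classical
  ext a
  rw [mul_comm h' (coeffwise D h)]
  simp only [map_add, MvPowerSeries.coeff_mul, coeff_coeffwise, map_sum, Derivation.leibniz,
    smul_eq_mul, ← Finset.sum_add_distrib]
  exact Finset.sum_congr rfl fun _ _ => by ring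

/-- The `k[[s]]`-linear derivation of `R[[s]]` extending a `k`-linear derivation of `R`. -/
def extendBase (σ : Type) (D : Derivation k R R) :
    Derivation (MvPowerSeries σ k) (MvPowerSeries σ R) (MvPowerSeries σ R) :=
  Derivation.mk'
    { toFun := coeffwise D
      map_add' := coeffwise_add D
      map_smul' := fun c h => by
        have h0 : coeffwise D (algebraMap (MvPowerSeries σ k) (MvPowerSeries σ R) c) = 0 := by
          ext a
          simp [coeff_coeffwise, MvPowerSeries.algebraMap_apply'']
        simp only [Algebra.smul_def, RingHom.id_apply]
        rw [coeffwise_mul, h0, mul_zero, add_zero] }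
    (coeffwise_mul D)

end Lift

/-! ### Power series and Laurent series in `u` over `ℂ{x}` -/

/-- The ring `ℂ{x}[[u]]`. -/
def Pow (N : ℕ) : Type := PowerSeries (Conv N)

instance Pow.instCommRing (N : ℕ) : CommRing (Pow N) :=
  inferInstanceAs (CommRing (PowerSeries (Conv N)))

namespace Pow

variable {N : ℕ}

/-- The coefficient of `u^n`. -/
def coeff (n : ℕ) (h : Pow N) : Conv N := PowerSeries.coeff n h

/-- The inclusion of `ℂ{x}`. -/
def C : Conv N →+* Pow N := (PowerSeries.C : Conv N →+* PowerSeries (Conv N))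

/-- The variable `u`. -/
def u (N : ℕ) : Pow N := (PowerSeries.X : PowerSeries (Conv N))

instance instAlgebra (N : ℕ) : Algebra ℂ (Pow N) :=
  ((C : Conv N →+* Pow N).comp (algebraMap ℂ (Conv N))).toAlgebra

theorem ext' {h h' : Pow N} (H : ∀ n, coeff n h = coeff n h') : h = h' :=
  PowerSeries.ext H

theorem algebraMap_apply (c : ℂ) : algebraMap ℂ (Pow N) c = C (algebraMap ℂ (Conv N) c) := rfl

theorem coeff_smul (n : ℕ) (c : ℂ) (h : Pow N) : coeff n (c • h) = c • coeff n h := by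
  rw [Algebra.smul_def, Algebra.smul_def]
  exact PowerSeries.coeff_C_mul n h _

theorem coeff_C (n : ℕ) (f : Conv N) : coeff n (C f) = if n = 0 then f else 0 :=
  PowerSeries.coeff_C n f

theorem coeff_u (n : ℕ) : coeff n (u N) = if n = 1 then 1 else 0 :=
  PowerSeries.coeff_X n

/-- The partial derivative `∂/∂x_i` on `ℂ{x}[[u]]`. -/
def pderiv (i : Fin N) : Derivation ℂ (Pow N) (Pow N) :=
  Derivation.mk'
    { toFun := fun h => (coeffwise (Conv.pderiv i) h : MvPowerSeries Unit (Conv N))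
      map_add' := coeffwise_add (Conv.pderiv i)
      map_smul' := fun c h => ext' fun n => by
        refine Eq.trans ?_ (coeff_smul n c _).symm
        exact (congrArg (Conv.pderiv i) (coeff_smul n c h)).trans
          ((Conv.pderiv i).map_smul c _) }
    (coeffwise_mul (Conv.pderiv i))

theorem coeff_pderiv (i : Fin N) (h : Pow N) (n : ℕ) :
    coeff n (pderiv i h) = Conv.pderiv i (coeff n h) := rfl

theorem pderiv_C (i : Fin N) (f : Conv N) : pderiv i (C f) = C (Conv.pderiv i f) := by
  refine ext' fun n => ?_
  rw [coeff_pderiv, coeff_C, coeff_C]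
  split_ifs <;> simp

theorem pderiv_u (i : Fin N) : pderiv i (u N) = 0 := by
  refine ext' fun n => ?_
  rw [coeff_pderiv, coeff_u]
  refine Eq.trans ?_ (map_zero (PowerSeries.coeff (R := Conv N) n)).symm
  split_ifs <;> simp

end Pow

/-- The ring `ℂ{x}((u))`. -/
def Laur (N : ℕ) : Type := LaurentSeries (Conv N)

instance Laur.instCommRing (N : ℕ) : CommRing (Laur N) :=
  inferInstanceAs (CommRing (LaurentSeries (Conv N)))

namespace Laur

variable {N : ℕ}

/-- The coefficient of `u^n`. -/
def coeff (h : Laur N) (n : ℤ) : Conv N := HahnSeries.coeff h n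

/-- The monomial `a u^n`. -/
def single (n : ℤ) (a : Conv N) : Laur N := HahnSeries.single n a

/-- The inclusion of `ℂ{x}`. -/
def C : Conv N →+* Laur N := (HahnSeries.C : Conv N →+* HahnSeries ℤ (Conv N))

/-- The inclusion of `ℂ{x}[[u]]`. -/
def ofPow : Pow N →+* Laur N := HahnSeries.ofPowerSeries ℤ (Conv N)

instance instAlgebra (N : ℕ) : Algebra ℂ (Laur N) :=
  ((C : Conv N →+* Laur N).comp (algebraMap ℂ (Conv N))).toAlgebra

theorem ext' {h h' : Laur N} (H : ∀ n, coeff h n = coeff h' n) : h = h' :=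
  HahnSeries.ext (funext H)

theorem coeff_add (h h' : Laur N) (n : ℤ) : coeff (h + h') n = coeff h n + coeff h' n := rfl

theorem coeff_zero (n : ℤ) : coeff (0 : Laur N) n = 0 := rfl

theorem coeff_single (n : ℤ) (a : Conv N) (k : ℤ) :
    coeff (single n a) k = if k = n then a else 0 := by
  by_cases h : k = n
  · subst h
    rw [if_pos rfl]
    exact HahnSeries.coeff_single_same _ _
  · rw [if_neg h]
    exact HahnSeries.coeff_single_of_ne h

theorem single_mul_single (n k : ℤ) (a b : Conv N) :
    single n a * single k b = single (n + k) (a * b) :=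
  HahnSeries.single_mul_single

theorem coeff_smul (c : ℂ) (h : Laur N) (n : ℤ) : coeff (c • h) n = c • coeff h n := by
  rw [Algebra.smul_def, Algebra.smul_def]
  exact HahnSeries.coeff_single_zero_mul

theorem coeff_ofPow (h : Pow N) (n : ℕ) :
    coeff (ofPow h) n = Pow.coeff n h :=
  HahnSeries.ofPowerSeries_apply_coeff _ _

theorem coeff_ofPow_neg (h : Pow N) {n : ℤ} (hn : n < 0) :
    coeff (ofPow h) n = 0 := by
  refine (congrArg (fun x => HahnSeries.coeff x n)
    (HahnSeries.ofPowerSeries_apply h)).trans (HahnSeries.embDomain_of_notMem_range ?_)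
  rintro ⟨k, hk⟩
  have : (k : ℤ) = n := hk
  omega

theorem ofPow_C (f : Conv N) : ofPow (Pow.C f) = C f := HahnSeries.ofPowerSeries_C f

/-- The inclusion of `ℂ{x}[[u]]` as a linear map. -/
def ofPowLin : Pow N →ₗ[ℂ] Laur N where
  toFun := ofPow
  map_add' := map_add ofPow
  map_smul' := fun c h => ext' fun n => by
    rw [RingHom.id_apply, coeff_smul]
    rcases lt_or_ge n 0 with hn | hn
    · rw [coeff_ofPow_neg _ hn, coeff_ofPow_neg _ hn, smul_zero]
    · lift n to ℕ using hn
      rw [coeff_ofPow, coeff_ofPow, Pow.coeff_smul]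

theorem ofPowLin_apply (h : Pow N) : ofPowLin h = ofPow h := rfl

theorem ofPow_algebraMap (c : ℂ) :
    ofPow (algebraMap ℂ (Pow N) c) = algebraMap ℂ (Laur N) c :=
  ofPow_C _

/-- The variable `u`. -/
def u (N : ℕ) : Laur N := single 1 1

/-- The inverse `u⁻¹`. -/
def uInv (N : ℕ) : Laur N := single (-1) 1

theorem ofPow_u : ofPow (Pow.u N) = u N :=
  HahnSeries.ofPowerSeries_X

theorem u_mul_uInv : u N * uInv N = 1 := by
  rw [u, uInv, single_mul_single]
  norm_num
  rfl

theorem leibniz (E : ℤ → Conv N →+ Conv N)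
    (hE : ∀ i j a b, E (i + j) (a * b) = a * E j b + b * E i a) (T : Laur N → Laur N)
    (hT : ∀ h n, coeff (T h) n = E n (coeff h n)) (h h' : Laur N) :
    T (h * h') = h * T h' + h' * T h := by
  have hsub : ∀ h, HahnSeries.support (T h) ⊆ HahnSeries.support h := fun h n hn => by
    refine fun h0 => hn ((hT h n).trans ((congrArg (E n) h0).trans (map_zero (E n))))
  refine ext' fun n => ?_
  rw [mul_comm h' (T h), coeff_add, hT]
  have h1 : coeff (h * h') n = _ := HahnSeries.coeff_mul
  have h2 : coeff (h * T h') n = _ :=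
    HahnSeries.coeff_mul_right' (HahnSeries.isPWO_support h') (hsub h')
  have h3 : coeff (T h * h') n = _ :=
    HahnSeries.coeff_mul_left' (HahnSeries.isPWO_support h) (hsub h)
  rw [h1, h2, h3, map_sum, ← Finset.sum_add_distrib]
  refine Finset.sum_congr rfl fun p hp => ?_
  obtain ⟨-, -, hp⟩ := Finset.mem_antidiagonal.mp hp
  have e1 : HahnSeries.coeff (T h') p.2 = E p.2 (HahnSeries.coeff h' p.2) := hT h' p.2
  have e2 : HahnSeries.coeff (T h) p.1 = E p.1 (HahnSeries.coeff h p.1) := hT h p.1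
  rw [← hp, hE, e1, e2]
  ring

/-- Bundle a coefficientwise operator satisfying the Leibniz rule into a derivation. -/
def mkDerivation (E : ℤ → Conv N →ₗ[ℂ] Conv N)
    (hE : ∀ i j a b, E (i + j) (a * b) = a * E j b + b * E i a) : Derivation ℂ (Laur N) (Laur N) :=
  Derivation.mk'
    { toFun := fun h =>
        ({ coeff := fun n => E n (coeff h n)
           isPWO_support' := (HahnSeries.isPWO_support h).mono fun n hn => by
            exact fun h0 => hn ((congrArg (E n) h0).trans (map_zero (E n))) } :
          HahnSeries ℤ (Conv N))
      map_add' := fun h h' => ext' fun n => map_add (E n) _ _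
      map_smul' := fun c h => ext' fun n => by
        refine Eq.trans ?_ (coeff_smul c _ n).symm
        exact (congrArg (E n) (coeff_smul c h n)).trans (map_smul (E n) c _) }
    (leibniz (fun n => (E n).toAddMonoidHom) hE _ fun _ _ => rfl)

/-- The partial derivative `∂/∂x_i` on `ℂ{x}((u))`. -/
def pderiv (i : Fin N) : Derivation ℂ (Laur N) (Laur N) :=
  mkDerivation (fun _ => (Conv.pderiv i).toLinearMap) fun _ _ a b => (Conv.pderiv i).leibniz a b

/-- The operator `u ∂/∂u` on `ℂ{x}((u))`. -/
def euler (N : ℕ) : Derivation ℂ (Laur N) (Laur N) :=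
  mkDerivation (fun n => (n : ℂ) • LinearMap.id) fun i j a b => by
    simp only [LinearMap.smul_apply, LinearMap.id_apply, Int.cast_add, LinearMap.add_apply,
      add_smul, mul_smul_comm]
    rw [mul_comm b a, add_comm]

theorem coeff_pderiv (i : Fin N) (h : Laur N) (n : ℤ) :
    coeff (pderiv i h) n = Conv.pderiv i (coeff h n) := rfl

theorem coeff_euler (h : Laur N) (n : ℤ) : coeff (euler N h) n = (n : ℂ) • coeff h n := rfl

theorem pderiv_single (i : Fin N) (n : ℤ) (a : Conv N) :
    pderiv i (single n a) = single n (Conv.pderiv i a) := by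
  refine ext' fun k => ?_
  rw [coeff_pderiv, coeff_single, coeff_single]
  split_ifs <;> simp

theorem pderiv_u (i : Fin N) : pderiv i (u N) = 0 := by
  rw [u, pderiv_single, Derivation.map_one_eq_zero]
  exact HahnSeries.single_eq_zero

theorem pderiv_uInv (i : Fin N) : pderiv i (uInv N) = 0 := by
  rw [uInv, pderiv_single, Derivation.map_one_eq_zero]
  exact HahnSeries.single_eq_zero

theorem pderiv_C (i : Fin N) (f : Conv N) : pderiv i (C f) = C (Conv.pderiv i f) :=
  pderiv_single i 0 f

theorem pderiv_ofPow (i : Fin N) (h : Pow N) :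
    pderiv i (ofPow h) = ofPow (Pow.pderiv i h) := by
  refine ext' fun n => ?_
  rw [coeff_pderiv]
  rcases lt_or_ge n 0 with hn | hn
  · rw [coeff_ofPow_neg _ hn, coeff_ofPow_neg _ hn, map_zero]
  · lift n to ℕ using hn
    rw [coeff_ofPow, coeff_ofPow, Pow.coeff_pderiv]

theorem euler_u : euler N (u N) = u N := by
  refine ext' fun k => ?_
  rw [coeff_euler, u, coeff_single]
  split_ifs with h <;> simp [h]

theorem euler_C (f : Conv N) : euler N (C f) = 0 := by
  refine ext' fun k => ?_
  have : coeff (C f) k = if k = 0 then f else 0 := coeff_single 0 f k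
  rw [coeff_euler, this, coeff_zero]
  split_ifs with h <;> simp [h]

theorem euler_pderiv (i : Fin N) (h : Laur N) : euler N (pderiv i h) = pderiv i (euler N h) := by
  refine ext' fun n => ?_
  rw [coeff_euler, coeff_pderiv, coeff_pderiv, coeff_euler, Derivation.map_smul]

end Laur


/-! ### Top cohomology of the twisted de Rham complex -/

section Twisted

variable {K K' A A' : Type} {N : ℕ} [CommRing K] [CommRing A] [Algebra K A]
  [CommRing K'] [CommRing A'] [Algebra K' A']

/-- The last differential `u d - dF ∧ : Ω^{N-1} → Ω^N` of the twisted relative de Rham complex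
with coefficient ring `A`.  An `(N-1)`-form `∑ (-1)^i g_i dx_0 ∧ … (omit dx_i) … ∧ dx_{N-1}` is
given by the family `g`, and an `N`-form `h dx_0 ∧ … ∧ dx_{N-1}` by the coefficient `h`. -/
def twistedDiff (D : Fin N → Derivation K A A) (u F : A) : (Fin N → A) →ₗ[K] A :=
  ∑ i, (LinearMap.mulLeft K u ∘ₗ (D i).toLinearMap - LinearMap.mulLeft K (D i F)) ∘ₗ
    LinearMap.proj i

theorem twistedDiff_apply (D : Fin N → Derivation K A A) (u F : A) (g : Fin N → A) :
    twistedDiff D u F g = ∑ i, (u * D i (g i) - D i F * g i) := by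
  simp [twistedDiff, LinearMap.sum_apply]

/-- The cohomology `H^N` of the twisted de Rham complex: all `N`-forms modulo exact ones. -/
abbrev TopCoh (D : Fin N → Derivation K A A) (u F : A) : Type :=
  A ⧸ LinearMap.range (twistedDiff D u F)

theorem twistedDiff_map {D : Fin N → Derivation K A A} {u F : A}
    {D' : Fin N → Derivation K' A' A'} {u' F' : A'} (θ : A →+ A') (T : A → A')
    (h : ∀ i g, θ (u * D i g - D i F * g) = u' * D' i (T g) - D' i F' * T g) (g : Fin N → A) :
    θ (twistedDiff D u F g) = twistedDiff D' u' F' (fun i => T (g i)) := by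
  simp only [twistedDiff_apply, map_sum, h]

/-- The additive map on cohomology induced by an additive map `θ` of `N`-forms which is
compatible with the differentials (through `T` on `(N-1)`-forms). -/
def descend {D : Fin N → Derivation K A A} {u F : A}
    {D' : Fin N → Derivation K' A' A'} {u' F' : A'} (θ : A →+ A') (T : A → A')
    (h : ∀ i g, θ (u * D i g - D i F * g) = u' * D' i (T g) - D' i F' * T g) :
    TopCoh D u F →+ TopCoh D' u' F' :=
  QuotientAddGroup.map (LinearMap.range (twistedDiff D u F)).toAddSubgroup
    (LinearMap.range (twistedDiff D' u' F')).toAddSubgroup θ (by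
      rintro _ ⟨g, rfl⟩
      exact ⟨_, (twistedDiff_map θ T h g).symm⟩)

theorem descend_mk {D : Fin N → Derivation K A A} {u F : A}
    {D' : Fin N → Derivation K' A' A'} {u' F' : A'} (θ : A →+ A') (T : A → A')
    (h : ∀ i g, θ (u * D i g - D i F * g) = u' * D' i (T g) - D' i F' * T g) (x : A) :
    descend θ T h (Submodule.Quotient.mk x) = Submodule.Quotient.mk (θ x) := rfl

variable [Algebra K A']

/-- The same for `K`-linear maps. -/
def descendLin {D : Fin N → Derivation K A A} {u F : A}
    {D' : Fin N → Derivation K A' A'} {u' F' : A'} (θ : A →ₗ[K] A') (T : A → A')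
    (h : ∀ i g, θ (u * D i g - D i F * g) = u' * D' i (T g) - D' i F' * T g) :
    TopCoh D u F →ₗ[K] TopCoh D' u' F' :=
  Submodule.mapQ _ _ θ (by
    rintro _ ⟨g, rfl⟩
    exact ⟨_, (twistedDiff_map θ.toAddMonoidHom T h g).symm⟩)

/-- Multiplication by an element `c` with `D_i c = 0`. -/
def mulConst (D : Fin N → Derivation K A A) (u F c : A) (hc : ∀ i, D i c = 0) :
    TopCoh D u F →ₗ[K] TopCoh D u F :=
  descendLin (LinearMap.mulLeft K c) (fun g => c * g) fun i g => by
    simp only [LinearMap.mulLeft_apply, Derivation.leibniz, hc, smul_eq_mul]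
    ring

/-- The action of `t`: since `t u^k = u^k t + k u^{k+1}` and `t δ(t - F) = F δ(t - F)`, it sends
the class of `h` to the class of `F h + u (u ∂_u h)`. Here `E` is the derivation `u ∂_u`. -/
def tAction (D : Fin N → Derivation K A A) (u F : A) (E : Derivation K A A)
    (hDE : ∀ i g, E (D i g) = D i (E g)) (hEu : E u = u) (hEF : E F = 0) (hDu : ∀ i, D i u = 0) :
    TopCoh D u F →ₗ[K] TopCoh D u F :=
  descendLin (LinearMap.mulLeft K F + LinearMap.mulLeft K u ∘ₗ E.toLinearMap)
    (fun g => F * g + u * E g + u * g) fun i g => by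
      simp only [LinearMap.add_apply, LinearMap.mulLeft_apply, LinearMap.comp_apply,
        Derivation.coeFn_coe, Derivation.leibniz, map_sub, map_add, hEu, hDE, hDu, hEF,
        map_zero, smul_eq_mul]
      ring

/-- The action of `∂_s`: since `∂_s δ(t - F) = -(∂F/∂s) u⁻¹ δ(t - F)`, it sends the class of `h`
to the class of `∂_s h - (∂F/∂s) u⁻¹ h`. Here `P` is the derivation `∂_s` and `v = u⁻¹`. -/
def sAction {R : Type} [CommRing R] [Algebra R A] (D : Fin N → Derivation K A A) (u F v : A)
    (P : Derivation R A A) (hDP : ∀ i g, P (D i g) = D i (P g)) (hPu : P u = 0) (huv : u * v = 1)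
    (hDv : ∀ i, D i v = 0) :
    TopCoh D u F →+ TopCoh D u F :=
  descend (P.toLinearMap.toAddMonoidHom - AddMonoidHom.mulLeft (P F * v))
    (fun g => P g - P F * v * g) fun i g => by
      simp only [AddMonoidHom.sub_apply, AddMonoidHom.coe_mulLeft, LinearMap.toAddMonoidHom_coe,
        Derivation.coeFn_coe, Derivation.leibniz, map_sub, hPu, hDP, hDv, smul_eq_mul, mul_zero,
        zero_add, add_zero]
      linear_combination (g * D i (P F)) * huv

end Twisted

/-! ### Exponentials -/

section Exponential

theorem coeff_pow_of_degree_lt {σ R : Type} [CommRing R] {y : MvPowerSeries σ R} (hy : MvPowerSeries.constantCoeff y = 0)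
    (a : σ →₀ ℕ) (j : ℕ) (hj : a.degree < j) : MvPowerSeries.coeff a (y ^ j) = 0 := by
  apply MvPowerSeries.coeff_of_lt_order
  have h1 : (j : ℕ∞) ≤ (y ^ j).order := by
    have h2 := MvPowerSeries.le_order_pow (f := y) j
    have h3 : 1 ≤ y.order := by
      rw [MvPowerSeries.one_le_order_iff_constCoeff_eq_zero]
      exact hy
    calc (j : ℕ∞) = j • 1 := by simp
      _ ≤ j • y.order := by gcongr
      _ ≤ _ := h2
  exact lt_of_lt_of_le (by exact_mod_cast hj) h1

variable {R σ : Type} [CommRing R] [Algebra ℂ R]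

/-- The exponential `e^y = ∑ y^j / j!` of a power series `y` in `s` without constant term. -/
def expSeries (y : MvPowerSeries σ R) : MvPowerSeries σ R :=
  (PowerSeries.exp ℂ).subst y

/-- The truncated exponential. -/
def expTrunc (y : MvPowerSeries σ R) (M : ℕ) : MvPowerSeries σ R :=
  ∑ j ∈ Finset.range M, (algebraMap ℚ ℂ (1 / (j.factorial : ℚ))) • y ^ j

theorem coeff_expSeries {y : MvPowerSeries σ R} (hy : MvPowerSeries.constantCoeff y = 0)
    (a : σ →₀ ℕ) (M : ℕ) (hM : a.degree < M) :
    MvPowerSeries.coeff a (expSeries y) = MvPowerSeries.coeff a (expTrunc y M) := by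
  rw [expSeries, PowerSeries.coeff_subst (PowerSeries.HasSubst.of_constantCoeff_zero hy),
    finsum_eq_sum_of_support_subset (s := Finset.range M), expTrunc, map_sum]
  · exact Finset.sum_congr rfl fun j _ => by rw [PowerSeries.coeff_exp]; rfl
  · intro j hj
    by_contra hj'
    rw [Finset.coe_range, Set.mem_Iio, not_lt] at hj'
    exact hj (by dsimp only; rw [coeff_pow_of_degree_lt hy a j (by omega), smul_zero])

theorem extendBase_expTrunc (D : Derivation ℂ R R) (y : MvPowerSeries σ R) (M : ℕ) :
    coeffwise D (expTrunc y (M + 1)) = coeffwise D y * expTrunc y M := by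
  have hD : ∀ h, extendBase σ D h = coeffwise D h := fun _ => rfl
  have hsm : ∀ (c : ℂ) (h : MvPowerSeries σ R), coeffwise D (c • h) = c • coeffwise D h := fun c h => by
    ext a
    exact D.map_smul c _
  rw [expTrunc, Finset.sum_range_succ', ← hD, map_add, map_sum, expTrunc, Finset.mul_sum]
  have h0 : extendBase σ D (algebraMap ℚ ℂ (1 / ((0 : ℕ).factorial : ℚ)) • y ^ 0) = 0 := by
    rw [hD, hsm, ← hD, pow_zero, Derivation.map_one_eq_zero, smul_zero]
  rw [h0, add_zero]
  refine Finset.sum_congr rfl fun j _ => ?_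
  rw [hD, hsm, ← hD, Derivation.leibniz_pow, hD, Nat.add_sub_cancel, mul_smul_comm,
    ← Nat.cast_smul_eq_nsmul ℂ, smul_smul, smul_eq_mul, mul_comm (y ^ j)]
  congr 1
  rw [Nat.factorial_succ]
  push_cast
  have : ((j : ℂ) + 1) ≠ 0 := by exact_mod_cast Nat.succ_ne_zero j
  have : (j.factorial : ℂ) ≠ 0 := by exact_mod_cast Nat.factorial_ne_zero j
  simp
  field_simp

theorem extendBase_expSeries (D : Derivation ℂ R R) {y : MvPowerSeries σ R}
    (hy : MvPowerSeries.constantCoeff y = 0) :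
    extendBase σ D (expSeries y) = extendBase σ D y * expSeries y := by
  classical
  change coeffwise D (expSeries y) = coeffwise D y * expSeries y
  ext a
  rw [coeff_coeffwise, coeff_expSeries hy a (a.degree + 1 + 1) (by omega), ← coeff_coeffwise,
    extendBase_expTrunc, MvPowerSeries.coeff_mul, MvPowerSeries.coeff_mul]
  refine Finset.sum_congr rfl fun p hp => ?_
  rw [coeff_expSeries hy p.2 (a.degree + 1)]
  have h4 := Finset.HasAntidiagonal.mem_antidiagonal.mp hp
  rw [← h4, map_add]
  omega

end Exponential

/-! ### Formal Gauss-Manin systems and Brieskorn lattices -/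

section Systems

variable {N : ℕ} {σ : Type}

theorem extendBase_C {R : Type} [CommRing R] [Algebra ℂ R] (D : Derivation ℂ R R) (r : R) :
    extendBase σ D (MvPowerSeries.C r) = MvPowerSeries.C (D r) := by
  classical
  ext a
  change D (MvPowerSeries.coeff a (MvPowerSeries.C r)) = _
  rw [MvPowerSeries.coeff_C, MvPowerSeries.coeff_C]
  split_ifs <;> simp

theorem constantCoeff_extendBase {R : Type} [CommRing R] [Algebra ℂ R] (D : Derivation ℂ R R)
    (h : MvPowerSeries σ R) :
    MvPowerSeries.constantCoeff (extendBase σ D h) = D (MvPowerSeries.constantCoeff h) := rfl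

theorem pderiv_extendBase {R : Type} [CommRing R] [Algebra ℂ R] (D : Derivation ℂ R R) (j : σ)
    (h : MvPowerSeries σ R) :
    MvPowerSeries.pderiv R j (extendBase σ D h) = extendBase σ D (MvPowerSeries.pderiv R j h) := by
  ext a
  rw [MvPowerSeries.coeff_pderiv]
  change D _ * _ = D (MvPowerSeries.coeff a (MvPowerSeries.pderiv R j h))
  rw [MvPowerSeries.coeff_pderiv, Derivation.leibniz]
  have : D ((a j : R) + 1) = 0 := by simp
  rw [this, smul_zero, zero_add, smul_eq_mul, mul_comm]

theorem ofPow_twisted (f : Conv N) (i : Fin N) (g : Pow N) :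
    Laur.ofPowLin ((Pow.u N) * Pow.pderiv i g - Pow.pderiv i (Pow.C f) * g) =
      Laur.u N * Laur.pderiv i (Laur.ofPow g) - Laur.pderiv i (Laur.C f) * Laur.ofPow g := by
  rw [Laur.ofPowLin_apply, map_sub, map_mul, map_mul, Laur.ofPow_u, Pow.pderiv_C, Laur.ofPow_C,
    Laur.pderiv_ofPow, Laur.pderiv_C]

theorem map_ofPow_algebraMap (c : MvPowerSeries σ ℂ) :
    MvPowerSeries.map Laur.ofPow
      (algebraMap (MvPowerSeries σ ℂ) (MvPowerSeries σ (Pow N)) c) =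
      algebraMap (MvPowerSeries σ ℂ) (MvPowerSeries σ (Laur N)) c := by
  ext1 a
  rw [MvPowerSeries.coeff_map, MvPowerSeries.algebraMap_apply'', MvPowerSeries.algebraMap_apply'',
    MvPowerSeries.coeff_map, MvPowerSeries.coeff_map, Laur.ofPow_algebraMap]

/-- The inclusion of `ℂ{x}[[u]][[s]]` into `ℂ{x}((u))[[s]]` as a linear map. -/
def mapOfPow (N : ℕ) (σ : Type) : MvPowerSeries σ (Pow N) →ₗ[MvPowerSeries σ ℂ]
    MvPowerSeries σ (Laur N) where
  toFun := MvPowerSeries.map (Laur.ofPow (N := N))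
  map_add' := map_add _
  map_smul' := fun c h => by
    rw [Algebra.smul_def, map_mul, map_ofPow_algebraMap, RingHom.id_apply, Algebra.smul_def]

theorem mapOfPow_apply (h : MvPowerSeries σ (Pow N)) :
    mapOfPow N σ h = MvPowerSeries.map Laur.ofPow h := rfl

/-! For a single function `f ∈ ℂ{x}`. -/

/-- The formal Gauss-Manin system of `f`: top cohomology of `(Ω((u)), ud - df∧)`. -/
abbrev GaussManin₀ (f : Conv N) : Type :=
  TopCoh (fun i => Laur.pderiv i) (Laur.u N) (Laur.C f)

/-- The formal Brieskorn lattice of `f`: top cohomology of `(Ω[[u]], ud - df∧)`. -/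
abbrev Brieskorn₀ (f : Conv N) : Type :=
  TopCoh (fun i => Pow.pderiv i) (Pow.u N) (Pow.C f)

/-- The class `[h ω₀]` in the Brieskorn lattice, `ω₀ = dx_0 ∧ … ∧ dx_{N-1}`. -/
def Brieskorn₀.cls (f h : Conv N) : Brieskorn₀ f :=
  Submodule.Quotient.mk (Pow.C h)

/-- The canonical map from the Brieskorn lattice to the Gauss-Manin system. -/
def Brieskorn₀.toGM (f : Conv N) : Brieskorn₀ f →ₗ[ℂ] GaussManin₀ f :=
  descendLin Laur.ofPowLin Laur.ofPow (ofPow_twisted f)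

/-- The action of `u = ∂_t⁻¹` on the Brieskorn lattice. -/
def Brieskorn₀.uMul (f : Conv N) : Brieskorn₀ f →ₗ[ℂ] Brieskorn₀ f :=
  mulConst _ _ _ (Pow.u N) Pow.pderiv_u

/-- The action of `u = ∂_t⁻¹` on the Gauss-Manin system. -/
def GaussManin₀.uMul (f : Conv N) : GaussManin₀ f →ₗ[ℂ] GaussManin₀ f :=
  mulConst _ _ _ (Laur.u N) Laur.pderiv_u

/-- The action of `u⁻¹ = ∂_t` on the Gauss-Manin system. -/
def GaussManin₀.uInvMul (f : Conv N) : GaussManin₀ f →ₗ[ℂ] GaussManin₀ f :=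
  mulConst _ _ _ (Laur.uInv N) Laur.pderiv_uInv

/-- The action of `t` on the Gauss-Manin system. -/
def GaussManin₀.t (f : Conv N) : GaussManin₀ f →ₗ[ℂ] GaussManin₀ f :=
  tAction _ _ _ (Laur.euler N) Laur.euler_pderiv Laur.euler_u (Laur.euler_C f) Laur.pderiv_u

/-- `Ω_f = H''_f / ∂_t⁻¹ H''_f`. -/
abbrev Omega₀ (f : Conv N) : Type := Brieskorn₀ f ⧸ LinearMap.range (Brieskorn₀.uMul f)

/-- The projection `H''_f → Ω_f`. -/
def pr₀ (f : Conv N) : Brieskorn₀ f →ₗ[ℂ] Omega₀ f := Submodule.mkQ _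

/-! For a deformation `F ∈ ℂ{x}[[s]]` over the formal base with coordinates `s = (s_j)_{j ∈ σ}`. -/

/-- `F` viewed in `ℂ{x}((u))[[s]]`. -/
def inLaur (F : MvPowerSeries σ (Conv N)) : MvPowerSeries σ (Laur N) :=
  MvPowerSeries.map Laur.C F

/-- `F` viewed in `ℂ{x}[[u]][[s]]`. -/
def inPow (F : MvPowerSeries σ (Conv N)) : MvPowerSeries σ (Pow N) :=
  MvPowerSeries.map Pow.C F

theorem extendBase_map (i : Fin N) (h : MvPowerSeries σ (Pow N)) :
    MvPowerSeries.map Laur.ofPow (extendBase σ (Pow.pderiv i) h) =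
      extendBase σ (Laur.pderiv i) (MvPowerSeries.map Laur.ofPow h) := by
  ext1 a
  exact (Laur.pderiv_ofPow i _).symm

theorem map_inPow (F : MvPowerSeries σ (Conv N)) :
    MvPowerSeries.map Laur.ofPow (inPow F) = inLaur F := by
  ext1 a
  exact Laur.ofPow_C _

theorem ringHom_twisted {A A' : Type} [CommRing A] [CommRing A'] (θ : A →+* A') (D : A → A)
    (D' : A' → A') (hD : ∀ x, θ (D x) = D' (θ x)) {u F : A} {u' F' : A'} (hu : θ u = u')
    (hF : θ F = F') (g : A) : θ (u * D g - D F * g) = u' * D' (θ g) - D' F' * θ g := by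
  rw [map_sub, map_mul, map_mul, hD, hD, hu, hF]

theorem map_C_X :
    MvPowerSeries.map Laur.ofPow
      (MvPowerSeries.C (Pow.u N) : MvPowerSeries σ _) =
      MvPowerSeries.C (Laur.u N) := by
  rw [MvPowerSeries.map_C, Laur.ofPow_u]

theorem mapOfPow_twisted (F : MvPowerSeries σ (Conv N)) (i : Fin N)
    (g : MvPowerSeries σ (Pow N)) :
    mapOfPow N σ (MvPowerSeries.C (Pow.u N) * extendBase σ (Pow.pderiv i) g -
        extendBase σ (Pow.pderiv i) (inPow F) * g) =
      MvPowerSeries.C (Laur.u N) * extendBase σ (Laur.pderiv i) (mapOfPow N σ g) -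
        extendBase σ (Laur.pderiv i) (inLaur F) * mapOfPow N σ g :=
  ringHom_twisted (MvPowerSeries.map Laur.ofPow) (fun x => extendBase σ (Pow.pderiv i) x)
    (fun x => extendBase σ (Laur.pderiv i) x) (extendBase_map i) map_C_X (map_inPow F) g

/-- The formal Gauss-Manin system of `F`: top cohomology of `(Ω((u))[[s]], ud - dF∧)`, where `d`
is relative to the base. -/
abbrev GaussManinSystem (F : MvPowerSeries σ (Conv N)) : Type :=
  TopCoh (fun i => extendBase σ (Laur.pderiv i)) (MvPowerSeries.C (Laur.u N)) (inLaur F)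

/-- The formal Brieskorn lattice of `F`: top cohomology of `(Ω[[u]][[s]], ud - dF∧)`. -/
abbrev BrieskornLattice (F : MvPowerSeries σ (Conv N)) : Type :=
  TopCoh (fun i => extendBase σ (Pow.pderiv i)) (MvPowerSeries.C (Pow.u N)) (inPow F)

namespace BrieskornLattice

variable (F : MvPowerSeries σ (Conv N))

/-- The class `[h ω₀]_F`. -/
def cls (h : MvPowerSeries σ (Conv N)) : BrieskornLattice F :=
  Submodule.Quotient.mk (inPow h)

/-- The canonical map from the Brieskorn lattice to the Gauss-Manin system. -/
def toGM : BrieskornLattice F →ₗ[MvPowerSeries σ ℂ] GaussManinSystem F :=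
  descendLin (mapOfPow N σ) (mapOfPow N σ) (mapOfPow_twisted F)

/-- The action of `u = ∂_t⁻¹`. -/
def uMul : BrieskornLattice F →ₗ[MvPowerSeries σ ℂ] BrieskornLattice F :=
  mulConst _ _ _ (MvPowerSeries.C (Pow.u N)) fun i => by
    rw [extendBase_C, Pow.pderiv_u, map_zero]

/-- Restriction to `s = 0`. -/
def restrict {f : Conv N} (hF : MvPowerSeries.constantCoeff F = f) :
    BrieskornLattice F →+ Brieskorn₀ f :=
  descend (MvPowerSeries.constantCoeff (σ := σ) (R := Pow N)).toAddMonoidHom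
    (MvPowerSeries.constantCoeff (σ := σ) (R := Pow N)) fun i g => by
      have h1 : MvPowerSeries.constantCoeff (inPow F) = Pow.C f := by
        rw [← hF]
        rfl
      change MvPowerSeries.constantCoeff _ = _
      rw [map_sub, map_mul, map_mul, constantCoeff_extendBase, constantCoeff_extendBase, h1,
        MvPowerSeries.constantCoeff_C]

end BrieskornLattice

namespace GaussManinSystem

variable (F : MvPowerSeries σ (Conv N))

/-- The action of `u = ∂_t⁻¹`. -/
def uMul : GaussManinSystem F →ₗ[MvPowerSeries σ ℂ] GaussManinSystem F :=
  mulConst _ _ _ (MvPowerSeries.C (Laur.u N)) fun i => by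
    rw [extendBase_C, Laur.pderiv_u, map_zero]

/-- The action of `u⁻¹ = ∂_t`. -/
def uInvMul : GaussManinSystem F →ₗ[MvPowerSeries σ ℂ] GaussManinSystem F :=
  mulConst _ _ _ (MvPowerSeries.C (Laur.uInv N)) fun i => by
    rw [extendBase_C, Laur.pderiv_uInv, map_zero]

/-- The action of `t`. -/
def t : GaussManinSystem F →ₗ[MvPowerSeries σ ℂ] GaussManinSystem F :=
  tAction _ _ _ (extendBase σ (Laur.euler N))
    (fun i g => by
      ext1 a
      exact Laur.euler_pderiv i _)
    (by rw [extendBase_C, Laur.euler_u])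
    (by
      ext1 a
      exact Laur.euler_C _)
    (fun i => by rw [extendBase_C, Laur.pderiv_u, map_zero])

/-- The action of `∂/∂s_j`. -/
def dS (j : σ) : GaussManinSystem F →+ GaussManinSystem F :=
  sAction _ _ _ (MvPowerSeries.C (Laur.uInv N)) (MvPowerSeries.pderiv (Laur N) j)
    (fun i g => pderiv_extendBase (Laur.pderiv i) j g)
    MvPowerSeries.pderiv_C
    (by rw [← map_mul, Laur.u_mul_uInv, map_one])
    (fun i => by rw [extendBase_C, Laur.pderiv_uInv, map_zero])

/-- The inclusion of the Gauss-Manin system of `f` into that of the trivial deformation of `f`. -/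
def ι (f : Conv N) :
    GaussManin₀ f →+ GaussManinSystem (MvPowerSeries.C f : MvPowerSeries σ (Conv N)) :=
  descend (MvPowerSeries.C (σ := σ) (R := Laur N)).toAddMonoidHom
    (MvPowerSeries.C (σ := σ) (R := Laur N)) fun i g => by
      change MvPowerSeries.C _ = _
      rw [map_sub, map_mul, map_mul, inLaur, MvPowerSeries.map_C, extendBase_C, extendBase_C]

/-- The exponent `(f - F) / u`. -/
def exponent (f : Conv N) : MvPowerSeries σ (Laur N) :=
  MvPowerSeries.C (Laur.uInv N) * (inLaur (MvPowerSeries.C f) - inLaur F)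

variable {F} in
theorem constantCoeff_exponent {f : Conv N} (hF : MvPowerSeries.constantCoeff F = f) :
    MvPowerSeries.constantCoeff (exponent F f) = 0 := by
  have h1 : MvPowerSeries.constantCoeff (inLaur F) = Laur.C f := by
    rw [← hF]
    rfl
  rw [exponent, map_mul, map_sub, h1, inLaur, MvPowerSeries.map_C, MvPowerSeries.constantCoeff_C,
    MvPowerSeries.constantCoeff_C, sub_self, mul_zero]

/-- The exponential operator `Φ = e^{(f - F)/u}` from the Gauss-Manin system of `F` to that of the
trivial deformation of `f = F|_{s = 0}`. -/
def Φ {f : Conv N} (hF : MvPowerSeries.constantCoeff F = f) :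
    GaussManinSystem F →ₗ[MvPowerSeries σ ℂ]
      GaussManinSystem (MvPowerSeries.C f : MvPowerSeries σ (Conv N)) :=
  descendLin (LinearMap.mulLeft _ (expSeries (exponent F f)))
    (fun g => expSeries (exponent F f) * g) fun i g => by
      have h1 := extendBase_expSeries (Laur.pderiv i) (constantCoeff_exponent hF)
      have h2 : MvPowerSeries.C (Laur.u N) * extendBase σ (Laur.pderiv i) (exponent F f) =
          extendBase σ (Laur.pderiv i) (inLaur (MvPowerSeries.C f)) -
            extendBase σ (Laur.pderiv i) (inLaur F) := by
        rw [exponent, Derivation.leibniz, extendBase_C, Laur.pderiv_uInv, map_zero, smul_zero,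
          add_zero, smul_eq_mul, ← mul_assoc, ← map_mul, Laur.u_mul_uInv, map_one, one_mul,
          map_sub]
      rw [LinearMap.mulLeft_apply, Derivation.leibniz, h1, smul_eq_mul, smul_eq_mul]
      linear_combination (-(expSeries (exponent F f)) * g) * h2

end GaussManinSystem

/-- `Ω_F = H''_F / ∂_t⁻¹ H''_F`. -/
abbrev Omega (F : MvPowerSeries σ (Conv N)) : Type :=
  BrieskornLattice F ⧸ LinearMap.range (BrieskornLattice.uMul F)

/-- The projection `H''_F → Ω_F`. -/
def pr (F : MvPowerSeries σ (Conv N)) :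
    BrieskornLattice F →ₗ[MvPowerSeries σ ℂ] Omega F := Submodule.mkQ _

end Systems

/-! ### Good sections and formal primitive forms -/

section Sections

variable {N : ℕ} {σ : Type}

/-- A section of `pr₀` whose image `I₀` satisfies `t I₀ ⊆ I₀ + ∂_t⁻¹ I₀`. -/
structure IsGoodSection₀ {f : Conv N} (σ₀ : Omega₀ f →ₗ[ℂ] Brieskorn₀ f) : Prop where
  isSection : ∀ w, pr₀ f (σ₀ w) = w
  t_mem : ∀ w, ∃ w₀ w₁, GaussManin₀.t f (Brieskorn₀.toGM f (σ₀ w)) =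
    Brieskorn₀.toGM f (σ₀ w₀) + GaussManin₀.uMul f (Brieskorn₀.toGM f (σ₀ w₁))

/-- A section of `pr` whose image `I` satisfies `t I ⊆ I + ∂_t⁻¹ I` and
`∂_{s_j} I ⊆ I + ∂_t I`. -/
structure IsGoodSection {F : MvPowerSeries σ (Conv N)}
    (σS : Omega F →ₗ[MvPowerSeries σ ℂ] BrieskornLattice F) : Prop where
  isSection : ∀ w, pr F (σS w) = w
  t_mem : ∀ w, ∃ w₀ w₁, GaussManinSystem.t F (BrieskornLattice.toGM F (σS w)) =
    BrieskornLattice.toGM F (σS w₀) +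
      GaussManinSystem.uMul F (BrieskornLattice.toGM F (σS w₁))
  dS_mem : ∀ j w, ∃ w₀ w₁, GaussManinSystem.dS F j (BrieskornLattice.toGM F (σS w)) =
    BrieskornLattice.toGM F (σS w₀) +
      GaussManinSystem.uInvMul F (BrieskornLattice.toGM F (σS w₁))

/-- `σS` restricts to `σ₀` at `s = 0`. -/
def Extends {F : MvPowerSeries σ (Conv N)} {f : Conv N}
    (hF : MvPowerSeries.constantCoeff F = f)
    (σS : Omega F →ₗ[MvPowerSeries σ ℂ] BrieskornLattice F)
    (σ₀ : Omega₀ f →ₗ[ℂ] Brieskorn₀ f) : Prop :=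
  ∀ w : BrieskornLattice F, BrieskornLattice.restrict F hF (σS (pr F w)) =
    σ₀ (pr₀ f (BrieskornLattice.restrict F hF w))

/-- `τ` is the flat lift of `σ₀`: a `ℂ`-linear lift with `Im τ ⊆ Im σS` and
`∂_{s_j} Im τ ⊆ ∂_t Im σS`. -/
structure IsFlatLift {F : MvPowerSeries σ (Conv N)} {f : Conv N}
    (hF : MvPowerSeries.constantCoeff F = f)
    (σS : Omega F →ₗ[MvPowerSeries σ ℂ] BrieskornLattice F)
    (σ₀ : Omega₀ f →ₗ[ℂ] Brieskorn₀ f)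
    (τ : Omega₀ f →ₛₗ[(MvPowerSeries.C : ℂ →+* MvPowerSeries σ ℂ)] BrieskornLattice F) :
    Prop where
  restrict_eq : ∀ w, BrieskornLattice.restrict F hF (τ w) = σ₀ w
  mem_range : ∀ w, ∃ w', τ w = σS w'
  dS_mem : ∀ j w, ∃ w', GaussManinSystem.dS F j (BrieskornLattice.toGM F (τ w)) =
    GaussManinSystem.uInvMul F (BrieskornLattice.toGM F (σS w'))

/-- `ζ₀ ∈ Ω_f` is an eigenvector of `A₁`, where `t σ₀ = σ₀ A₀ + ∂_t⁻¹ σ₀ A₁`, and generates `Ω_f`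
over `ℂ{x}`. -/
structure IsPrimitiveVector {f : Conv N} (σ₀ : Omega₀ f →ₗ[ℂ] Brieskorn₀ f) (ζ₀ : Omega₀ f) :
    Prop where
  ne_zero : ζ₀ ≠ 0
  eigen : ∃ (α : ℂ) (w₀ : Omega₀ f), GaussManin₀.t f (Brieskorn₀.toGM f (σ₀ ζ₀)) =
    Brieskorn₀.toGM f (σ₀ w₀) + GaussManin₀.uMul f (Brieskorn₀.toGM f (σ₀ (α • ζ₀)))
  generates : ∃ g : Conv N, ζ₀ = pr₀ f (Brieskorn₀.cls f g) ∧
    ∀ w : Omega₀ f, ∃ h : Conv N, w = pr₀ f (Brieskorn₀.cls f (h * g))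

/-- `ζ` is the formal primitive form associated with `σ₀` and `ζ₀`: the value at `ζ₀` of the flat
lift of `σ₀` for a good section extending `σ₀`. -/
def IsFormalPrimitiveForm {F : MvPowerSeries σ (Conv N)} {f : Conv N}
    (hF : MvPowerSeries.constantCoeff F = f) (σ₀ : Omega₀ f →ₗ[ℂ] Brieskorn₀ f)
    (ζ₀ : Omega₀ f) (ζ : BrieskornLattice F) : Prop :=
  IsGoodSection₀ σ₀ ∧ IsPrimitiveVector σ₀ ζ₀ ∧
    ∃ σS : Omega F →ₗ[MvPowerSeries σ ℂ] BrieskornLattice F,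
    ∃ τ : Omega₀ f →ₛₗ[(MvPowerSeries.C : ℂ →+* MvPowerSeries σ ℂ)] BrieskornLattice F,
      IsGoodSection σS ∧ Extends hF σS σ₀ ∧ IsFlatLift hF σS σ₀ τ ∧ ζ = τ ζ₀

/-- The subspace `u⁻¹ I[u⁻¹]` of the Gauss-Manin system of `f`. -/
def polarPart {f : Conv N} (I : Submodule ℂ (Brieskorn₀ f)) : Submodule ℂ (GaussManin₀ f) :=
  ⨆ j : ℕ, I.map ((GaussManin₀.uInvMul f ^ (j + 1)) ∘ₗ Brieskorn₀.toGM f)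

/-- The elements of `ι(V)[[s]]` in the Gauss-Manin system of the trivial deformation of `f`: series
in `s` whose coefficients have classes in `V`. -/
def seriesIn {f : Conv N} (V : Submodule ℂ (GaussManin₀ f)) :
    Set (GaussManinSystem (MvPowerSeries.C f : MvPowerSeries σ (Conv N))) :=
  {w | ∃ h : MvPowerSeries σ (Laur N), Submodule.Quotient.mk h = w ∧
    ∀ a, (Submodule.Quotient.mk (MvPowerSeries.coeff a h) : GaussManin₀ f) ∈ V}

/-- The congruence `Φ(ζ) = ι(ζ₀)` modulo `ι(u⁻¹ I₀[u⁻¹])[[s]]`. -/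
def PhiCongruence {F : MvPowerSeries σ (Conv N)} {f : Conv N}
    (hF : MvPowerSeries.constantCoeff F = f) (I₀ : Submodule ℂ (Brieskorn₀ f))
    (ζ₀ : Brieskorn₀ f) (ζ : BrieskornLattice F) : Prop :=
  GaussManinSystem.Φ F hF (BrieskornLattice.toGM F ζ) -
    GaussManinSystem.ι f (Brieskorn₀.toGM f ζ₀) ∈ seriesIn (polarPart I₀)

end Sections

/-! ### Brieskorn-Pham polynomials -/

section BrieskornPham

variable {n : ℕ} (m : Fin (n + 1) → ℕ)

/-- The index set `Γ = ∏ [0, m_i - 2]`. -/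
abbrev Gam : Type := (i : Fin (n + 1)) → Fin (m i - 1)

/-- The monomial `x^ν`. -/
def xpow {N : ℕ} (ν : Fin N → ℕ) : Conv N := ∏ i, Conv.X i ^ ν i

/-- The polynomial `f = ∑ x_i^{m_i}`. -/
def bp : Conv (n + 1) := ∑ i, Conv.X i ^ m i

/-- The miniversal deformation `F = f + ∑_{ν ∈ Γ} x^ν s_ν`. -/
def bpDeformation : MvPowerSeries (Gam m) (Conv (n + 1)) :=
  MvPowerSeries.C (bp m) +
    ∑ ν : Gam m, MvPowerSeries.C (xpow fun i => (ν i : ℕ)) * MvPowerSeries.X ν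

theorem constantCoeff_bpDeformation :
    MvPowerSeries.constantCoeff (bpDeformation m) = bp m := by
  rw [bpDeformation, map_add, MvPowerSeries.constantCoeff_C, map_sum,
    Finset.sum_eq_zero, add_zero]
  intro ν _
  rw [map_mul, MvPowerSeries.constantCoeff_X, mul_zero]

/-- The subspace `I₀ = ∑_{ν ∈ Γ} ℂ [x^ν ω₀]` of the Brieskorn lattice of `f`. -/
def bpI₀ : Submodule ℂ (Brieskorn₀ (bp m)) :=
  Submodule.span ℂ
    (Set.range fun ν : Gam m => Brieskorn₀.cls (bp m) (xpow fun i => (ν i : ℕ)))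

/-- `σ₀` is the canonical section: the section of `pr₀` with image `I₀`. -/
def IsCanonicalSection (σ₀ : Omega₀ (bp m) →ₗ[ℂ] Brieskorn₀ (bp m)) : Prop :=
  (∀ w, pr₀ (bp m) (σ₀ w) = w) ∧ LinearMap.range σ₀ = bpI₀ m

/-- The class `[ω₀]` in the Brieskorn lattice of `f`. -/
def bpOmega : Brieskorn₀ (bp m) := Brieskorn₀.cls (bp m) 1

variable {m}

/-- `p(a)_i = ∑_ν ν_i a_ν`. -/
def pExp (a : Gam m →₀ ℕ) (i : Fin (n + 1)) : ℕ := ∑ ν : Gam m, (ν i : ℕ) * a ν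

/-- `q(a)_i = ⌊p(a)_i / m_i⌋`. -/
def qExp (a : Gam m →₀ ℕ) (i : Fin (n + 1)) : ℕ := pExp a i / m i

/-- `r(a)_i`, the remainder of `p(a)_i` modulo `m_i`. -/
def rExp (a : Gam m →₀ ℕ) (i : Fin (n + 1)) : ℕ := pExp a i % m i

/-- `e_a = ∑_i q(a)_i - |a|`. -/
def eExp (a : Gam m →₀ ℕ) : ℤ := (∑ i, (qExp a i : ℤ)) - ∑ ν, (a ν : ℤ)

/-- `q(a,b)_i = ⌊(r(b)_i + p(a-b)_i) / m_i⌋`. -/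
def qExp₂ (a b : Gam m →₀ ℕ) (i : Fin (n + 1)) : ℕ := (rExp b i + pExp (a - b) i) / m i

variable (m) in
open Classical in
/-- The set `A'_k` of all `a` with `|a| ≤ k`, `e_a ≥ 0` and `r(a) ∈ Γ`. -/
def indexSet (k : ℕ) : Finset (Gam m →₀ ℕ) :=
  ((Finset.range (k + 1)).biUnion fun d => Finset.univ.finsuppAntidiag d).filter
    fun a => 0 ≤ eExp a ∧ ∃ γ : Gam m, ∀ i, rExp a i = γ i

theorem mem_indexSet (k : ℕ) (a : Gam m →₀ ℕ) :
    a ∈ indexSet m k ↔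
      ∑ ν, a ν ≤ k ∧ 0 ≤ eExp a ∧ ∃ γ : Gam m, ∀ i, rExp a i = γ i := by
  classical
  simp only [indexSet, Finset.mem_filter, Finset.mem_biUnion, Finset.mem_range,
    Finset.mem_finsuppAntidiag]
  constructor
  · rintro ⟨⟨d, hd, h, -⟩, h'⟩
    exact ⟨(le_of_eq h).trans (Nat.le_of_lt_succ hd), h'⟩
  · rintro ⟨h, h'⟩
    exact ⟨⟨_, Nat.lt_succ_of_le h, rfl, Finset.subset_univ _⟩, h'⟩

/-- The element `∂_t^{-e_a} [x^{r(a)} s^a ω₀]_F` of the Brieskorn lattice of `F`. -/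
def taylorTerm (a : Gam m →₀ ℕ) : BrieskornLattice (bpDeformation m) :=
  (BrieskornLattice.uMul (bpDeformation m) ^ (eExp a).toNat)
    (BrieskornLattice.cls (bpDeformation m) (MvPowerSeries.monomial a (xpow (rExp a))))

/-- The expansion `ζ = ∑_{a ∈ A'_k} c_a ∂_t^{-e_a} [x^{r(a)} s^a ω₀]_F` modulo `𝔪₀^{k+1}`. -/
def HasTaylorExpansion (ζ : BrieskornLattice (bpDeformation m)) (k : ℕ)
    (c : (Gam m →₀ ℕ) → ℂ) : Prop :=
  ζ ≡ ∑ a ∈ indexSet m k, (MvPowerSeries.C (c a) : MvPowerSeries (Gam m) ℂ) • taylorTerm a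
    [SMOD (IsLocalRing.maximalIdeal (MvPowerSeries (Gam m) ℂ) ^ (k + 1) •
      (⊤ : Submodule (MvPowerSeries (Gam m) ℂ) (BrieskornLattice (bpDeformation m))))]

open Classical in
/-- The recursion for the coefficients `c_a`, `a ∈ A'_k`, with initial value `c_0 = 1`. -/
def SatisfiesRecursion (k : ℕ) (c : (Gam m →₀ ℕ) → ℂ) : Prop :=
  c 0 = 1 ∧ ∀ a ∈ indexSet m k, a ≠ 0 →
    c a = -∑ b ∈ (indexSet m k).filter (fun b => b < a),
      (-1) ^ (∑ ν, (a - b) ν) * (c b / ((∏ ν, ((a - b) ν).factorial : ℕ) : ℂ)) *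
        ∏ i, ∏ l ∈ Finset.Icc 1 (qExp₂ a b i),
          ((rExp b i : ℂ) + (pExp (a - b) i : ℂ) - (l : ℂ) * (m i : ℂ) + 1) / (m i : ℂ)

end BrieskornPham

end GaussManin

end

/-! Everything is read in coordinates adapted to monomials. In the system of `f` the relation [∂_i f
· g] = u[∂_i g] says on monomials that x^{μ + m_i e_i} ≡ u (μ_i + 1)/m_i · x^μ, while x^μ ≡ 0 as
soon as some μ_i ≡ -1 mod m_i. Iterating it moves every monomial to some x^ν u^k with ν in Γ; the
accumulated scalar is `redFactor`, and `red` collects the resulting coordinates. `red_twisted` shows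
that `red` kills exact forms. Monomial division by the partial derivatives of `f`, repeated along
powers of u (`exists_division_pow`), gives every lattice class a normal form with exponents in Γ, so
the coordinates are injective (`brRed_injective`, `gmRed_injective`). In them I₀ consists of the
lattice elements with coordinates only at u^0, and by quasi-homogeneity t is a shift by u followed
by a diagonal matrix (`red_t`). This settles the canonical section.

For the deformation, Φ = e^{(f-F)/u} turns the differential of F, ∂_s and t into those of the
trivial deformation; the coordinates of Φ(w) are `latRed`. The exponential has constant term 1 in s,
so passing from the coefficients of a series to its coordinates is unipotent triangular. Hence an
element of the lattice of F is determined by its coordinates at u^k with k ≥ 0 (`lattice_ext`), and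
these can be prescribed freely (`exists_lattice`). The lattice elements without coordinates at k ≥ 1
form the image of a good section. Conversely, ∂_s acts on coordinates as a plain derivative, so the
conditions on a good section and on its flat lift determine, by induction on the exponent of s, all
coordinates at k ≥ 1 of the section (`latRed_goodSection`) and all coordinates at k ≥ 0 of the lift
(`latRed_flatLift`). The primitive form is therefore the unique lattice element whose coordinates at
k ≥ 0 are those of [ω₀], constant in s. This is also what the Φ-congruence says
(`phiCongruence_iff`).

For the Taylor expansion, each s-coefficient of the exponential is a single monomial. The term
u^{e_b} x^{r(b)} s^b therefore contributes to s^a, for every a ≥ b, at most at the one coordinate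
u^{e_a} x^{r(a)} (`latRed_taylorSer`). Requiring the total there to be 1 for a = 0 and 0 otherwise
is the recursion. If e_a < 0 or r(a) lies outside Γ, there is no coordinate at k ≥ 0 to correct, and
no term is needed. -/

noncomputable section

namespace GaussManin

/-! ### Coefficients of convergent power series -/

namespace Conv

variable {N : ℕ}

/-- The coefficient of `x^μ`, as a linear functional on `ℂ{x}`. -/
def cf (μ : Fin N →₀ ℕ) : Conv N →ₗ[ℂ] ℂ :=
  MvPowerSeries.coeff μ ∘ₗ (convergentSeries N).val.toLinearMap

theorem cf_apply (μ : Fin N →₀ ℕ) (φ : Conv N) : cf μ φ = MvPowerSeries.coeff μ φ.1 := rfl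

theorem ext_cf {φ ψ : Conv N} (h : ∀ μ, cf μ φ = cf μ ψ) : φ = ψ :=
  Subtype.ext (MvPowerSeries.ext h)

theorem cf_pderiv (μ : Fin N →₀ ℕ) (i : Fin N) (φ : Conv N) :
    cf μ (pderiv i φ) = cf (μ + Finsupp.single i 1) φ * (μ i + 1) :=
  MvPowerSeries.coeff_pderiv _ _

theorem cf_X_pow_mul (μ : Fin N →₀ ℕ) (i : Fin N) (k : ℕ) (φ : Conv N) :
    cf μ (X i ^ k * φ) = if k ≤ μ i then cf (μ - Finsupp.single i k) φ else 0 := by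
  classical
  have h1 : ((X i ^ k * φ : Conv N) : MvPowerSeries (Fin N) ℂ) =
      MvPowerSeries.monomial (Finsupp.single i k) 1 * φ.1 := by
    rw [← MvPowerSeries.X_pow_eq]
    rfl
  rw [cf_apply, h1, MvPowerSeries.coeff_monomial_mul]
  simp only [Finsupp.single_le_iff, one_mul]
  rfl

theorem cf_add_X_pow_mul (μ : Fin N →₀ ℕ) (i : Fin N) (k : ℕ) (φ : Conv N) :
    cf (μ + Finsupp.single i k) (X i ^ k * φ) = cf μ φ := by
  rw [cf_X_pow_mul, if_pos (by simp), add_tsub_cancel_right]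

theorem coe_xpow (ν : Fin N → ℕ) : ((xpow ν : Conv N) : MvPowerSeries (Fin N) ℂ) =
    MvPowerSeries.monomial (Finsupp.equivFunOnFinite.symm ν) 1 := by
  have h1 : ((xpow ν : Conv N) : MvPowerSeries (Fin N) ℂ) =
      ∏ i, (MvPowerSeries.X i) ^ ν i := by
    simp only [xpow, SubmonoidClass.coe_finsetProd, SubmonoidClass.coe_pow]
    rfl
  rw [h1]
  simp only [MvPowerSeries.X_pow_eq]
  have h2 : ∑ i, Finsupp.single i (ν i) = Finsupp.equivFunOnFinite.symm ν := by
    ext i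
    simp [Finsupp.finsetSum_apply, Finsupp.single_apply]
  rw [MvPowerSeries.prod_monomial, Finset.prod_const_one, h2]

open Classical in
theorem cf_xpow (μ : Fin N →₀ ℕ) (ν : Fin N → ℕ) :
    cf μ (xpow ν) = if (μ : Fin N → ℕ) = ν then 1 else 0 := by
  rw [cf_apply, coe_xpow, MvPowerSeries.coeff_monomial]
  refine if_congr ⟨fun h => ?_, fun h => ?_⟩ rfl rfl
  · rw [h]
    rfl
  · ext i
    exact congrFun h i

theorem xpow_mul (ν ν' : Fin N → ℕ) : (xpow ν * xpow ν' : Conv N) = xpow (ν + ν') := by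
  simp only [xpow, ← Finset.prod_mul_distrib, ← pow_add, Pi.add_apply]

theorem xpow_zero : (xpow 0 : Conv N) = 1 := by
  simp [xpow]

theorem pderiv_X (i j : Fin N) : pderiv i (X j) = if i = j then 1 else 0 := by
  have h : ((pderiv i (X j) : Conv N) : MvPowerSeries (Fin N) ℂ) =
      MvPowerSeries.pderiv ℂ i (MvPowerSeries.X j) := rfl
  refine Subtype.ext (h.trans ?_)
  rcases eq_or_ne i j with rfl | hij
  · rw [if_pos rfl]
    exact MvPowerSeries.pderiv_X_self
  · rw [if_neg hij]
    exact MvPowerSeries.pderiv_X_of_ne hij.symm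

theorem cf_pderiv_X_mul (μ : Fin N →₀ ℕ) (i : Fin N) (φ : Conv N) :
    cf μ (pderiv i (X i * φ)) = (μ i + 1) * cf μ φ := by
  rw [cf_pderiv, ← pow_one (X i), cf_add_X_pow_mul, mul_comm]

/-- The quotient by `x_i^k` of the part of `φ` with exponents satisfying `S`. -/
theorem exists_shift (i : Fin N) (k : ℕ) (S : (Fin N →₀ ℕ) → Prop) (φ : Conv N) :
    ∃ g : Conv N, (∀ μ, S μ → cf μ g = cf (μ + Finsupp.single i k) φ) ∧
      ∀ μ, ¬ S μ → cf μ g = 0 := by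
  classical
  obtain ⟨r, hr, h⟩ := φ.2
  refine ⟨⟨fun μ => if S μ then cf (μ + Finsupp.single i k) φ else 0, r, hr, ?_⟩,
    fun μ hμ => if_pos hμ, fun μ hμ => if_neg hμ⟩
  have hinj : Function.Injective fun ν : Fin N →₀ ℕ => ν + Finsupp.single i k :=
    add_left_injective _
  refine Summable.of_nonneg_of_le (fun _ => by positivity) (fun ν => ?_)
    ((h.comp_injective hinj).mul_left (r ^ k)⁻¹)
  have h1 : ‖(if S ν then cf (ν + Finsupp.single i k) φ else 0 : ℂ)‖ ≤
      ‖cf (ν + Finsupp.single i k) φ‖ := by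
    split_ifs <;> simp
  calc _ ≤ ‖cf (ν + Finsupp.single i k) φ‖ * r ^ ν.degree := by
        gcongr
        exact h1
    _ = _ := by
        simp only [Function.comp_apply, map_add, Finsupp.degree_single, pow_add, cf_apply]
        field_simp

end Conv

/-! ### Division of convergent series by the partial derivatives of a Brieskorn-Pham polynomial -/

section Division

variable {n : ℕ} (m : Fin (n + 1) → ℕ)

theorem pderiv_bp (i : Fin (n + 1)) :
    Conv.pderiv i (bp m) = (m i : ℂ) • Conv.X i ^ (m i - 1) := by
  rw [bp, map_sum, Finset.sum_eq_single i]
  · rw [Derivation.leibniz_pow, Conv.pderiv_X, if_pos rfl, smul_eq_mul, mul_one,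
      ← Nat.cast_smul_eq_nsmul ℂ]
  · intro j _ hj
    rw [Derivation.leibniz_pow, Conv.pderiv_X, if_neg hj.symm, smul_zero, smul_zero]
  · simp

/-- The normal form `∑ c_ν x^ν`. -/
def nfConv (c : Gam m → ℂ) : Conv (n + 1) := ∑ ν : Gam m, c ν • xpow fun i => (ν i : ℕ)

open Classical in
theorem cf_nfConv (c : Gam m → ℂ) (μ : Fin (n + 1) →₀ ℕ) :
    Conv.cf μ (nfConv m c) = ∑ ν : Gam m, if (μ : Fin (n + 1) → ℕ) = (fun i => (ν i : ℕ)) then c ν else 0 := by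
  rw [nfConv, map_sum]
  refine Finset.sum_congr rfl fun ν _ => ?_
  rw [map_smul, Conv.cf_xpow]
  split_ifs <;> simp

theorem Gam.coe_injective : Function.Injective fun (ν : Gam m) (i : Fin (n + 1)) => (ν i : ℕ) :=
  fun _ _ h => funext fun i => Fin.ext (congrFun h i)

theorem cf_nfConv_of_eq (c : Gam m → ℂ) (μ : Fin (n + 1) →₀ ℕ) (ν : Gam m)
    (h : ∀ i, μ i = ν i) : Conv.cf μ (nfConv m c) = c ν := by
  classical
  rw [cf_nfConv, Finset.sum_eq_single ν, if_pos (funext h)]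
  · intro ν' _ hν'
    rw [if_neg]
    exact fun h' => hν' (Gam.coe_injective m (h'.symm.trans (funext h)))
  · simp

theorem cf_nfConv_of_le (c : Gam m → ℂ) (μ : Fin (n + 1) →₀ ℕ) (i : Fin (n + 1))
    (h : m i - 1 ≤ μ i) : Conv.cf μ (nfConv m c) = 0 := by
  classical
  rw [cf_nfConv]
  refine Finset.sum_eq_zero fun ν _ => if_neg fun h' => ?_
  have h1 : μ i = ν i := congrFun h' i
  have := (ν i).2
  omega

variable {m}

/-- A monomial outside Γ is divisible by x_i^{m_i - 1} for some i, and ∂_i f is a nonzero multiple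
of that power. Each quotient is a shifted part of φ, so it converges without any analytic division
theorem. -/
theorem exists_division_conv (hm : ∀ i, 2 ≤ m i) (φ : Conv (n + 1)) :
    ∃ (c : Gam m → ℂ) (g : Fin (n + 1) → Conv (n + 1)),
      φ = nfConv m c + ∑ i, Conv.pderiv i (bp m) * g i := by
  classical
  have hm0 : ∀ i, (m i : ℂ) ≠ 0 := fun i => by
    have := hm i
    exact_mod_cast (by omega : m i ≠ 0)
  -- A monomial divisible by several x_i^{m_i - 1} is charged to the least such i. The condition on
  -- j < i may be tested on the quotient exponent, since the shift changes only coordinate i.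
  choose g hg hg' using fun i => Conv.exists_shift i (m i - 1)
    (fun μ => ∀ j < i, μ j < m j - 1) φ
  refine ⟨fun ν => Conv.cf (Finsupp.equivFunOnFinite.symm fun i => (ν i : ℕ)) φ,
    fun i => (m i : ℂ)⁻¹ • g i, Conv.ext_cf fun μ => ?_⟩
  have h1 : ∀ i, Conv.cf μ (Conv.pderiv i (bp m) * ((m i : ℂ)⁻¹ • g i)) =
      if m i - 1 ≤ μ i ∧ ∀ j < i, μ j < m j - 1 then Conv.cf μ φ else 0 := fun i => by
    rw [pderiv_bp, smul_mul_smul_comm, mul_inv_cancel₀ (hm0 i), one_smul, Conv.cf_X_pow_mul]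
    by_cases h : m i - 1 ≤ μ i
    · rw [if_pos h]
      have hsub : ∀ j < i, (μ - Finsupp.single i (m i - 1)) j = μ j := fun j hj => by
        simp [hj.ne']
      by_cases h2 : ∀ j < i, μ j < m j - 1
      · rw [if_pos ⟨h, h2⟩, hg _ _ fun j hj => by rw [hsub j hj]; exact h2 j hj,
          tsub_add_cancel_of_le (by simpa using h)]
      · rw [if_neg fun h' => h2 h'.2, hg' _ _ fun h' => h2 fun j hj => by
          rw [← hsub j hj]; exact h' j hj]
    · rw [if_neg h, if_neg fun h' => h h'.1]
  rw [map_add, map_sum, Finset.sum_congr rfl fun i _ => h1 i]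
  by_cases hμ : ∃ i, m i - 1 ≤ μ i
  · have hmin := Fin.find_spec hμ
    obtain ⟨i, hi, hlt⟩ : ∃ i, m i - 1 ≤ μ i ∧ ∀ j < i, μ j < m j - 1 :=
      ⟨Fin.find _ hμ, hmin, fun j hj => not_le.1 (Fin.find_min hμ hj)⟩
    rw [cf_nfConv_of_le m _ μ i hi, Finset.sum_eq_single i, if_pos ⟨hi, hlt⟩, zero_add]
    · intro j _ hj
      rw [if_neg]
      rintro ⟨h2, h3⟩
      rcases lt_or_gt_of_ne hj with h | h
      · have := hlt j h
        omega
      · have := h3 i h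
        omega
    · simp
  · push Not at hμ
    rw [cf_nfConv_of_eq m _ μ (fun i => ⟨μ i, hμ i⟩) fun i => rfl, Finset.sum_eq_zero, add_zero]
    · congr 2
      ext j
      rfl
    · exact fun i _ => if_neg fun h => not_le.2 (hμ i) h.1

end Division

/-! ### Coefficients of Laurent series -/

theorem finsum_eq_finsum_comp {α β M : Type*} [AddCommMonoid M] {g : β → α}
    (hg : Function.Injective g) (f : α → M) (hf : ∀ x, x ∉ Set.range g → f x = 0) :
    ∑ᶠ x, f x = ∑ᶠ y, f (g y) := by
  rw [← finsum_mem_range hg, ← finsum_mem_univ]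
  refine finsum_mem_inter_support_eq' _ _ _ fun x hx => ⟨fun _ => ?_, fun _ => Set.mem_univ _⟩
  by_contra h
  exact hx (hf x h)

theorem prod_Icc_one {M : Type*} [CommMonoid M] (k : ℕ) (f : ℕ → M) :
    ∏ l ∈ Finset.Icc 1 k, f l = ∏ l ∈ Finset.range k, f (l + 1) := by
  have h : Finset.Icc 1 k = Finset.Ico 1 (k + 1) := by
    ext
    simp
  rw [h, Finset.prod_Ico_eq_prod_range, Nat.add_sub_cancel]
  simp only [add_comm]

namespace Laur

variable {N : ℕ}

/-- The coefficient of `u^k` as a linear map. -/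
def coeffLin (k : ℤ) : Laur N →ₗ[ℂ] Conv N where
  toFun h := coeff h k
  map_add' h h' := coeff_add h h' k
  map_smul' c h := coeff_smul c h k

theorem coeff_sub (h h' : Laur N) (k : ℤ) : coeff (h - h') k = coeff h k - coeff h' k :=
  map_sub (coeffLin k) h h'

theorem coeff_sum {ι : Type*} (s : Finset ι) (h : ι → Laur N) (k : ℤ) :
    coeff (∑ i ∈ s, h i) k = ∑ i ∈ s, coeff (h i) k :=
  map_sum (coeffLin k) h s

theorem coeff_single_mul (j : ℤ) (a : Conv N) (h : Laur N) (k : ℤ) :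
    coeff (single j a * h) k = a * coeff h (k - j) :=
  HahnSeries.coeff_single_mul

theorem coeff_u_mul (h : Laur N) (k : ℤ) : coeff (u N * h) k = coeff h (k - 1) := by
  rw [u, coeff_single_mul, one_mul]

theorem coeff_uInv_mul (h : Laur N) (k : ℤ) : coeff (uInv N * h) k = coeff h (k + 1) := by
  rw [uInv, coeff_single_mul, one_mul, sub_neg_eq_add]

theorem C_eq_single (f : Conv N) : C f = single 0 f := rfl

theorem coeff_C_mul (f : Conv N) (h : Laur N) (k : ℤ) : coeff (C f * h) k = f * coeff h k := by
  rw [C_eq_single, coeff_single_mul, sub_zero]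

theorem mul_natCast_add_one (h : Laur N) (j : ℕ) :
    h * ((j : Laur N) + 1) = ((j : ℂ) + 1) • h := by
  have : h * ((j : Laur N) + 1) = (j + 1) • h := by
    rw [nsmul_eq_mul, mul_comm]
    push_cast
    rfl
  rw [this, ← Nat.cast_smul_eq_nsmul ℂ]
  push_cast
  rfl

theorem exists_bound (h : Laur N) : ∃ B : ℤ, ∀ k < B, coeff h k = 0 :=
  ⟨HahnSeries.order (h : HahnSeries ℤ (Conv N)), fun _ hk =>
    HahnSeries.coeff_eq_zero_of_lt_order hk⟩

/-- Each unit of |q| consumes one power of u and `h` has bounded pole order, so only finitely many q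
contribute. The `finsum` in `weightedSum` is thus a genuine finite sum, hence linear. -/
theorem finite_support (h : Laur N) (k : ℤ) (L : (Fin N →₀ ℕ) → Conv N →ₗ[ℂ] ℂ) :
    (Function.support fun q : Fin N →₀ ℕ => L q (coeff h (k - q.degree))).Finite := by
  obtain ⟨B, hB⟩ := exists_bound h
  refine (Finsupp.finite_of_degree_le (k - B).toNat).subset fun q hq => ?_
  by_contra h'
  refine hq ?_
  have h1 : ¬ q.degree ≤ (k - B).toNat := h'
  dsimp only
  rw [hB _ (by omega), map_zero]

/-- The functional `h ↦ ∑_q L_q (h_{k - |q|})`. -/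
def weightedSum (L : (Fin N →₀ ℕ) → Conv N →ₗ[ℂ] ℂ) (k : ℤ) : Laur N →ₗ[ℂ] ℂ where
  toFun h := ∑ᶠ q : Fin N →₀ ℕ, L q (coeff h (k - q.degree))
  map_add' h h' := by
    rw [← finsum_add_distrib (finite_support h k L) (finite_support h' k L)]
    exact finsum_congr fun q => by rw [coeff_add, map_add]
  map_smul' c h := by
    rw [RingHom.id_apply, smul_finsum]
    exact finsum_congr fun q => by rw [coeff_smul, map_smul]

end Laur

/-! ### Coordinates that vanish on twisted exact forms -/

section Residue

variable {n : ℕ} (m : Fin (n + 1) → ℕ)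

/-- The factor by which `x^μ` reduces modulo the twisted exact forms. -/
def redFactor (μ : Fin (n + 1) → ℕ) : ℂ :=
  ∏ i, ∏ l ∈ Finset.Icc 1 (μ i / m i), ((μ i : ℂ) - (l : ℂ) * (m i : ℂ) + 1) / (m i : ℂ)

/-- The exponent `ν + m q`. -/
def liftExp (ν : Gam m) (q : Fin (n + 1) →₀ ℕ) : Fin (n + 1) →₀ ℕ :=
  Finsupp.equivFunOnFinite.symm fun i => (ν i : ℕ) + m i * q i

theorem liftExp_apply (ν : Gam m) (q : Fin (n + 1) →₀ ℕ) (i : Fin (n + 1)) :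
    liftExp m ν q i = (ν i : ℕ) + m i * q i := rfl

variable {m}

theorem liftExp_div (ν : Gam m) (q : Fin (n + 1) →₀ ℕ) (i : Fin (n + 1)) :
    liftExp m ν q i / m i = q i := by
  have := (ν i).2
  rw [liftExp_apply, Nat.add_mul_div_left _ _ (by omega), Nat.div_eq_of_lt (by omega), zero_add]

theorem liftExp_mod (ν : Gam m) (q : Fin (n + 1) →₀ ℕ) (i : Fin (n + 1)) :
    liftExp m ν q i % m i = ν i := by
  have := (ν i).2
  rw [liftExp_apply, Nat.add_mul_mod_self_left, Nat.mod_eq_of_lt (by omega)]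

theorem liftExp_add_single (ν : Gam m) (q : Fin (n + 1) →₀ ℕ) (i : Fin (n + 1)) :
    liftExp m ν (q + Finsupp.single i 1) =
      liftExp m ν q + Finsupp.single i 1 + Finsupp.single i (m i - 1) := by
  classical
  ext j
  have := (ν j).2
  simp only [liftExp_apply, Finsupp.add_apply, Finsupp.single_apply]
  split_ifs with h
  · subst h
    rw [mul_add]
    omega
  · simp

theorem redFactor_of_lt (μ : Fin (n + 1) → ℕ) (h : ∀ i, μ i < m i) : redFactor m μ = 1 := by
  refine Finset.prod_eq_one fun i _ => ?_
  rw [Nat.div_eq_of_lt (h i)]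
  rfl

/-- This is the rule x^{μ + m_i e_i} ≡ u (μ_i + 1)/m_i · x^μ at the level of scalars, cleared of the
denominator: raising q_i by one adds one factor to the product over l. -/
theorem redFactor_liftExp_add_single (ν : Gam m) (q : Fin (n + 1) →₀ ℕ) (i : Fin (n + 1)) :
    redFactor m (liftExp m ν (q + Finsupp.single i 1)) * (m i : ℂ) =
      redFactor m (liftExp m ν q) * ((liftExp m ν q i : ℂ) + 1) := by
  classical
  have hmi : (m i : ℂ) ≠ 0 := by
    have := (ν i).2
    exact_mod_cast (by omega : m i ≠ 0)
  simp only [redFactor, liftExp_div, prod_Icc_one]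
  rw [← Finset.mul_prod_erase _ _ (Finset.mem_univ i),
    ← Finset.mul_prod_erase (Finset.univ : Finset (Fin (n + 1))) _ (Finset.mem_univ i)]
  have h1 : ∀ j ∈ Finset.univ.erase i,
      (∏ l ∈ Finset.range ((q + Finsupp.single i 1 : Fin (n + 1) →₀ ℕ) j),
        ((liftExp m ν (q + Finsupp.single i 1) j : ℂ) - ((l + 1 : ℕ) : ℂ) * (m j : ℂ) + 1) /
          (m j : ℂ)) =
      ∏ l ∈ Finset.range (q j),
        ((liftExp m ν q j : ℂ) - ((l + 1 : ℕ) : ℂ) * (m j : ℂ) + 1) / (m j : ℂ) := fun j hj => by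
    have hj' : (Finsupp.single i 1 : Fin (n + 1) →₀ ℕ) j = 0 :=
      Finsupp.single_eq_of_ne (Finset.ne_of_mem_erase hj)
    simp only [liftExp_apply, Finsupp.add_apply, hj', add_zero]
  have h2 : (∏ l ∈ Finset.range ((q + Finsupp.single i 1 : Fin (n + 1) →₀ ℕ) i),
        ((liftExp m ν (q + Finsupp.single i 1) i : ℂ) - ((l + 1 : ℕ) : ℂ) * (m i : ℂ) + 1) /
          (m i : ℂ)) =
      (((liftExp m ν q i : ℂ) + 1) / (m i : ℂ)) * ∏ l ∈ Finset.range (q i),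
        ((liftExp m ν q i : ℂ) - ((l + 1 : ℕ) : ℂ) * (m i : ℂ) + 1) / (m i : ℂ) := by
    simp only [liftExp_apply, Finsupp.add_apply, Finsupp.single_eq_same]
    -- The new factor is the one with l = 1, equal to (μ_i + 1)/m_i for the old exponent μ. The
    -- remaining factors are the old ones with l shifted by one, which the increase of μ_i by m_i
    -- compensates.
    rw [Finset.prod_range_succ', mul_comm]
    congr 1
    · push_cast
      ring
    · refine Finset.prod_congr rfl fun l _ => ?_
      push_cast
      ring
  rw [Finset.prod_congr rfl h1, h2]
  field_simp

variable (m)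

/-- The coefficient functional of `x^ν` along `x^{ν + m q}`. -/
def redCoeff (ν : Gam m) (q : Fin (n + 1) →₀ ℕ) : Conv (n + 1) →ₗ[ℂ] ℂ :=
  redFactor m (liftExp m ν q) • Conv.cf (liftExp m ν q)

theorem redCoeff_apply (ν : Gam m) (q : Fin (n + 1) →₀ ℕ) (φ : Conv (n + 1)) :
    redCoeff m ν q φ = redFactor m (liftExp m ν q) * Conv.cf (liftExp m ν q) φ := rfl

/-- The coefficient of `x^ν u^k` in the reduction of an element of `ℂ{x}((u))` modulo the twisted
exact forms. -/
def red : Laur (n + 1) →ₗ[ℂ] (ℤ → Gam m → ℂ) :=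
  LinearMap.pi fun k => LinearMap.pi fun ν => Laur.weightedSum (redCoeff m ν) k

theorem red_apply (h : Laur (n + 1)) (k : ℤ) (ν : Gam m) :
    red m h k ν = ∑ᶠ q : Fin (n + 1) →₀ ℕ, redCoeff m ν q (Laur.coeff h (k - q.degree)) := rfl

theorem red_u_mul (h : Laur (n + 1)) (k : ℤ) (ν : Gam m) :
    red m (Laur.u _ * h) k ν = red m h (k - 1) ν := by
  rw [red_apply, red_apply]
  exact finsum_congr fun q => by rw [Laur.coeff_u_mul]; congr 2; ring

theorem red_single_mul (j : ℤ) (h : Laur (n + 1)) (k : ℤ) (ν : Gam m) :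
    red m (Laur.single j 1 * h) k ν = red m h (k - j) ν := by
  rw [red_apply, red_apply]
  exact finsum_congr fun q => by rw [Laur.coeff_single_mul, one_mul]; congr 2; ring

theorem redCoeff_pderiv (ν : Gam m) (q : Fin (n + 1) →₀ ℕ) (i : Fin (n + 1)) (φ : Conv (n + 1)) :
    redCoeff m ν (q + Finsupp.single i 1) (Conv.pderiv i (bp m) * φ) =
      redCoeff m ν q (Conv.pderiv i φ) := by
  rw [redCoeff_apply, redCoeff_apply, pderiv_bp, smul_mul_assoc, map_smul, Conv.cf_pderiv,
    liftExp_add_single, Conv.cf_add_X_pow_mul, ← liftExp_add_single, smul_eq_mul, ← mul_assoc,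
    redFactor_liftExp_add_single]
  ring

/-- The substitution q ↦ q + e_i matches the two sums term by term through `redCoeff_pderiv`. The
unmatched terms have q_i = 0; their exponent in x_i is ν_i < m_i - 1, which a multiple of ∂_i f does
not contain. -/
theorem red_twisted (i : Fin (n + 1)) (g : Laur (n + 1)) :
    red m (Laur.u _ * Laur.pderiv i g - Laur.pderiv i (Laur.C (bp m)) * g) = 0 := by
  ext k ν
  rw [map_sub, Pi.sub_apply, Pi.sub_apply, Pi.zero_apply, Pi.zero_apply, sub_eq_zero, red_apply,
    red_apply, eq_comm, finsum_eq_finsum_comp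
      (add_left_injective (Finsupp.single i 1 : Fin (n + 1) →₀ ℕ))]
  · refine finsum_congr fun q => ?_
    rw [Laur.pderiv_C, Laur.coeff_C_mul, redCoeff_pderiv, Laur.coeff_u_mul, Laur.coeff_pderiv,
      map_add, Finsupp.degree_single]
    congr 3
    push_cast
    ring
  · intro q hq
    have hqi : q i = 0 := by
      by_contra h
      refine hq ⟨q - Finsupp.single i 1, tsub_add_cancel_of_le ?_⟩
      rw [Finsupp.single_le_iff]
      omega
    rw [Laur.pderiv_C, Laur.coeff_C_mul, pderiv_bp, smul_mul_assoc, map_smul, redCoeff_apply,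
      Conv.cf_X_pow_mul, if_neg, mul_zero, smul_zero]
    have := (ν i).2
    rw [liftExp_apply, hqi]
    omega

/-- `∑_i (ν_i + 1) / m_i`. -/
def bpExponent (ν : Gam m) : ℂ := ∑ i, ((ν i : ℂ) + 1) / (m i : ℂ)

variable {m}

/-- Quasi-homogeneity writes f h as ∑ ∂_i f · (x_i h / m_i), which is equivalent to u ∑ ∂_i(x_i h /
m_i). On x^{ν + m q} the operator ∂_i x_i / m_i has eigenvalue (ν_i + 1)/m_i + q_i. The sum of the
q_i cancels against the shift by |q| in the eigenvalue of u ∂_u. -/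
theorem red_t (h : Laur (n + 1)) (k : ℤ) (ν : Gam m) :
    red m (Laur.C (bp m) * h + Laur.u _ * Laur.euler _ h) k ν =
      (bpExponent m ν + k - 1) * red m h (k - 1) ν := by
  have hm0 : ∀ i, (m i : ℂ) ≠ 0 := fun i => by
    have := (ν i).2
    exact_mod_cast (by omega : m i ≠ 0)
  have h1 : Laur.C (bp m) * h = ∑ i, Laur.pderiv i (Laur.C (bp m)) *
      (Laur.C ((m i : ℂ)⁻¹ • Conv.X i) * h) := by
    simp only [Laur.pderiv_C, pderiv_bp, ← mul_assoc, ← map_mul, ← Finset.sum_mul, ← map_sum]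
    congr 2
    rw [bp]
    refine Finset.sum_congr rfl fun i _ => ?_
    have := (ν i).2
    rw [smul_mul_smul_comm, mul_inv_cancel₀ (hm0 i), one_smul, ← pow_succ]
    congr 1
    omega
  have h2 : ∀ i, red m (Laur.pderiv i (Laur.C (bp m)) *
      (Laur.C ((m i : ℂ)⁻¹ • Conv.X i) * h)) =
      red m (Laur.u _ * Laur.pderiv i (Laur.C ((m i : ℂ)⁻¹ • Conv.X i) * h)) := fun i => by
    have := red_twisted m i (Laur.C ((m i : ℂ)⁻¹ • Conv.X i) * h)
    rw [map_sub, sub_eq_zero] at this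
    exact this.symm
  have h3 : red m (Laur.C (bp m) * h + Laur.u _ * Laur.euler _ h) =
      red m (Laur.u _ * (∑ i, Laur.pderiv i (Laur.C ((m i : ℂ)⁻¹ • Conv.X i) * h) +
        Laur.euler _ h)) := by
    rw [h1, map_add, map_sum, Finset.sum_congr rfl fun i _ => h2 i, ← map_sum, ← map_add,
      mul_add, Finset.mul_sum]
  rw [h3, red_u_mul, red_apply, red_apply, mul_finsum]
  refine finsum_congr fun q => ?_
  rw [redCoeff_apply, redCoeff_apply, Laur.coeff_add, Laur.coeff_sum, Laur.coeff_euler, map_add,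
    map_sum, map_smul]
  have h4 : ∀ i, Conv.cf (liftExp m ν q) (Laur.coeff (Laur.pderiv i
      (Laur.C ((m i : ℂ)⁻¹ • Conv.X i) * h)) (k - 1 - q.degree)) =
      (((ν i : ℂ) + 1) / (m i : ℂ) + q i) *
        Conv.cf (liftExp m ν q) (Laur.coeff h (k - 1 - q.degree)) := fun i => by
    rw [Laur.coeff_pderiv, Laur.coeff_C_mul, smul_mul_assoc, Derivation.map_smul, map_smul,
      Conv.cf_pderiv_X_mul, liftExp_apply, smul_eq_mul]
    have := hm0 i
    push_cast
    field_simp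
    ring
  have h5 : (q.degree : ℂ) = ∑ i, (q i : ℂ) := by
    rw [Finsupp.degree_eq_sum]
    push_cast
    rfl
  rw [Finset.sum_congr rfl fun i _ => h4 i, ← Finset.sum_mul, Finset.sum_add_distrib, ← h5,
    bpExponent, smul_eq_mul]
  push_cast
  ring

end Residue

/-! ### The Gauss-Manin system and the Brieskorn lattice of a Brieskorn-Pham polynomial -/

namespace Pow

variable {N : ℕ}

theorem coeff_sum {ι : Type*} (s : Finset ι) (h : ι → Pow N) (k : ℕ) :
    coeff k (∑ i ∈ s, h i) = ∑ i ∈ s, coeff k (h i) :=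
  map_sum (PowerSeries.coeff (R := Conv N) k) h s

theorem coeff_add (h h' : Pow N) (k : ℕ) : coeff k (h + h') = coeff k h + coeff k h' :=
  map_add (PowerSeries.coeff (R := Conv N) k) h h'

theorem coeff_sub (h h' : Pow N) (k : ℕ) : coeff k (h - h') = coeff k h - coeff k h' :=
  map_sub (PowerSeries.coeff (R := Conv N) k) h h'

theorem coeff_C_mul (f : Conv N) (h : Pow N) (k : ℕ) : coeff k (C f * h) = f * coeff k h :=
  PowerSeries.coeff_C_mul k h f

theorem coeff_succ_u_mul (h : Pow N) (k : ℕ) : coeff (k + 1) (u N * h) = coeff k h :=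
  PowerSeries.coeff_succ_X_mul k h

theorem coeff_zero_u_mul (h : Pow N) : coeff 0 (u N * h) = 0 :=
  PowerSeries.coeff_zero_X_mul h

/-- The power series with the given coefficients. -/
def mk (c : ℕ → Conv N) : Pow N := PowerSeries.mk c

theorem coeff_mk (c : ℕ → Conv N) (k : ℕ) : coeff k (mk c) = c k :=
  PowerSeries.coeff_mk k c

end Pow

theorem Laur.exists_ofPow {N : ℕ} (h : Laur N) (hh : ∀ k < 0, Laur.coeff h k = 0) :
    ∃ h' : Pow N, Laur.ofPow h' = h := by
  refine ⟨Pow.mk fun k => Laur.coeff h k, Laur.ext' fun k => ?_⟩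
  rcases lt_or_ge k 0 with hk | hk
  · rw [Laur.coeff_ofPow_neg _ hk, hh k hk]
  · lift k to ℕ using hk
    rw [Laur.coeff_ofPow, Pow.coeff_mk]

theorem Brieskorn₀.uMul_mk {N : ℕ} (f : Conv N) (h : Pow N) :
    Brieskorn₀.uMul f (Submodule.Quotient.mk h) = Submodule.Quotient.mk (Pow.u N * h) := rfl

section BrieskornPhamLattice

variable {n : ℕ} (m : Fin (n + 1) → ℕ)

/-- The normal form `∑ c_{k,ν} x^ν u^k`. -/
def nfPow (c : ℕ → Gam m → ℂ) : Pow (n + 1) := Pow.mk fun k => nfConv m (c k)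

theorem coeff_nfPow (c : ℕ → Gam m → ℂ) (k : ℕ) :
    Pow.coeff k (nfPow m c) = nfConv m (c k) := Pow.coeff_mk _ _

theorem nfConv_zero : nfConv m 0 = 0 := by
  simp [nfConv]

theorem nfConv_add (c c' : Gam m → ℂ) : nfConv m (c + c') = nfConv m c + nfConv m c' := by
  simp [nfConv, add_smul, Finset.sum_add_distrib]

theorem nfConv_smul (r : ℂ) (c : Gam m → ℂ) : nfConv m (r • c) = r • nfConv m c := by
  simp [nfConv, Finset.smul_sum, smul_smul]

theorem C_nfConv (c : Gam m → ℂ) : Pow.C (nfConv m c) = nfPow m (Pi.single 0 c) := by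
  refine Pow.ext' fun k => ?_
  rw [Pow.coeff_C, coeff_nfPow]
  rcases eq_or_ne k 0 with rfl | hk
  · rw [if_pos rfl, Pi.single_eq_same]
  · rw [if_neg hk, Pi.single_eq_of_ne hk, nfConv_zero]

theorem u_mul_nfPow (c : ℕ → Gam m → ℂ) (hc : c 0 = 0) :
    Pow.u _ * nfPow m (fun k => c (k + 1)) = nfPow m c := by
  refine Pow.ext' fun k => ?_
  cases k with
  | zero => rw [Pow.coeff_zero_u_mul, coeff_nfPow, hc, nfConv_zero]
  | succ k => rw [Pow.coeff_succ_u_mul, coeff_nfPow, coeff_nfPow]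

variable {m}

/-- Dividing the coefficient of u^k by the ∂_i f replaces the quotients g_i by ∂_i g_i at u^{k+1},
where they join the next coefficient before it is divided. The process need not stop, but it settles
one power of u at a time; `r k` is what remains to be divided at step k. -/
theorem exists_division_pow (hm : ∀ i, 2 ≤ m i) (h : Pow (n + 1)) :
    ∃ (c : ℕ → Gam m → ℂ) (g : Fin (n + 1) → Pow (n + 1)),
      h + twistedDiff (K := ℂ) (fun i => Pow.pderiv i) (Pow.u _) (Pow.C (bp m)) g =
        nfPow m c := by
  choose c g hg using exists_division_conv (m := m) hm
  let r : ℕ → Conv (n + 1) := fun k => Nat.rec (Pow.coeff 0 h)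
    (fun k r => Pow.coeff (k + 1) h + ∑ i, Conv.pderiv i (g r i)) k
  refine ⟨fun k => c (r k), fun i => Pow.mk fun k => g (r k) i, Pow.ext' fun k => ?_⟩
  have h1 : r k - ∑ i, Conv.pderiv i (bp m) * g (r k) i = nfConv m (c (r k)) :=
    sub_eq_iff_eq_add.2 (hg (r k))
  rw [Pow.coeff_add, coeff_nfPow, twistedDiff_apply, Pow.coeff_sum]
  simp only [Pow.coeff_sub, Pow.pderiv_C, Pow.coeff_C_mul, Pow.coeff_mk]
  rw [Finset.sum_sub_distrib, ← h1, ← add_sub_assoc]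
  congr 1
  cases k with
  | zero =>
    rw [Finset.sum_eq_zero fun i _ => Pow.coeff_zero_u_mul _, add_zero]
    rfl
  | succ k =>
    simp only [Pow.coeff_succ_u_mul, Pow.coeff_pderiv, Pow.coeff_mk]
    rfl

variable (m)

theorem red_ofPow_neg (h : Pow (n + 1)) {k : ℤ} (hk : k < 0) (ν : Gam m) :
    red m (Laur.ofPow h) k ν = 0 := by
  rw [red_apply]
  refine finsum_eq_zero_of_forall_eq_zero fun q => ?_
  rw [Laur.coeff_ofPow_neg _ (by omega), map_zero]

theorem red_ofPow_nfPow (c : ℕ → Gam m → ℂ) (k : ℕ) (ν : Gam m) :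
    red m (Laur.ofPow (nfPow m c)) k ν = c k ν := by
  rw [red_apply, finsum_eq_single _ 0]
  · rw [map_zero, Nat.cast_zero, sub_zero, Laur.coeff_ofPow, coeff_nfPow, redCoeff_apply,
      cf_nfConv_of_eq m _ _ ν, redFactor_of_lt, one_mul]
    · intro i
      have := (ν i).2
      simp only [liftExp_apply, Finsupp.zero_apply]
      omega
    · intro i
      simp [liftExp_apply]
  · intro q hq
    obtain ⟨i, hi⟩ := Finsupp.ne_iff.1 hq
    rcases lt_or_ge ((k : ℤ) - q.degree) 0 with h | h
    · rw [Laur.coeff_ofPow_neg _ h, map_zero]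
    · lift (k : ℤ) - q.degree to ℕ using h with j
      rw [Laur.coeff_ofPow, coeff_nfPow, redCoeff_apply, cf_nfConv_of_le m _ _ i, mul_zero]
      have h1 : 1 ≤ q i := Nat.one_le_iff_ne_zero.2 hi
      have := Nat.mul_le_mul_left (m i) h1
      rw [liftExp_apply]
      omega

open Classical in
-- Euclidean division allows only q = ⌊μ/m⌋ and ν = μ mod m. If some remainder equals m_i - 1, no ν
-- in Γ fits and all coordinates vanish.
theorem red_single_xpow (j : ℤ) (μ : Fin (n + 1) → ℕ) (k : ℤ) (ν : Gam m) :
    red m (Laur.single j (xpow μ)) k ν =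
      if k = j + ∑ i, ((μ i / m i : ℕ) : ℤ) ∧ ∀ i, μ i % m i = ν i then redFactor m μ else 0 := by
  have h0 : ∀ q, redCoeff m ν q (xpow μ) ≠ 0 → ⇑(liftExp m ν q) = μ := fun q hq => by
    by_contra h
    rw [redCoeff_apply, Conv.cf_xpow, if_neg h, mul_zero] at hq
    exact hq rfl
  rw [red_apply]
  simp only [Laur.coeff_single]
  by_cases h : ∀ i, μ i % m i = ν i
  · have hq0 : ⇑(liftExp m ν (Finsupp.equivFunOnFinite.symm fun i => μ i / m i)) = μ := by
      ext i
      rw [liftExp_apply, ← h i]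
      exact Nat.mod_add_div _ _
    rw [finsum_eq_single _ (Finsupp.equivFunOnFinite.symm fun i => μ i / m i)]
    · have hd : ((Finsupp.equivFunOnFinite.symm fun i => μ i / m i).degree : ℤ) =
          ∑ i, ((μ i / m i : ℕ) : ℤ) := by
        rw [Finsupp.degree_eq_sum]
        push_cast
        rfl
      rw [hd]
      by_cases hk : k = j + ∑ i, ((μ i / m i : ℕ) : ℤ)
      · rw [if_pos (by omega), if_pos ⟨hk, h⟩, redCoeff_apply, hq0, Conv.cf_xpow, if_pos hq0,
          mul_one]
      · rw [if_neg (by omega), if_neg fun h' => hk h'.1, map_zero]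
    · intro q hq
      split_ifs
      · by_contra hne
        refine hq (Finsupp.ext fun i => ?_)
        rw [← liftExp_div ν q i, h0 q hne]
        rfl
      · rw [map_zero]
  · rw [if_neg fun h' => h h'.2]
    refine finsum_eq_zero_of_forall_eq_zero fun q => ?_
    split_ifs
    · by_contra hne
      refine h fun i => ?_
      rw [← liftExp_mod ν q i, h0 q hne]
    · rw [map_zero]

/-- The coordinates with respect to `x^ν u^k` on the Gauss-Manin system of `f`. -/
def gmRed : GaussManin₀ (bp m) →ₗ[ℂ] (ℤ → Gam m → ℂ) :=
  Submodule.liftQ _ (red m) (by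
    rintro _ ⟨g, rfl⟩
    rw [LinearMap.mem_ker, twistedDiff_apply, map_sum]
    exact Finset.sum_eq_zero fun i _ => red_twisted m i (g i))

/-- The coordinates with respect to `x^ν u^k` on the Brieskorn lattice of `f`. -/
def brRed : Brieskorn₀ (bp m) →ₗ[ℂ] (ℤ → Gam m → ℂ) := gmRed m ∘ₗ Brieskorn₀.toGM (bp m)

theorem gmRed_toGM (w : Brieskorn₀ (bp m)) : gmRed m (Brieskorn₀.toGM (bp m) w) = brRed m w := rfl

theorem brRed_mk (h : Pow (n + 1)) :
    brRed m (Submodule.Quotient.mk h) = red m (Laur.ofPow h) := rfl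

theorem gmRed_uMul (w : GaussManin₀ (bp m)) (k : ℤ) (ν : Gam m) :
    gmRed m (GaussManin₀.uMul (bp m) w) k ν = gmRed m w (k - 1) ν := by
  induction w using Submodule.Quotient.induction_on with | H h =>
  exact red_u_mul m h k ν

theorem gmRed_uInvMul (w : GaussManin₀ (bp m)) (k : ℤ) (ν : Gam m) :
    gmRed m (GaussManin₀.uInvMul (bp m) w) k ν = gmRed m w (k + 1) ν := by
  induction w using Submodule.Quotient.induction_on with | H h =>
  have := red_single_mul m (-1) h k ν
  rwa [sub_neg_eq_add] at this

theorem gmRed_uInvMul_pow (j : ℕ) (w : GaussManin₀ (bp m)) (k : ℤ) (ν : Gam m) :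
    gmRed m ((GaussManin₀.uInvMul (bp m) ^ j) w) k ν = gmRed m w (k + j) ν := by
  induction j generalizing k with
  | zero => simp
  | succ j ih =>
    have h : k + 1 + (j : ℤ) = k + (j + 1 : ℕ) := by
      push_cast
      ring
    rw [pow_succ', Module.End.mul_apply, gmRed_uInvMul, ih, h]

theorem gmRed_t (w : GaussManin₀ (bp m)) (k : ℤ) (ν : Gam m) :
    gmRed m (GaussManin₀.t (bp m) w) k ν = (bpExponent m ν + k - 1) * gmRed m w (k - 1) ν := by
  induction w using Submodule.Quotient.induction_on with | H h =>
  exact red_t h k ν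

theorem brRed_neg (w : Brieskorn₀ (bp m)) {k : ℤ} (hk : k < 0) (ν : Gam m) :
    brRed m w k ν = 0 := by
  induction w using Submodule.Quotient.induction_on with | H h =>
  exact red_ofPow_neg m h hk ν

theorem brRed_nfPow (c : ℕ → Gam m → ℂ) (k : ℕ) (ν : Gam m) :
    brRed m (Submodule.Quotient.mk (nfPow m c)) k ν = c k ν := red_ofPow_nfPow m c k ν

theorem brRed_uMul (w : Brieskorn₀ (bp m)) (k : ℤ) (ν : Gam m) :
    brRed m (Brieskorn₀.uMul (bp m) w) k ν = brRed m w (k - 1) ν := by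
  induction w using Submodule.Quotient.induction_on with | H h =>
  rw [Brieskorn₀.uMul_mk, brRed_mk, map_mul, Laur.ofPow_u, red_u_mul, brRed_mk]

/-- The class of `∑ c_ν x^ν ω₀`. -/
def nfClass : (Gam m → ℂ) →ₗ[ℂ] Brieskorn₀ (bp m) where
  toFun c := Brieskorn₀.cls (bp m) (nfConv m c)
  map_add' c c' := by
    rw [nfConv_add, Brieskorn₀.cls, map_add]
    rfl
  map_smul' r c := by
    have h : Pow.C (r • nfConv m c) = r • Pow.C (nfConv m c) := by
      rw [Algebra.smul_def, map_mul, Algebra.smul_def, Pow.algebraMap_apply]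
    rw [nfConv_smul, Brieskorn₀.cls, h]
    rfl

theorem brRed_nfClass_zero (c : Gam m → ℂ) (ν : Gam m) : brRed m (nfClass m c) 0 ν = c ν := by
  change brRed m (Submodule.Quotient.mk (Pow.C (nfConv m c))) ((0 : ℕ) : ℤ) ν = _
  rw [C_nfConv, brRed_nfPow, Pi.single_eq_same]

theorem brRed_nfClass_of_ne (c : Gam m → ℂ) {k : ℤ} (hk : k ≠ 0) (ν : Gam m) :
    brRed m (nfClass m c) k ν = 0 := by
  rcases lt_or_ge k 0 with h | h
  · exact brRed_neg m _ h ν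
  · lift k to ℕ using h
    change brRed m (Submodule.Quotient.mk (Pow.C (nfConv m c))) k ν = _
    rw [C_nfConv, brRed_nfPow, Pi.single_eq_of_ne (by exact_mod_cast hk), Pi.zero_apply]

theorem range_nfClass : LinearMap.range (nfClass m) = bpI₀ m := by
  have h : nfClass m = Fintype.linearCombination ℂ
      fun ν : Gam m => Brieskorn₀.cls (bp m) (xpow fun i => (ν i : ℕ)) := by
    classical
    refine LinearMap.pi_ext' fun ν => LinearMap.ext_ring ?_
    rw [LinearMap.comp_apply, LinearMap.comp_apply, LinearMap.single_apply,
      Fintype.linearCombination_apply_single, one_smul]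
    change Brieskorn₀.cls _ (nfConv m _) = _
    rw [nfConv, Finset.sum_eq_single ν]
    · rw [Pi.single_eq_same, one_smul]
    · intro ν' _ h
      rw [Pi.single_eq_of_ne h, zero_smul]
    · simp
  rw [h, Fintype.range_linearCombination]
  rfl

/-! ### Faithfulness of the coordinates, and the lattice and polar part described by them -/

variable {m} (hm : ∀ i, 2 ≤ m i)
include hm

theorem exists_eq_nfPow (w : Brieskorn₀ (bp m)) :
    ∃ c, w = Submodule.Quotient.mk (nfPow m c) := by
  induction w using Submodule.Quotient.induction_on with | H h =>
  obtain ⟨c, g, hc⟩ := exists_division_pow hm h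
  refine ⟨c, (Submodule.Quotient.eq _).2 ⟨-g, ?_⟩⟩
  rw [map_neg, ← hc, sub_add_cancel_left]

/-- Division supplies a normal form for every class, and the coordinates of a normal form are its
own coefficients. Vanishing coordinates thus leave only the zero normal form. -/
theorem brRed_injective : Function.Injective (brRed m) := by
  rw [injective_iff_map_eq_zero]
  intro w hw
  obtain ⟨c, rfl⟩ := exists_eq_nfPow hm w
  have hc : c = 0 := by
    ext k ν
    rw [← brRed_nfPow m c k ν, hw]
    rfl
  have : nfPow m c = 0 := Pow.ext' fun k => by
    rw [coeff_nfPow, hc, Pi.zero_apply, nfConv_zero]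
    exact (map_zero (PowerSeries.coeff (R := Conv (n + 1)) k)).symm
  rw [this, Submodule.Quotient.mk_zero]

theorem mem_bpI₀_iff (w : Brieskorn₀ (bp m)) :
    w ∈ bpI₀ m ↔ ∀ k : ℤ, 1 ≤ k → ∀ ν, brRed m w k ν = 0 := by
  rw [← range_nfClass]
  constructor
  · rintro ⟨c, rfl⟩ k hk ν
    exact brRed_nfClass_of_ne m c (by omega) ν
  · refine fun h => ⟨brRed m w 0, brRed_injective hm ?_⟩
    ext k ν
    rcases lt_trichotomy k 0 with hk | rfl | hk
    · rw [brRed_neg m _ hk, brRed_neg m _ hk]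
    · rw [brRed_nfClass_zero]
    · rw [h k (by omega), brRed_nfClass_of_ne m _ hk.ne']

theorem mem_range_uMul_iff (w : Brieskorn₀ (bp m)) :
    w ∈ LinearMap.range (Brieskorn₀.uMul (bp m)) ↔ ∀ ν, brRed m w 0 ν = 0 := by
  constructor
  · rintro ⟨w, rfl⟩ ν
    rw [brRed_uMul, brRed_neg m _ (by norm_num)]
  · intro h
    obtain ⟨c, rfl⟩ := exists_eq_nfPow hm w
    refine ⟨Submodule.Quotient.mk (nfPow m fun k => c (k + 1)), ?_⟩
    rw [Brieskorn₀.uMul_mk, u_mul_nfPow m c]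
    · ext ν
      rw [← brRed_nfPow m c 0 ν]
      exact h ν

theorem pr₀_eq_iff (w w' : Brieskorn₀ (bp m)) :
    pr₀ (bp m) w = pr₀ (bp m) w' ↔ ∀ ν, brRed m w 0 ν = brRed m w' 0 ν := by
  refine (Submodule.Quotient.eq _).trans ((mem_range_uMul_iff hm _).trans ?_)
  simp only [map_sub, Pi.sub_apply, sub_eq_zero]

omit hm in
theorem exists_eq_uInvMul_pow (w : GaussManin₀ (bp m)) :
    ∃ (B : ℕ) (w' : Brieskorn₀ (bp m)),
      w = (GaussManin₀.uInvMul (bp m) ^ B) (Brieskorn₀.toGM (bp m) w') := by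
  induction w using Submodule.Quotient.induction_on with | H h =>
  obtain ⟨B, hB⟩ := Laur.exists_bound h
  -- The sign of the bound `B` is unknown. For k < 0 one has k - |B| < B in either case, so
  -- multiplication by u^{|B|} clears the poles.
  obtain ⟨h', hh'⟩ := Laur.exists_ofPow (Laur.single B.natAbs 1 * h) fun k hk => by
    rw [Laur.coeff_single_mul, hB _ (by omega), mul_zero]
  have h1 : ∀ (j : ℕ) (x : Laur (n + 1)),
      (GaussManin₀.uInvMul (bp m) ^ j) (Submodule.Quotient.mk x) =
        Submodule.Quotient.mk (Laur.single (-j) 1 * x) := fun j => by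
    induction j with
    | zero =>
      intro x
      rw [Nat.cast_zero, neg_zero, ← Laur.C_eq_single, map_one, one_mul]
      rfl
    | succ j ih =>
      intro x
      rw [pow_succ', Module.End.mul_apply, ih]
      change Submodule.Quotient.mk (Laur.single (-1) 1 * _) = _
      rw [← mul_assoc, Laur.single_mul_single, one_mul]
      congr 3
      push_cast
      ring
  refine ⟨B.natAbs, Submodule.Quotient.mk h', ?_⟩
  change _ = (GaussManin₀.uInvMul (bp m) ^ B.natAbs) (Submodule.Quotient.mk (Laur.ofPow h'))
  rw [h1, hh', ← mul_assoc, Laur.single_mul_single, one_mul, neg_add_cancel, ← Laur.C_eq_single,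
    map_one, one_mul]

theorem gmRed_injective : Function.Injective (gmRed m) := by
  rw [injective_iff_map_eq_zero]
  intro w hw
  obtain ⟨B, w', rfl⟩ := exists_eq_uInvMul_pow w
  have : w' = 0 := by
    refine brRed_injective hm ?_
    ext k ν
    have h1 := congrFun (congrFun hw (k - B)) ν
    rw [gmRed_uInvMul_pow, sub_add_cancel] at h1
    rw [map_zero]
    exact h1
  rw [this, map_zero, map_zero]

theorem mem_polarPart_iff (w : GaussManin₀ (bp m)) :
    w ∈ polarPart (bpI₀ m) ↔ ∀ k : ℤ, 0 ≤ k → ∀ ν, gmRed m w k ν = 0 := by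
  constructor
  · intro hw
    refine Submodule.iSup_induction _
      (motive := fun w => ∀ k : ℤ, 0 ≤ k → ∀ ν, gmRed m w k ν = 0) hw ?_ ?_ ?_
    · rintro j _ ⟨v, hv, rfl⟩ k hk ν
      rw [LinearMap.comp_apply, gmRed_uInvMul_pow]
      exact (mem_bpI₀_iff hm v).1 hv _ (by push_cast; omega) ν
    · intro k _ ν
      rw [map_zero]
      rfl
    · intro x y hx hy k hk ν
      rw [map_add, Pi.add_apply, Pi.add_apply, hx k hk, hy k hk, add_zero]
  · intro h
    obtain ⟨B, w', hw'⟩ := exists_eq_uInvMul_pow w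
    -- The j-th summand carries the coordinates at u^{-(j+1)}. The pole order of `w` is at most `B`,
    -- which makes the sum finite.
    have h1 : w = ∑ j ∈ Finset.range B, (GaussManin₀.uInvMul (bp m) ^ (j + 1))
        (Brieskorn₀.toGM (bp m) (nfClass m (gmRed m w (-(j + 1))))) := by
      refine gmRed_injective hm ?_
      ext k ν
      rw [map_sum, Finset.sum_apply, Finset.sum_apply]
      simp only [gmRed_uInvMul_pow, gmRed_toGM]
      by_cases hk : 0 ≤ k
      · rw [h k hk, Finset.sum_eq_zero]
        intro j _
        exact brRed_nfClass_of_ne m _ (by push_cast; omega) ν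
      · by_cases hkB : k < -B
        · rw [hw', gmRed_uInvMul_pow, gmRed_toGM, brRed_neg m _ (by omega), Finset.sum_eq_zero]
          intro j hj
          have := Finset.mem_range.1 hj
          exact brRed_nfClass_of_ne m _ (by push_cast; omega) ν
        · obtain ⟨j, rfl⟩ : ∃ j : ℕ, k = -(j + 1) := ⟨(-k - 1).toNat, by omega⟩
          rw [Finset.sum_eq_single j]
          · have : -((j : ℤ) + 1) + ((j + 1 : ℕ) : ℤ) = 0 := by push_cast; ring
            rw [this, brRed_nfClass_zero]
          · intro i _ hi
            exact brRed_nfClass_of_ne m _ (by push_cast; omega) ν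
          · intro hj
            exact absurd (Finset.mem_range.2 (by omega)) hj
    rw [h1]
    refine Submodule.sum_mem _ fun j _ => Submodule.mem_iSup_of_mem j ⟨_, ?_, rfl⟩
    rw [← range_nfClass]
    exact ⟨_, rfl⟩

/-! ### The canonical section -/

/-- A value of the section lies in I₀, so it is known from its coordinates at u^0, and these are
invariants of the class modulo u. No freedom is left, which gives uniqueness and a formula to define
the section by. -/
theorem IsCanonicalSection.apply_pr₀ {σ₀ : Omega₀ (bp m) →ₗ[ℂ] Brieskorn₀ (bp m)}
    (hσ₀ : IsCanonicalSection m σ₀) (w : Brieskorn₀ (bp m)) :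
    σ₀ (pr₀ (bp m) w) = nfClass m (brRed m w 0) := by
  have h1 : σ₀ (pr₀ (bp m) w) ∈ bpI₀ m := by
    rw [← hσ₀.2]
    exact ⟨_, rfl⟩
  rw [← range_nfClass] at h1
  obtain ⟨c, hc⟩ := h1
  rw [← hc]
  congr 1
  ext ν
  rw [← brRed_nfClass_zero m c ν, hc]
  exact (pr₀_eq_iff hm _ _).1 (hσ₀.1 (pr₀ _ w)) ν

theorem existsUnique_canonicalSection : ∃! σ₀, IsCanonicalSection m σ₀ := by
  have hex : ∃ σ₀ : Omega₀ (bp m) →ₗ[ℂ] Brieskorn₀ (bp m), ∀ w,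
      σ₀ (pr₀ (bp m) w) = nfClass m (brRed m w 0) := by
    let T : Brieskorn₀ (bp m) →ₗ[ℂ] Brieskorn₀ (bp m) :=
      nfClass m ∘ₗ LinearMap.proj 0 ∘ₗ brRed m
    have hT : ∀ w, T w = nfClass m (brRed m w 0) := fun _ => rfl
    clear_value T
    refine ⟨Submodule.liftQ (LinearMap.range (Brieskorn₀.uMul (bp m))) T fun w hw => ?_,
      fun w => Eq.trans (Submodule.liftQ_apply _ _ _) (hT w)⟩
    have : brRed m w 0 = 0 := funext ((mem_range_uMul_iff hm w).1 hw)
    rw [LinearMap.mem_ker, hT, this, map_zero]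
  obtain ⟨σ₀, hσ₀⟩ := hex
  have hsec : ∀ w, pr₀ (bp m) (nfClass m (brRed m w 0)) = pr₀ (bp m) w := fun w => by
    rw [pr₀_eq_iff hm]
    exact brRed_nfClass_zero m _
  refine ⟨σ₀, ⟨fun w => ?_, ?_⟩, fun σ' hσ' => LinearMap.ext fun w => ?_⟩
  · obtain ⟨w, rfl⟩ := Submodule.mkQ_surjective _ w
    exact (congrArg _ (hσ₀ w)).trans (hsec w)
  · rw [← range_nfClass]
    refine le_antisymm ?_ ?_
    · rintro _ ⟨w, rfl⟩
      obtain ⟨w, rfl⟩ := Submodule.mkQ_surjective _ w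
      exact ⟨_, (hσ₀ w).symm⟩
    · rintro _ ⟨c, rfl⟩
      refine ⟨pr₀ _ (nfClass m c), (hσ₀ _).trans ?_⟩
      congr 1
      exact funext (brRed_nfClass_zero m c)
  · obtain ⟨w, rfl⟩ := Submodule.mkQ_surjective _ w
    exact (hσ'.apply_pr₀ hm w).trans (hσ₀ w).symm

variable {σ₀ : Omega₀ (bp m) →ₗ[ℂ] Brieskorn₀ (bp m)} (hσ₀ : IsCanonicalSection m σ₀)
include hσ₀

theorem IsCanonicalSection.apply_pr₀_nfClass (c : Gam m → ℂ) :
    σ₀ (pr₀ (bp m) (nfClass m c)) = nfClass m c := by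
  rw [hσ₀.apply_pr₀ hm]
  congr 1
  exact funext (brRed_nfClass_zero m c)

theorem IsCanonicalSection.exists_nfClass (w : Omega₀ (bp m)) : ∃ c, σ₀ w = nfClass m c := by
  obtain ⟨w, rfl⟩ := Submodule.mkQ_surjective _ w
  exact ⟨_, hσ₀.apply_pr₀ hm w⟩

omit hσ₀ in
-- The coordinates of a normal form sit at u^0 only, and `gmRed_t` moves them to u^1 with diagonal
-- weights. Thus A₀ = 0, and A₁ is diagonal in the basis x^ν with eigenvalues `bpExponent`.
theorem t_nfClass (c : Gam m → ℂ) :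
    GaussManin₀.t (bp m) (Brieskorn₀.toGM (bp m) (nfClass m c)) =
      GaussManin₀.uMul (bp m) (Brieskorn₀.toGM (bp m) (nfClass m (bpExponent m * c))) := by
  refine gmRed_injective hm ?_
  ext k ν
  rw [gmRed_t, gmRed_uMul, gmRed_toGM, gmRed_toGM]
  rcases eq_or_ne k 1 with rfl | hk
  · rw [sub_self, brRed_nfClass_zero, brRed_nfClass_zero, Pi.mul_apply]
    push_cast
    ring
  · rw [brRed_nfClass_of_ne m _ (by omega), brRed_nfClass_of_ne m _ (by omega), mul_zero]

theorem IsCanonicalSection.isGoodSection₀ : IsGoodSection₀ σ₀ := by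
  refine ⟨hσ₀.1, fun w => ?_⟩
  obtain ⟨c, hc⟩ := hσ₀.exists_nfClass hm w
  refine ⟨0, pr₀ (bp m) (nfClass m (bpExponent m * c)), ?_⟩
  rw [hc, hσ₀.apply_pr₀_nfClass hm, t_nfClass hm, map_zero, map_zero, zero_add]

omit hm hσ₀ in
open Classical in
theorem brRed_cls_xpow (μ : Fin (n + 1) → ℕ) (k : ℤ) (ν : Gam m) :
    brRed m (Brieskorn₀.cls (bp m) (xpow μ)) k ν =
      if k = ∑ i, ((μ i / m i : ℕ) : ℤ) ∧ ∀ i, μ i % m i = ν i then redFactor m μ else 0 := by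
  rw [Brieskorn₀.cls, brRed_mk, Laur.ofPow_C, Laur.C_eq_single, red_single_xpow, zero_add]

open Classical in
omit hσ₀ in
theorem bpOmega_eq : bpOmega m =
    nfClass m (Pi.single (fun i => ⟨0, by have := hm i; omega⟩) 1) := by
  refine congrArg (Brieskorn₀.cls (bp m)) ?_
  rw [nfConv, Finset.sum_eq_single (fun i => ⟨0, by have := hm i; omega⟩), Pi.single_eq_same,
    one_smul]
  · exact Conv.xpow_zero.symm
  · intro ν _ h
    rw [Pi.single_eq_of_ne h, zero_smul]
  · simp

/-- [ω₀] is the basis vector x^0, hence an eigenvector of the diagonal A₁. It generates because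
every class in Ω_f is represented by its normal form times 1. -/
theorem IsCanonicalSection.isPrimitiveVector :
    IsPrimitiveVector σ₀ (pr₀ (bp m) (bpOmega m)) := by
  classical
  refine ⟨fun h => ?_, ⟨bpExponent m fun i => ⟨0, by have := hm i; omega⟩, 0, ?_⟩, 1, rfl,
    fun w => ?_⟩
  · rw [← map_zero (pr₀ (bp m)), pr₀_eq_iff hm] at h
    have h1 := h fun i => ⟨0, by have := hm i; omega⟩
    rw [bpOmega_eq hm, brRed_nfClass_zero, Pi.single_eq_same, map_zero] at h1
    exact one_ne_zero h1
  · rw [map_smul, bpOmega_eq hm, hσ₀.apply_pr₀_nfClass hm, t_nfClass hm, map_zero, map_zero,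
      zero_add, ← map_smul]
    congr 3
    ext ν
    rw [Pi.mul_apply, Pi.smul_apply, smul_eq_mul]
    rcases eq_or_ne ν fun i => ⟨0, by have := hm i; omega⟩ with rfl | hν
    · rfl
    · rw [Pi.single_eq_of_ne hν, mul_zero, mul_zero]
  · obtain ⟨w, rfl⟩ := Submodule.mkQ_surjective _ w
    refine ⟨nfConv m (brRed m w 0), ?_⟩
    rw [mul_one]
    refine (pr₀_eq_iff hm _ _).2 fun ν => ?_
    exact (brRed_nfClass_zero m _ ν).symm

end BrieskornPhamLattice

/-! ### Exponentials and triangular systems -/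

/-- Well-founded recursion in the form of a fixed point. It solves the three systems triangular in
the exponent of s: division in s, lattice elements with prescribed coordinates, and the Taylor
coefficients. -/
theorem exists_triangular {α X : Type*} [Inhabited X] [Preorder α] [WellFoundedLT α]
    (G : α → (α → X) → X) (hG : ∀ a g g', (∀ b < a, g b = g' b) → G a g = G a g') :
    ∃ g : α → X, ∀ a, g a = G a g := by
  classical
  -- The default value is never consulted, because `G a` depends only on values strictly below `a`.
  let P : ∀ a : α, (∀ b, b < a → X) → X := fun a prev =>
    G a fun b => if h : b < a then prev b h else default
  refine ⟨(wellFounded_lt (α := α)).fix P, fun a => ?_⟩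
  rw [WellFounded.fix_eq]
  refine hG a _ _ fun b hb => ?_
  rw [dif_pos hb]

section Series

variable {R σ : Type} [CommRing R]

open Classical in
-- Only the pair (0, a) has second entry a; every other pair has a strictly smaller one. Separating
-- it makes convolutions triangular.
theorem coeff_mul_eq_add_lower (φ ψ : MvPowerSeries σ R) (a : σ →₀ ℕ) :
    MvPowerSeries.coeff a (φ * ψ) =
      MvPowerSeries.constantCoeff φ * MvPowerSeries.coeff a ψ +
        ∑ p ∈ (Finset.HasAntidiagonal.antidiagonal a).filter (fun p => p.2 < a),
          MvPowerSeries.coeff p.1 φ * MvPowerSeries.coeff p.2 ψ := by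
  have h1 : (Finset.HasAntidiagonal.antidiagonal a).filter (fun p => p.2 < a) =
      (Finset.HasAntidiagonal.antidiagonal a).erase (0, a) := by
    ext p
    simp only [Finset.mem_filter, Finset.mem_erase, Finset.HasAntidiagonal.mem_antidiagonal]
    constructor
    · rintro ⟨h, h2⟩
      exact ⟨fun h3 => h2.ne (congrArg Prod.snd h3), h⟩
    · rintro ⟨h, h2⟩
      refine ⟨h2, lt_of_le_of_ne (h2 ▸ le_add_self) fun h3 => h (Prod.ext ?_ h3)⟩
      rw [h3] at h2
      simpa using h2
  rw [MvPowerSeries.coeff_mul, h1, ← Finset.add_sum_erase (a := ((0 : σ →₀ ℕ), a))]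
  · rfl
  · simp

variable [Algebra ℂ R]

theorem constantCoeff_expSeries {y : MvPowerSeries σ R}
    (hy : MvPowerSeries.constantCoeff y = 0) :
    MvPowerSeries.constantCoeff (expSeries y) = 1 := by
  have h := coeff_expSeries hy 0 1 (by simp)
  rw [expTrunc, Finset.sum_range_one, pow_zero, Nat.factorial_zero, Nat.cast_one, div_one,
    map_one, one_smul] at h
  rw [← MvPowerSeries.coeff_zero_eq_constantCoeff_apply, h,
    MvPowerSeries.coeff_zero_eq_constantCoeff_apply, map_one]

theorem pderiv_expTrunc (j : σ) (y : MvPowerSeries σ R) (M : ℕ) :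
    MvPowerSeries.pderiv R j (expTrunc y (M + 1)) =
      MvPowerSeries.pderiv R j y * expTrunc y M := by
  have hsm : ∀ (c : ℂ) (h : MvPowerSeries σ R),
      MvPowerSeries.pderiv R j (c • h) = c • MvPowerSeries.pderiv R j h := fun c h => by
    rw [← algebraMap_smul R c h, Derivation.map_smul, algebraMap_smul]
  rw [expTrunc, Finset.sum_range_succ', map_add, map_sum, expTrunc, Finset.mul_sum, hsm, pow_zero,
    Derivation.map_one_eq_zero, smul_zero, add_zero]
  refine Finset.sum_congr rfl fun j _ => ?_
  rw [hsm, Derivation.leibniz_pow, Nat.add_sub_cancel, mul_smul_comm,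
    ← Nat.cast_smul_eq_nsmul ℂ, smul_smul, smul_eq_mul, mul_comm (y ^ j)]
  congr 1
  rw [Nat.factorial_succ]
  push_cast
  have : ((j : ℂ) + 1) ≠ 0 := by exact_mod_cast Nat.succ_ne_zero j
  have : (j.factorial : ℂ) ≠ 0 := by exact_mod_cast Nat.factorial_ne_zero j
  simp
  field_simp

theorem pderiv_expSeries (j : σ) {y : MvPowerSeries σ R}
    (hy : MvPowerSeries.constantCoeff y = 0) :
    MvPowerSeries.pderiv R j (expSeries y) = MvPowerSeries.pderiv R j y * expSeries y := by
  classical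
  ext a
  -- The coefficient at a + e_j has degree |a| + 1 and needs truncation order |a| + 2.
  -- Differentiation lowers the order to |a| + 1, which still covers all degrees up to |a|.
  rw [MvPowerSeries.coeff_pderiv, coeff_expSeries hy _ (a.degree + 1 + 1) (by simp),
    ← MvPowerSeries.coeff_pderiv, pderiv_expTrunc, MvPowerSeries.coeff_mul,
    MvPowerSeries.coeff_mul]
  refine Finset.sum_congr rfl fun p hp => ?_
  rw [coeff_expSeries hy p.2 (a.degree + 1)]
  have h4 := Finset.HasAntidiagonal.mem_antidiagonal.mp hp
  rw [← h4, map_add]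
  omega

end Series

/-! ### Coordinates on the Gauss-Manin system of a deformation -/

section Deformation

variable {n : ℕ} (m : Fin (n + 1) → ℕ) {σ : Type}

/-- The coordinates of the coefficients of a series in `s`. -/
def serRed : MvPowerSeries σ (Laur (n + 1)) →+ ((σ →₀ ℕ) → ℤ → Gam m → ℂ) where
  toFun h a := red m (MvPowerSeries.coeff a h)
  map_zero' := funext fun a => by rw [map_zero, map_zero]; rfl
  map_add' h h' := funext fun a => by rw [map_add, map_add]; rfl

theorem serRed_apply (h : MvPowerSeries σ (Laur (n + 1))) (a : σ →₀ ℕ) :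
    serRed m h a = red m (MvPowerSeries.coeff a h) := rfl

theorem coeff_twistedDiff_C (f : Conv (n + 1))
    (g : Fin (n + 1) → MvPowerSeries σ (Laur (n + 1))) (a : σ →₀ ℕ) :
    MvPowerSeries.coeff a (twistedDiff (K := MvPowerSeries σ ℂ)
      (fun i => extendBase σ (Laur.pderiv i)) (MvPowerSeries.C (Laur.u _))
      (inLaur (MvPowerSeries.C f)) g) =
    twistedDiff (K := ℂ) (fun i => Laur.pderiv i) (Laur.u _) (Laur.C f)
      (fun i => MvPowerSeries.coeff a (g i)) := by
  rw [twistedDiff_apply, twistedDiff_apply, map_sum]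
  refine Finset.sum_congr rfl fun i _ => ?_
  rw [inLaur, MvPowerSeries.map_C, extendBase_C, map_sub, MvPowerSeries.coeff_C_mul,
    MvPowerSeries.coeff_C_mul]
  rfl

/-- The coordinates on the Gauss-Manin system of the trivial deformation of `f`. -/
def trivRed : GaussManinSystem (MvPowerSeries.C (bp m) : MvPowerSeries σ (Conv (n + 1))) →+
    ((σ →₀ ℕ) → ℤ → Gam m → ℂ) :=
  QuotientAddGroup.lift _ (serRed m) (by
    rintro _ ⟨g, rfl⟩
    rw [AddMonoidHom.mem_ker]
    funext a
    rw [serRed_apply, coeff_twistedDiff_C, twistedDiff_apply, map_sum]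
    exact Finset.sum_eq_zero fun i _ => red_twisted m i _)

theorem trivRed_mk (h : MvPowerSeries σ (Laur (n + 1))) :
    trivRed m (Submodule.Quotient.mk h) = serRed m h := rfl

variable {m} {F : MvPowerSeries σ (Conv (n + 1))} (hF : MvPowerSeries.constantCoeff F = bp m)

theorem Φ_mk {N : ℕ} {F : MvPowerSeries σ (Conv N)} {f : Conv N}
    (hF : MvPowerSeries.constantCoeff F = f) (h : MvPowerSeries σ (Laur N)) :
    GaussManinSystem.Φ F hF (Submodule.Quotient.mk h) =
      Submodule.Quotient.mk (expSeries (GaussManinSystem.exponent F f) * h) := rfl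

include hF in
variable (F) in
/-- The coordinates on the Gauss-Manin system of `F` given by `Φ`. -/
def defRed : GaussManinSystem F →+ ((σ →₀ ℕ) → ℤ → Gam m → ℂ) :=
  (trivRed m).comp (GaussManinSystem.Φ F hF).toAddMonoidHom

theorem defRed_apply (w : GaussManinSystem F) :
    defRed F hF w = trivRed m (GaussManinSystem.Φ F hF w) := rfl

theorem defRed_mk (h : MvPowerSeries σ (Laur (n + 1))) (a : σ →₀ ℕ) :
    defRed F hF (Submodule.Quotient.mk h) a =
      red m (MvPowerSeries.coeff a (expSeries (GaussManinSystem.exponent F (bp m)) * h)) := by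
  rw [defRed_apply, Φ_mk, trivRed_mk, serRed_apply]

theorem uMul_mk {N : ℕ} (F : MvPowerSeries σ (Conv N)) (h : MvPowerSeries σ (Laur N)) :
    GaussManinSystem.uMul F (Submodule.Quotient.mk h) =
      Submodule.Quotient.mk (MvPowerSeries.C (Laur.u N) * h) := rfl

theorem uInvMul_mk {N : ℕ} (F : MvPowerSeries σ (Conv N)) (h : MvPowerSeries σ (Laur N)) :
    GaussManinSystem.uInvMul F (Submodule.Quotient.mk h) =
      Submodule.Quotient.mk (MvPowerSeries.C (Laur.uInv N) * h) := rfl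

theorem t_mk {N : ℕ} (F : MvPowerSeries σ (Conv N)) (h : MvPowerSeries σ (Laur N)) :
    GaussManinSystem.t F (Submodule.Quotient.mk h) =
      Submodule.Quotient.mk (inLaur F * h +
        MvPowerSeries.C (Laur.u N) * extendBase σ (Laur.euler N) h) := rfl

theorem dS_mk {N : ℕ} (F : MvPowerSeries σ (Conv N)) (j : σ) (h : MvPowerSeries σ (Laur N)) :
    GaussManinSystem.dS F j (Submodule.Quotient.mk h) =
      Submodule.Quotient.mk (MvPowerSeries.pderiv (Laur N) j h -
        MvPowerSeries.pderiv (Laur N) j (inLaur F) * MvPowerSeries.C (Laur.uInv N) * h) := rfl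

theorem uMul_uInvMul {N : ℕ} (F : MvPowerSeries σ (Conv N)) (w : GaussManinSystem F) :
    GaussManinSystem.uMul F (GaussManinSystem.uInvMul F w) = w := by
  induction w using Submodule.Quotient.induction_on with | H h =>
  rw [uInvMul_mk, uMul_mk, ← mul_assoc, ← map_mul, Laur.u_mul_uInv, map_one, one_mul]

theorem uInvMul_uMul {N : ℕ} (F : MvPowerSeries σ (Conv N)) (w : GaussManinSystem F) :
    GaussManinSystem.uInvMul F (GaussManinSystem.uMul F w) = w := by
  induction w using Submodule.Quotient.induction_on with | H h =>
  rw [uMul_mk, uInvMul_mk, ← mul_assoc, ← map_mul, mul_comm (Laur.uInv N), Laur.u_mul_uInv, map_one,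
    one_mul]

theorem defRed_uMul (w : GaussManinSystem F) (a : σ →₀ ℕ) (k : ℤ) (ν : Gam m) :
    defRed F hF (GaussManinSystem.uMul F w) a k ν = defRed F hF w a (k - 1) ν := by
  induction w using Submodule.Quotient.induction_on with | H h =>
  rw [uMul_mk, defRed_mk, defRed_mk, mul_left_comm, MvPowerSeries.coeff_C_mul, red_u_mul]

theorem defRed_uInvMul (w : GaussManinSystem F) (a : σ →₀ ℕ) (k : ℤ) (ν : Gam m) :
    defRed F hF (GaussManinSystem.uInvMul F w) a k ν = defRed F hF w a (k + 1) ν := by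
  rw [← uMul_uInvMul F w, defRed_uMul, uMul_uInvMul, add_sub_cancel_right]

open Classical in
theorem defRed_smul (c : MvPowerSeries σ ℂ) (w : GaussManinSystem F) (a : σ →₀ ℕ) (k : ℤ)
    (ν : Gam m) :
    defRed F hF (c • w) a k ν = ∑ p ∈ Finset.HasAntidiagonal.antidiagonal a,
      MvPowerSeries.coeff p.1 c * defRed F hF w p.2 k ν := by
  induction w using Submodule.Quotient.induction_on with | H h =>
  rw [← Submodule.Quotient.mk_smul, defRed_mk, Algebra.smul_def, mul_left_comm,
    MvPowerSeries.coeff_mul, map_sum, Finset.sum_apply, Finset.sum_apply]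
  refine Finset.sum_congr rfl fun p _ => ?_
  rw [MvPowerSeries.algebraMap_apply'', MvPowerSeries.coeff_map, ← Algebra.smul_def, map_smul]
  rfl

/-- Differentiating e^{(f-F)/u} produces exactly the twist -u⁻¹ ∂_s F. Multiplication by the
exponential therefore turns the twisted derivative into the plain one. -/
theorem defRed_dS (j : σ) (w : GaussManinSystem F) (a : σ →₀ ℕ) (k : ℤ) (ν : Gam m) :
    defRed F hF (GaussManinSystem.dS F j w) a k ν =
      ((a j : ℂ) + 1) * defRed F hF w (a + Finsupp.single j 1) k ν := by
  induction w using Submodule.Quotient.induction_on with | H h =>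
  have h1 := pderiv_expSeries j (GaussManinSystem.constantCoeff_exponent hF)
  have h2 : MvPowerSeries.pderiv _ j (GaussManinSystem.exponent F (bp m)) =
      -(MvPowerSeries.C (Laur.uInv _) * MvPowerSeries.pderiv _ j (inLaur F)) := by
    rw [GaussManinSystem.exponent, Derivation.leibniz, MvPowerSeries.pderiv_C, smul_zero, add_zero,
      map_sub, inLaur, MvPowerSeries.map_C, MvPowerSeries.pderiv_C, zero_sub, smul_neg,
      smul_eq_mul]
  have h3 : expSeries (GaussManinSystem.exponent F (bp m)) *
      (MvPowerSeries.pderiv (Laur _) j h -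
        MvPowerSeries.pderiv (Laur _) j (inLaur F) * MvPowerSeries.C (Laur.uInv _) * h) =
      MvPowerSeries.pderiv (Laur _) j (expSeries (GaussManinSystem.exponent F (bp m)) * h) := by
    rw [Derivation.leibniz, h1, h2, smul_eq_mul, smul_eq_mul]
    ring
  rw [dS_mk, defRed_mk, defRed_mk, h3, MvPowerSeries.coeff_pderiv,
    Laur.mul_natCast_add_one, map_smul]
  rfl

/-- Applying u · u∂_u to the exponent (f - F)/u gives F - f. Hence Φ carries the t-action of F to
that of f, and `red_t` applies to each coefficient of s^a. -/
theorem defRed_t (w : GaussManinSystem F) (a : σ →₀ ℕ) (k : ℤ) (ν : Gam m) :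
    defRed F hF (GaussManinSystem.t F w) a k ν =
      (bpExponent m ν + k - 1) * defRed F hF w a (k - 1) ν := by
  induction w using Submodule.Quotient.induction_on with | H h =>
  have h1 := extendBase_expSeries (Laur.euler (n + 1)) (GaussManinSystem.constantCoeff_exponent hF)
  have h2 : MvPowerSeries.C (Laur.u _) *
      extendBase σ (Laur.euler (n + 1)) (GaussManinSystem.exponent F (bp m)) =
      inLaur F - inLaur (MvPowerSeries.C (bp m)) := by
    have h3 : ∀ G : MvPowerSeries σ (Conv (n + 1)),
        extendBase σ (Laur.euler (n + 1)) (inLaur G) = 0 := fun G => by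
      ext1 a
      exact Laur.euler_C _
    have h4 : Laur.euler (n + 1) (Laur.uInv _) = -Laur.uInv _ := by
      refine Laur.ext' fun k => ?_
      rw [Laur.coeff_euler, ← zero_sub, Laur.coeff_sub, Laur.uInv, Laur.coeff_single,
        Laur.coeff_zero]
      split_ifs with h
      · rw [h]
        simp
      · simp
    rw [GaussManinSystem.exponent, Derivation.leibniz, extendBase_C, map_sub, h3, h3, h4, sub_zero,
      smul_zero, zero_add, smul_eq_mul, map_neg, mul_neg, mul_neg, mul_left_comm, ← mul_assoc,
      mul_assoc, ← map_mul, Laur.u_mul_uInv, map_one, mul_one, neg_sub]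
  have h3 : expSeries (GaussManinSystem.exponent F (bp m)) *
      (inLaur F * h + MvPowerSeries.C (Laur.u _) * extendBase σ (Laur.euler _) h) =
      inLaur (MvPowerSeries.C (bp m)) * (expSeries (GaussManinSystem.exponent F (bp m)) * h) +
        MvPowerSeries.C (Laur.u _) * extendBase σ (Laur.euler _)
          (expSeries (GaussManinSystem.exponent F (bp m)) * h) := by
    rw [Derivation.leibniz, h1, smul_eq_mul, smul_eq_mul]
    linear_combination (-(expSeries (GaussManinSystem.exponent F (bp m))) * h) * h2
  rw [t_mk, defRed_mk, defRed_mk, h3, ← red_t, map_add, inLaur, MvPowerSeries.map_C,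
    MvPowerSeries.coeff_C_mul, MvPowerSeries.coeff_C_mul]
  rfl

end Deformation

/-! ### The Brieskorn lattice of a deformation -/

section DeformationLattice

variable {n : ℕ} {m : Fin (n + 1) → ℕ} {σ : Type}

variable (m) in
/-- The normal form `∑ c_{a,k,ν} x^ν u^k s^a`. -/
def nfSer (c : (σ →₀ ℕ) → ℕ → Gam m → ℂ) : MvPowerSeries σ (Pow (n + 1)) := fun a => nfPow m (c a)

theorem coeff_nfSer (c : (σ →₀ ℕ) → ℕ → Gam m → ℂ) (a : σ →₀ ℕ) :
    MvPowerSeries.coeff a (nfSer m c) = nfPow m (c a) := rfl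

variable {F : MvPowerSeries σ (Conv (n + 1))} (hF : MvPowerSeries.constantCoeff F = bp m)

include hF in
-- In the coefficient of s^a, the terms of dF ∧ g that involve s-derivatives of F of positive order
-- use only the quotients at b < a. With these moved into the dividend as `low`, what remains is a
-- division with respect to f alone.
theorem exists_division_ser (hm : ∀ i, 2 ≤ m i) (h : MvPowerSeries σ (Pow (n + 1))) :
    ∃ (c : (σ →₀ ℕ) → ℕ → Gam m → ℂ) (g : Fin (n + 1) → MvPowerSeries σ (Pow (n + 1))),
      h + twistedDiff (K := MvPowerSeries σ ℂ) (fun i => extendBase σ (Pow.pderiv i))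
        (MvPowerSeries.C (Pow.u _)) (inPow F) g = nfSer m c := by
  classical
  choose c g hg using exists_division_pow (m := m) hm
  let low : (σ →₀ ℕ) → ((σ →₀ ℕ) → Fin (n + 1) → Pow (n + 1)) → Pow (n + 1) := fun a G =>
    ∑ i, ∑ p ∈ (Finset.HasAntidiagonal.antidiagonal a).filter (fun p => p.2 < a),
      MvPowerSeries.coeff p.1 (extendBase σ (Pow.pderiv i) (inPow F)) * G p.2 i
  have : Inhabited (Fin (n + 1) → Pow (n + 1)) := ⟨0⟩
  obtain ⟨G, hG⟩ := exists_triangular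
    (fun (a : σ →₀ ℕ) G => g (MvPowerSeries.coeff a h - low a G)) fun a G G' hGG' => by
      have : low a G = low a G' := Finset.sum_congr rfl fun i _ => Finset.sum_congr rfl
        fun p hp => by rw [hGG' p.2 (Finset.mem_filter.1 hp).2]
      rw [this]
  let G' : Fin (n + 1) → MvPowerSeries σ (Pow (n + 1)) := fun i a => G a i
  have hG' : ∀ i a, MvPowerSeries.coeff a (G' i) = G a i := fun _ _ => rfl
  refine ⟨fun a => c (MvPowerSeries.coeff a h - low a G), G', ?_⟩
  ext1 a
  rw [coeff_nfSer, ← hg, ← hG a, map_add, twistedDiff_apply, twistedDiff_apply, map_sum,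
    sub_add_eq_add_sub, add_sub_assoc]
  congr 1
  rw [← Finset.sum_sub_distrib]
  refine Finset.sum_congr rfl fun i _ => ?_
  have h0 : MvPowerSeries.constantCoeff (inPow F) = Pow.C (bp m) := by
    rw [← hF]
    rfl
  rw [map_sub, MvPowerSeries.coeff_C_mul, coeff_mul_eq_add_lower, constantCoeff_extendBase, h0, hG']
  simp only [hG']
  rw [sub_sub]
  rfl

variable (F) in
/-- The coordinates on the Brieskorn lattice of `F` given by `Φ`. -/
def latRed : BrieskornLattice F →+ ((σ →₀ ℕ) → ℤ → Gam m → ℂ) :=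
  (defRed F hF).comp (BrieskornLattice.toGM F).toAddMonoidHom

theorem defRed_toGM (w : BrieskornLattice F) :
    defRed F hF (BrieskornLattice.toGM F w) = latRed F hF w := rfl

theorem toGM_mk {N : ℕ} (F : MvPowerSeries σ (Conv N)) (h : MvPowerSeries σ (Pow N)) :
    BrieskornLattice.toGM F (Submodule.Quotient.mk h) =
      Submodule.Quotient.mk (mapOfPow N σ h) := rfl

theorem latRed_mk (h : MvPowerSeries σ (Pow (n + 1))) (a : σ →₀ ℕ) :
    latRed F hF (Submodule.Quotient.mk h) a =
      red m (MvPowerSeries.coeff a (expSeries (GaussManinSystem.exponent F (bp m)) *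
        mapOfPow (n + 1) σ h)) := by
  rw [← defRed_toGM, toGM_mk, defRed_mk]

open Classical in
-- The exponential has constant term 1 in s, so the coefficient at a enters its own coordinates
-- unchanged. Both the injectivity and the surjectivity of the coordinates at k ≥ 0 come from this
-- unipotent shape.
theorem latRed_mk_eq_add_lower (h : MvPowerSeries σ (Pow (n + 1))) (a : σ →₀ ℕ) :
    latRed F hF (Submodule.Quotient.mk h) a = red m (Laur.ofPow (MvPowerSeries.coeff a h)) +
      red m (∑ p ∈ (Finset.HasAntidiagonal.antidiagonal a).filter (fun p => p.2 < a),
        MvPowerSeries.coeff p.1 (expSeries (GaussManinSystem.exponent F (bp m))) *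
          Laur.ofPow (MvPowerSeries.coeff p.2 h)) := by
  rw [latRed_mk, coeff_mul_eq_add_lower, constantCoeff_expSeries
    (GaussManinSystem.constantCoeff_exponent hF), one_mul, map_add]
  rfl

theorem latRed_zero (w : BrieskornLattice F) :
    latRed F hF w 0 = brRed m (BrieskornLattice.restrict F hF w) := by
  induction w using Submodule.Quotient.induction_on with | H h =>
  rw [latRed_mk_eq_add_lower, Finset.sum_eq_zero, map_zero, add_zero]
  · rfl
  · intro p hp
    exact absurd (Finset.mem_filter.1 hp).2 (not_lt_zero)

variable (hm : ∀ i, 2 ≤ m i)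
include hm

theorem exists_eq_nfSer (w : BrieskornLattice F) (hF : MvPowerSeries.constantCoeff F = bp m) :
    ∃ c, w = Submodule.Quotient.mk (nfSer m c) := by
  induction w using Submodule.Quotient.induction_on with | H h =>
  obtain ⟨c, g, hc⟩ := exists_division_ser hF hm h
  refine ⟨c, (Submodule.Quotient.eq _).2 ⟨-g, ?_⟩⟩
  rw [map_neg, ← hc, sub_add_cancel_left]

/-- Take a normal form and induct on a. Once the lower coefficients vanish, the coordinates at a are
the coefficients of the normal form, which live at k ≥ 0 only. -/
theorem eq_zero_of_latRed (w : BrieskornLattice F)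
    (hw : ∀ (a : σ →₀ ℕ) (k : ℤ), 0 ≤ k → ∀ ν, latRed F hF w a k ν = 0) : w = 0 := by
  classical
  obtain ⟨c, rfl⟩ := exists_eq_nfSer hm w hF
  have hc : ∀ a, c a = 0 := fun a => by
    induction a using WellFoundedLT.induction with | ind a ih =>
    ext k ν
    have h1 := hw a k (by omega) ν
    rw [latRed_mk_eq_add_lower, Finset.sum_eq_zero, map_zero, add_zero, coeff_nfSer,
      red_ofPow_nfPow] at h1
    · exact h1
    · intro p hp
      have h2 : nfPow m (0 : ℕ → Gam m → ℂ) = 0 := Pow.ext' fun k => by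
        rw [coeff_nfPow, Pi.zero_apply, nfConv_zero]
        exact (map_zero (PowerSeries.coeff (R := Conv (n + 1)) k)).symm
      rw [coeff_nfSer, ih p.2 (Finset.mem_filter.1 hp).2, h2, map_zero, mul_zero]
  rw [Submodule.Quotient.mk_eq_zero]
  have : nfSer m c = 0 := by
    ext1 a
    refine Pow.ext' fun k => ?_
    rw [coeff_nfSer, coeff_nfPow, hc, Pi.zero_apply, nfConv_zero, map_zero]
    exact (map_zero (PowerSeries.coeff (R := Conv (n + 1)) k)).symm
  rw [this]
  exact Submodule.zero_mem _

theorem lattice_ext {w w' : BrieskornLattice F}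
    (hw : ∀ (a : σ →₀ ℕ) (k : ℤ), 0 ≤ k → ∀ ν, latRed F hF w a k ν = latRed F hF w' a k ν) :
    w = w' := by
  rw [← sub_eq_zero]
  refine eq_zero_of_latRed hF hm _ fun a k hk ν => ?_
  rw [map_sub, Pi.sub_apply, Pi.sub_apply, Pi.sub_apply, hw a k hk, sub_self]

omit hm in
-- The triangular system is solved from small a upwards. The lower terms may also have poles in u,
-- so the coordinates at k < 0 are an uncontrolled by-product; only those at k ≥ 0 can be
-- prescribed.
theorem exists_lattice (θ : (σ →₀ ℕ) → ℤ → Gam m → ℂ) :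
    ∃ w : BrieskornLattice F, ∀ (a : σ →₀ ℕ) (k : ℤ), 0 ≤ k → ∀ ν,
      latRed F hF w a k ν = θ a k ν := by
  classical
  let low : (σ →₀ ℕ) → ((σ →₀ ℕ) → ℕ → Gam m → ℂ) → (ℤ → Gam m → ℂ) := fun a c =>
    red m (∑ p ∈ (Finset.HasAntidiagonal.antidiagonal a).filter (fun p => p.2 < a),
      MvPowerSeries.coeff p.1 (expSeries (GaussManinSystem.exponent F (bp m))) *
        Laur.ofPow (nfPow m (c p.2)))
  obtain ⟨c, hc⟩ := exists_triangular
    (fun (a : σ →₀ ℕ) c => fun (k : ℕ) (ν : Gam m) => θ a k ν - low a c k ν) fun a c c' hcc' => by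
      have : low a c = low a c' := congrArg (red m) (Finset.sum_congr rfl
        fun p hp => by rw [hcc' p.2 (Finset.mem_filter.1 hp).2])
      rw [this]
  refine ⟨Submodule.Quotient.mk (nfSer m c), fun a k hk ν => ?_⟩
  lift k to ℕ using hk
  rw [latRed_mk_eq_add_lower, coeff_nfSer, Pi.add_apply, Pi.add_apply, red_ofPow_nfPow, hc a]
  simp only [coeff_nfSer]
  exact sub_add_cancel _ _

omit hm in
theorem exists_mapOfPow {N : ℕ} (h : MvPowerSeries σ (Laur N))
    (hh : ∀ a, ∀ k < 0, Laur.coeff (MvPowerSeries.coeff a h) k = 0) :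
    ∃ h', mapOfPow N σ h' = h := by
  choose g hg using fun a => Laur.exists_ofPow (MvPowerSeries.coeff a h) (hh a)
  let g' : MvPowerSeries σ (Pow N) := fun a => g a
  refine ⟨g', ?_⟩
  ext1 a
  exact hg a

omit hm in
theorem exists_toGM_eq_t {N : ℕ} (F : MvPowerSeries σ (Conv N)) (w : BrieskornLattice F) :
    ∃ w', BrieskornLattice.toGM F w' = GaussManinSystem.t F (BrieskornLattice.toGM F w) := by
  induction w using Submodule.Quotient.induction_on with | H h =>
  obtain ⟨x, hx⟩ := exists_mapOfPow (extendBase σ (Laur.euler N) (mapOfPow N σ h))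
    fun a k hk => by
      have : Laur.coeff (MvPowerSeries.coeff a
          (extendBase σ (Laur.euler N) (mapOfPow N σ h))) k =
        (k : ℂ) • Laur.coeff (Laur.ofPow (MvPowerSeries.coeff a h)) k := rfl
      rw [this, Laur.coeff_ofPow_neg _ hk, smul_zero]
  refine ⟨Submodule.Quotient.mk (inPow F * h + MvPowerSeries.C (Pow.u N) * x), ?_⟩
  rw [toGM_mk, toGM_mk, t_mk, ← hx]
  simp only [mapOfPow_apply]
  rw [map_add, map_mul, map_mul, map_inPow, map_C_X]

omit hm in
theorem map_pderiv {R S : Type} [CommRing R] [CommRing S] (θ : R →+* S) (j : σ)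
    (h : MvPowerSeries σ R) :
    MvPowerSeries.map θ (MvPowerSeries.pderiv R j h) =
      MvPowerSeries.pderiv S j (MvPowerSeries.map θ h) := by
  ext1 a
  rw [MvPowerSeries.coeff_map, MvPowerSeries.coeff_pderiv, MvPowerSeries.coeff_pderiv, map_mul,
    MvPowerSeries.coeff_map, map_add, map_natCast, map_one]

omit hm in
-- The conditions on good sections live in the Gauss-Manin system, whereas coordinates at k ≥ 0
-- determine only lattice elements. Since ∂_s has a pole of order one in u, multiplying by u brings
-- the comparison back into the lattice.
theorem exists_toGM_eq_u_dS {N : ℕ} (F : MvPowerSeries σ (Conv N)) (j : σ)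
    (w : BrieskornLattice F) :
    ∃ w', BrieskornLattice.toGM F w' = GaussManinSystem.uMul F
      (GaussManinSystem.dS F j (BrieskornLattice.toGM F w)) := by
  induction w using Submodule.Quotient.induction_on with | H h =>
  refine ⟨Submodule.Quotient.mk (MvPowerSeries.C (Pow.u N) * MvPowerSeries.pderiv _ j h -
    MvPowerSeries.pderiv _ j (inPow F) * h), ?_⟩
  have h1 : MvPowerSeries.C (Laur.u N) * MvPowerSeries.C (Laur.uInv N) =
      (1 : MvPowerSeries σ (Laur N)) := by
    rw [← map_mul, Laur.u_mul_uInv, map_one]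
  rw [toGM_mk, toGM_mk, dS_mk, uMul_mk]
  simp only [mapOfPow_apply]
  rw [map_sub, map_mul, map_mul, map_C_X, map_pderiv, map_pderiv, map_inPow]
  congr 1
  linear_combination (MvPowerSeries.pderiv _ j (inLaur F) * MvPowerSeries.map Laur.ofPow h) * h1

omit hm in
theorem toGM_uMul {N : ℕ} (F : MvPowerSeries σ (Conv N)) (w : BrieskornLattice F) :
    BrieskornLattice.toGM F (BrieskornLattice.uMul F w) =
      GaussManinSystem.uMul F (BrieskornLattice.toGM F w) := by
  induction w using Submodule.Quotient.induction_on with | H h =>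
  have h1 : BrieskornLattice.uMul F (Submodule.Quotient.mk h) =
    Submodule.Quotient.mk (MvPowerSeries.C (Pow.u N) * h) := rfl
  rw [h1, toGM_mk, toGM_mk, uMul_mk]
  simp only [mapOfPow_apply]
  rw [map_mul, map_C_X]

omit hm in
theorem latRed_uMul (w : BrieskornLattice F) (a : σ →₀ ℕ) (k : ℤ) (ν : Gam m) :
    latRed F hF (BrieskornLattice.uMul F w) a k ν = latRed F hF w a (k - 1) ν := by
  rw [← defRed_toGM, toGM_uMul, defRed_uMul, defRed_toGM]

omit hm in
open Classical in
theorem latRed_smul (c : MvPowerSeries σ ℂ) (w : BrieskornLattice F) (a : σ →₀ ℕ) (k : ℤ)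
    (ν : Gam m) :
    latRed F hF (c • w) a k ν = ∑ p ∈ Finset.HasAntidiagonal.antidiagonal a,
      MvPowerSeries.coeff p.1 c * latRed F hF w p.2 k ν := by
  rw [← defRed_toGM, map_smul, defRed_smul, defRed_toGM]

end DeformationLattice

/-! ### Good sections and the formal primitive form -/

theorem finsupp_induction_single {σ : Type} {P : (σ →₀ ℕ) → Prop} (h0 : P 0)
    (h : ∀ a j, P a → P (a + Finsupp.single j 1)) (a : σ →₀ ℕ) : P a := by
  induction a using WellFoundedLT.induction with | ind a ih =>
  rcases eq_or_ne a 0 with rfl | ha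
  · exact h0
  · obtain ⟨j, hj⟩ := Finsupp.ne_iff.1 ha
    have hle : Finsupp.single j 1 ≤ a := by
      rw [Finsupp.single_le_iff]
      exact Nat.one_le_iff_ne_zero.2 hj
    have h1 : a - Finsupp.single j 1 + Finsupp.single j 1 = a := tsub_add_cancel_of_le hle
    rw [← h1]
    refine h _ _ (ih _ (lt_of_le_of_ne tsub_le_self fun h2 => ?_))
    rw [h2] at h1
    simp at h1

section GoodSections

variable {n : ℕ} {m : Fin (n + 1) → ℕ} {σ : Type}
  {F : MvPowerSeries σ (Conv (n + 1))} (hF : MvPowerSeries.constantCoeff F = bp m)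

variable (F) in
/-- The lattice elements whose coordinates are polynomials in `u⁻¹`. -/
def goodPart : Submodule (MvPowerSeries σ ℂ) (BrieskornLattice F) where
  carrier := {w | ∀ (a : σ →₀ ℕ) (k : ℤ), 1 ≤ k → ∀ ν, latRed F hF w a k ν = 0}
  add_mem' {w w'} hw hw' a k hk ν := by
    rw [map_add, Pi.add_apply, Pi.add_apply, Pi.add_apply, hw a k hk, hw' a k hk, add_zero]
  zero_mem' a k _ ν := by
    rw [map_zero]
    rfl
  smul_mem' c w hw a k hk ν := by
    classical
    rw [latRed_smul]
    exact Finset.sum_eq_zero fun p _ => by rw [hw p.2 k hk, mul_zero]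

theorem latRed_C_smul (c : ℂ) (w : BrieskornLattice F) (a : σ →₀ ℕ) (k : ℤ) (ν : Gam m) :
    latRed F hF ((MvPowerSeries.C c : MvPowerSeries σ ℂ) • w) a k ν =
      c * latRed F hF w a k ν := by
  classical
  rw [latRed_smul, Finset.sum_eq_single (0, a)]
  · rw [MvPowerSeries.coeff_zero_C]
  · intro p hp hne
    rw [MvPowerSeries.coeff_C, if_neg, zero_mul]
    intro h0
    have := Finset.HasAntidiagonal.mem_antidiagonal.1 hp
    rw [h0, zero_add] at this
    exact hne (Prod.ext h0 this)
  · intro h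
    exact absurd (Finset.HasAntidiagonal.mem_antidiagonal.2 (zero_add a)) h

theorem latRed_neg_zero (w : BrieskornLattice F) {k : ℤ} (hk : k < 0) (ν : Gam m) :
    latRed F hF w 0 k ν = 0 := by
  rw [latRed_zero, brRed_neg m _ hk]

/-- Choose `w₁` with the coordinates of `w` shifted down by one. Then u `w₁` cancels every
coordinate of `w` at k ≥ 1, and the hypothesis at k ≥ 2 makes `w₁` itself good. -/
theorem exists_good_add_u_good (w : BrieskornLattice F)
    (hw : ∀ (a : σ →₀ ℕ) (k : ℤ), 2 ≤ k → ∀ ν, latRed F hF w a k ν = 0) :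
    ∃ w₀ ∈ goodPart F hF, ∃ w₁ ∈ goodPart F hF, w = w₀ + BrieskornLattice.uMul F w₁ := by
  obtain ⟨w₁, h₁⟩ := exists_lattice hF fun a k ν => latRed F hF w a (k + 1) ν
  refine ⟨w - BrieskornLattice.uMul F w₁, fun a k hk ν => ?_, w₁, fun a k hk ν => ?_,
    (sub_add_cancel _ _).symm⟩
  · rw [map_sub, Pi.sub_apply, Pi.sub_apply, Pi.sub_apply, latRed_uMul, h₁ a (k - 1) (by omega),
      sub_add_cancel, sub_self]
  · rw [h₁ a k (by omega), hw a _ (by omega)]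

variable (hm : ∀ i, 2 ≤ m i)
include hm

/-- An element u v without coordinates at k ≥ 1 comes from a v without coordinates at k ≥ 0, so v =
0. In the other direction, `exists_lattice` supplies a multiple of u with any given coordinates at k
≥ 1. -/
theorem isCompl_range_uMul_goodPart :
    IsCompl (LinearMap.range (BrieskornLattice.uMul F)) (goodPart F hF) := by
  refine IsCompl.of_eq ?_ ?_
  · rw [eq_bot_iff]
    rintro _ ⟨⟨v, rfl⟩, hv⟩
    have : v = 0 := eq_zero_of_latRed hF hm _ fun a k hk ν => by
      have := hv a (k + 1) (by omega) ν
      rwa [latRed_uMul, add_sub_cancel_right] at this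
    rw [this, map_zero]
    exact Submodule.zero_mem _
  · rw [eq_top_iff]
    intro w _
    obtain ⟨v, hv⟩ := exists_lattice hF fun a k ν => latRed F hF w a (k + 1) ν
    refine Submodule.mem_sup.2 ⟨_, ⟨v, rfl⟩, w - BrieskornLattice.uMul F v, fun a k hk ν => ?_,
      add_sub_cancel _ _⟩
    rw [map_sub, Pi.sub_apply, Pi.sub_apply, Pi.sub_apply, latRed_uMul, hv a (k - 1) (by omega),
      sub_add_cancel, sub_self]

theorem exists_section_goodPart : ∃ σS : Omega F →ₗ[MvPowerSeries σ ℂ] BrieskornLattice F,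
    (∀ w, pr F (σS w) = w) ∧ (∀ w, σS w ∈ goodPart F hF) ∧
      ∀ v ∈ goodPart F hF, ∃ w, σS w = v := by
  let e := Submodule.quotientEquivOfIsCompl _ _ (isCompl_range_uMul_goodPart hF hm)
  refine ⟨(goodPart F hF).subtype ∘ₗ e.toLinearMap, fun w => ?_, fun w => (e w).2,
    fun v hv => ⟨e.symm ⟨v, hv⟩, ?_⟩⟩
  · exact Submodule.mk_quotientEquivOfIsCompl_apply (isCompl_range_uMul_goodPart hF hm) w
  · change ((e (e.symm ⟨v, hv⟩) : goodPart F hF) : BrieskornLattice F) = v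
    rw [LinearEquiv.apply_symm_apply]

omit hm in
theorem isGoodSection_of_goodPart {σS : Omega F →ₗ[MvPowerSeries σ ℂ] BrieskornLattice F}
    (h₁ : ∀ w, pr F (σS w) = w) (h₂ : ∀ w, σS w ∈ goodPart F hF)
    (h₃ : ∀ v ∈ goodPart F hF, ∃ w, σS w = v) : IsGoodSection σS := by
  refine ⟨h₁, fun w => ?_, fun j w => ?_⟩
  · obtain ⟨w', hw'⟩ := exists_toGM_eq_t F (σS w)
    obtain ⟨v₀, hv₀, v₁, hv₁, h⟩ := exists_good_add_u_good hF w' fun a k hk ν => by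
      rw [← defRed_toGM, hw', defRed_t, defRed_toGM, h₂ w a _ (by omega), mul_zero]
    obtain ⟨w₀, rfl⟩ := h₃ v₀ hv₀
    obtain ⟨w₁, rfl⟩ := h₃ v₁ hv₁
    exact ⟨w₀, w₁, by rw [← hw', h, map_add, toGM_uMul]⟩
  · obtain ⟨w', hw'⟩ := exists_toGM_eq_u_dS F j (σS w)
    obtain ⟨v₀, hv₀, v₁, hv₁, h⟩ := exists_good_add_u_good hF w' fun a k hk ν => by
      rw [← defRed_toGM, hw', defRed_uMul, defRed_dS, defRed_toGM, h₂ w _ _ (by omega), mul_zero]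
    obtain ⟨w₀, rfl⟩ := h₃ v₀ hv₀
    obtain ⟨w₁, rfl⟩ := h₃ v₁ hv₁
    -- The decomposition is that of u ∂_s; dividing by u turns v₀ + u v₁ into v₁ + u⁻¹ v₀, which
    -- exchanges the two roles.
    refine ⟨w₁, w₀, ?_⟩
    rw [← uInvMul_uMul F (GaussManinSystem.dS F j _), ← hw', h, map_add, map_add, toGM_uMul,
      uInvMul_uMul]
    exact add_comm _ _

variable {σ₀ : Omega₀ (bp m) →ₗ[ℂ] Brieskorn₀ (bp m)} (hσ₀ : IsCanonicalSection m σ₀)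
include hσ₀

omit hm in
theorem IsCanonicalSection.brRed_apply_of_pos (hm : ∀ i, 2 ≤ m i) (w : Omega₀ (bp m)) {k : ℤ}
    (hk : 1 ≤ k) (ν : Gam m) : brRed m (σ₀ w) k ν = 0 := by
  obtain ⟨c, hc⟩ := hσ₀.exists_nfClass hm w
  rw [hc, brRed_nfClass_of_ne m _ (by omega)]

/-- At s = 0 both sides are classes in the lattice of f. They agree at k < 0 because coordinates
vanish there, at k = 0 because both maps are sections, and at k ≥ 1 because both images have no such
coordinates. -/
theorem extends_of_goodPart {σS : Omega F →ₗ[MvPowerSeries σ ℂ] BrieskornLattice F}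
    (h₁ : ∀ w, pr F (σS w) = w) (h₂ : ∀ w, σS w ∈ goodPart F hF) : Extends hF σS σ₀ := by
  intro w
  refine brRed_injective hm ?_
  ext k ν
  rw [← latRed_zero]
  rcases lt_trichotomy k 0 with hk | rfl | hk
  · rw [latRed_neg_zero hF _ hk, brRed_neg m _ hk]
  · rw [hσ₀.apply_pr₀ hm, brRed_nfClass_zero, ← latRed_zero]
    obtain ⟨v, hv⟩ := (Submodule.Quotient.eq _).1 (h₁ (pr F w))
    have h3 : σS (pr F w) = w + BrieskornLattice.uMul F v := by rw [hv, add_sub_cancel]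
    rw [h3, map_add, Pi.add_apply, Pi.add_apply, Pi.add_apply, latRed_uMul,
      latRed_neg_zero hF v (by norm_num), add_zero]
  · rw [h₂ _ 0 k (by omega), hσ₀.brRed_apply_of_pos hm _ (by omega)]

/-- The lift keeps the coordinates of σ₀ w at s^0 and sets all others at k ≥ 0 to zero. Since ∂_s is
a plain derivative in coordinates, the derivative of the lift has coordinates at k < 0 only, and so
lies in u⁻¹ times the good part. -/
theorem exists_flatLift {σS : Omega F →ₗ[MvPowerSeries σ ℂ] BrieskornLattice F}
    (h₃ : ∀ v ∈ goodPart F hF, ∃ w, σS w = v) : ∃ τ, IsFlatLift hF σS σ₀ τ := by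
  classical
  choose T hT using fun w : Omega₀ (bp m) => exists_lattice hF
    fun (a : σ →₀ ℕ) k ν => if a = 0 then brRed m (σ₀ w) k ν else 0
  let τ : Omega₀ (bp m) →ₛₗ[(MvPowerSeries.C : ℂ →+* MvPowerSeries σ ℂ)] BrieskornLattice F :=
    { toFun := T
      map_add' := fun w w' => lattice_ext hF hm fun a k hk ν => by
        rw [hT _ a k hk, map_add, map_add, map_add, Pi.add_apply, Pi.add_apply, Pi.add_apply,
          Pi.add_apply, Pi.add_apply, hT _ a k hk, hT _ a k hk]
        split_ifs
        · rfl
        · rw [add_zero]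
      map_smul' := fun c w => lattice_ext hF hm fun a k hk ν => by
        rw [hT _ a k hk, latRed_C_smul, hT _ a k hk, map_smul, map_smul, Pi.smul_apply,
          Pi.smul_apply, smul_eq_mul, mul_ite, mul_zero] }
  have hτ : ∀ w, τ w = T w := fun _ => rfl
  clear_value τ
  have hgood : ∀ w, τ w ∈ goodPart F hF := fun w a k hk ν => by
    rw [hτ, hT w a k (by omega), hσ₀.brRed_apply_of_pos hm w hk, ite_self]
  refine ⟨τ, fun w => brRed_injective hm ?_, fun w => ?_, fun j w => ?_⟩
  · ext k ν
    rw [← latRed_zero]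
    rcases lt_or_ge k 0 with hk | hk
    · rw [latRed_neg_zero hF _ hk, brRed_neg m _ hk]
    · rw [hτ, hT w 0 k hk, if_pos rfl]
  · obtain ⟨w', hw'⟩ := h₃ _ (hgood w)
    exact ⟨w', hw'.symm⟩
  · obtain ⟨v, hv⟩ := exists_toGM_eq_u_dS F j (τ w)
    obtain ⟨w', hw'⟩ := h₃ v fun a k hk ν => by
      rw [← defRed_toGM, hv, defRed_uMul, defRed_dS, defRed_toGM, hτ, hT w _ _ (by omega), if_neg,
        mul_zero]
      intro h
      have := DFunLike.congr_fun h j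
      simp at this
    exact ⟨w', by rw [hw', hv, uInvMul_uMul]⟩

omit hσ₀ in
theorem exists_isFormalPrimitiveForm (hσ₀ : IsCanonicalSection m σ₀) :
    ∃ ζ, IsFormalPrimitiveForm hF σ₀ (pr₀ (bp m) (bpOmega m)) ζ := by
  obtain ⟨σS, h₁, h₂, h₃⟩ := exists_section_goodPart hF hm
  obtain ⟨τ, hτ⟩ := exists_flatLift hF hm hσ₀ h₃
  exact ⟨_, hσ₀.isGoodSection₀ hm, hσ₀.isPrimitiveVector hm, σS, τ,
    isGoodSection_of_goodPart hF h₁ h₂ h₃, extends_of_goodPart hF hm hσ₀ h₁ h₂, hτ, rfl⟩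

omit hσ₀ in
-- The coordinate at (a + e_j, k), times a_j + 1, is a coordinate at a of an element of I + u⁻¹ I.
-- It is read from I at the indices k and k + 1, both at least 1, where induction applies. Hence any
-- good extension has its image inside `goodPart`.
theorem latRed_goodSection {σS : Omega F →ₗ[MvPowerSeries σ ℂ] BrieskornLattice F}
    (hσ₀ : IsCanonicalSection m σ₀) (hS : IsGoodSection σS) (hE : Extends hF σS σ₀)
    (a : σ →₀ ℕ) : ∀ w (k : ℤ), 1 ≤ k → ∀ ν, latRed F hF (σS w) a k ν = 0 := by
  induction a using finsupp_induction_single with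
  | h0 =>
    intro w k hk ν
    obtain ⟨w, rfl⟩ := Submodule.mkQ_surjective _ w
    rw [latRed_zero]
    exact (congrArg (fun x => brRed m x k ν) (hE w)).trans (hσ₀.brRed_apply_of_pos hm _ hk ν)
  | h a j ih =>
    intro w k hk ν
    obtain ⟨w₀, w₁, h⟩ := hS.dS_mem j w
    have h1 := defRed_dS hF j (BrieskornLattice.toGM F (σS w)) a k ν
    rw [h, map_add, Pi.add_apply, Pi.add_apply, Pi.add_apply, defRed_uInvMul, defRed_toGM,
      defRed_toGM, defRed_toGM, ih w₀ k hk, ih w₁ _ (by omega), add_zero] at h1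
    exact (mul_eq_zero.1 h1.symm).resolve_left (by exact_mod_cast Nat.succ_ne_zero (a j))

open Classical in
-- For the lift, ∂_s lands in u⁻¹ I, so the index k ≥ 0 is read from I at k + 1 ≥ 1, where it
-- vanishes. Gaining one index over `latRed_goodSection` makes the primitive form unique.
theorem latRed_flatLift {σS : Omega F →ₗ[MvPowerSeries σ ℂ] BrieskornLattice F}
    {τ : Omega₀ (bp m) →ₛₗ[(MvPowerSeries.C : ℂ →+* MvPowerSeries σ ℂ)] BrieskornLattice F}
    (hS : IsGoodSection σS) (hE : Extends hF σS σ₀) (hτ : IsFlatLift hF σS σ₀ τ)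
    (w : Omega₀ (bp m)) (a : σ →₀ ℕ) (k : ℤ) (hk : 0 ≤ k) (ν : Gam m) :
    latRed F hF (τ w) a k ν = if a = 0 then brRed m (σ₀ w) k ν else 0 := by
  split_ifs with ha
  · rw [ha, latRed_zero, hτ.restrict_eq]
  · obtain ⟨j, hj⟩ := Finsupp.ne_iff.1 ha
    have hle : Finsupp.single j 1 ≤ a := by
      rw [Finsupp.single_le_iff]
      exact Nat.one_le_iff_ne_zero.2 hj
    obtain ⟨b, rfl⟩ : ∃ b, a = b + Finsupp.single j 1 := ⟨_, (tsub_add_cancel_of_le hle).symm⟩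
    obtain ⟨w', hw'⟩ := hτ.dS_mem j w
    have h1 := defRed_dS hF j (BrieskornLattice.toGM F (τ w)) b k ν
    rw [hw', defRed_uInvMul, defRed_toGM, defRed_toGM,
      latRed_goodSection hF hm hσ₀ hS hE b w' _ (by omega)] at h1
    exact (mul_eq_zero.1 h1.symm).resolve_left (by exact_mod_cast Nat.succ_ne_zero (b j))

open Classical in
theorem IsFormalPrimitiveForm.latRed_eq {ζ : BrieskornLattice F}
    (hζ : IsFormalPrimitiveForm hF σ₀ (pr₀ (bp m) (bpOmega m)) ζ)
    (a : σ →₀ ℕ) (k : ℤ) (hk : 0 ≤ k) (ν : Gam m) :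
    latRed F hF ζ a k ν = if a = 0 then brRed m (bpOmega m) k ν else 0 := by
  obtain ⟨-, -, σS, τ, hS, hE, hτ, rfl⟩ := hζ
  rw [latRed_flatLift hF hm hσ₀ hS hE hτ _ a k hk, bpOmega_eq hm, hσ₀.apply_pr₀_nfClass hm]

omit hm hσ₀ in
open Classical in
theorem trivRed_ι (w : GaussManin₀ (bp m)) (a : σ →₀ ℕ) (k : ℤ) (ν : Gam m) :
    trivRed m (GaussManinSystem.ι (bp m) w) a k ν = if a = 0 then gmRed m w k ν else 0 := by
  induction w using Submodule.Quotient.induction_on with | H h =>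
  have h1 : GaussManinSystem.ι (bp m) (Submodule.Quotient.mk h) =
    Submodule.Quotient.mk (MvPowerSeries.C h : MvPowerSeries σ (Laur (n + 1))) := rfl
  rw [h1, trivRed_mk, serRed_apply, MvPowerSeries.coeff_C]
  split_ifs
  · rfl
  · rw [map_zero]
    rfl

omit hσ₀ in
open Classical in
-- By `mem_polarPart_iff`, belonging to the polar part means having no coordinates at k ≥ 0.
-- Coordinates depend only on the class, so any representing series can serve as the witness.
theorem phiCongruence_iff (v : Brieskorn₀ (bp m)) (ζ : BrieskornLattice F) :
    PhiCongruence hF (bpI₀ m) v ζ ↔ ∀ (a : σ →₀ ℕ) (k : ℤ), 0 ≤ k → ∀ ν,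
      latRed F hF ζ a k ν = if a = 0 then brRed m v k ν else 0 := by
  have key : ∀ (a : σ →₀ ℕ) (k : ℤ) (ν : Gam m),
      trivRed m (GaussManinSystem.Φ F hF (BrieskornLattice.toGM F ζ) -
        GaussManinSystem.ι (bp m) (Brieskorn₀.toGM (bp m) v)) a k ν =
      latRed F hF ζ a k ν - if a = 0 then brRed m v k ν else 0 := fun a k ν => by
    rw [map_sub, Pi.sub_apply, Pi.sub_apply, Pi.sub_apply, trivRed_ι, ← defRed_apply,
      defRed_toGM, gmRed_toGM]
  have key2 : ∀ (h : MvPowerSeries σ (Laur (n + 1))) (a : σ →₀ ℕ),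
      trivRed m (Submodule.Quotient.mk h) a =
        gmRed m (Submodule.Quotient.mk (MvPowerSeries.coeff a h)) := fun _ _ => rfl
  constructor
  · rintro ⟨h, hh, hP⟩ a k hk ν
    rw [← sub_eq_zero, ← key, ← hh, key2]
    exact (mem_polarPart_iff hm _).1 (hP a) k hk ν
  · intro H
    obtain ⟨h, hh⟩ := Submodule.Quotient.mk_surjective _
      (GaussManinSystem.Φ F hF (BrieskornLattice.toGM F ζ) -
        GaussManinSystem.ι (bp m) (Brieskorn₀.toGM (bp m) v))
    refine ⟨h, hh, fun a => (mem_polarPart_iff hm _).2 fun k hk ν => ?_⟩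
    rw [← key2, hh, key, H a k hk, sub_self]

end GoodSections

/-! ### Powers of the maximal ideal of the base -/

section MaximalIdeal

variable {σ : Type}

theorem constantCoeff_of_mem_maximalIdeal {c : MvPowerSeries σ ℂ}
    (hc : c ∈ IsLocalRing.maximalIdeal (MvPowerSeries σ ℂ)) :
    MvPowerSeries.constantCoeff c = 0 := by
  rw [IsLocalRing.mem_maximalIdeal, mem_nonunits_iff, MvPowerSeries.isUnit_iff_constantCoeff,
    isUnit_iff_ne_zero, not_not] at hc
  exact hc

theorem X_mem_maximalIdeal (j : σ) :
    (MvPowerSeries.X j : MvPowerSeries σ ℂ) ∈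
      IsLocalRing.maximalIdeal (MvPowerSeries σ ℂ) := by
  rw [IsLocalRing.mem_maximalIdeal, mem_nonunits_iff, MvPowerSeries.isUnit_iff_constantCoeff,
    MvPowerSeries.constantCoeff_X]
  exact not_isUnit_zero

/-- Each nonzero exponent a selects one variable s_j dividing s^a. This splits the series as a
finite sum ∑ s_j g_j in which every g_j vanishes in one degree less, and induction applies. -/
theorem mem_maximalIdeal_pow_smul_top [Fintype σ] {R : Type} [CommRing R] [Algebra ℂ R] (K : ℕ)
    (h : MvPowerSeries σ R) (hh : ∀ a : σ →₀ ℕ, a.degree < K → MvPowerSeries.coeff a h = 0) :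
    h ∈ IsLocalRing.maximalIdeal (MvPowerSeries σ ℂ) ^ K •
      (⊤ : Submodule (MvPowerSeries σ ℂ) (MvPowerSeries σ R)) := by
  classical
  induction K generalizing h with
  | zero =>
    rw [pow_zero, Ideal.one_eq_top, Submodule.top_smul]
    exact Submodule.mem_top
  | succ K ih =>
    -- `Option` is needed because a = 0 selects no variable and the index type may be empty.
    have hsel : ∀ a : σ →₀ ℕ, ∃ j : Option σ, a ≠ 0 → ∃ i, j = some i ∧ a i ≠ 0 := fun a => by
      by_cases ha : a = 0
      · exact ⟨none, fun h => absurd ha h⟩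
      · obtain ⟨i, hi⟩ := Finsupp.ne_iff.1 ha
        exact ⟨some i, fun _ => ⟨i, rfl, hi⟩⟩
    choose sel hsel using hsel
    let g : σ → MvPowerSeries σ R := fun j b =>
      if sel (b + Finsupp.single j 1) = some j then
        MvPowerSeries.coeff (b + Finsupp.single j 1) h else 0
    have hg : ∀ j b, MvPowerSeries.coeff b (g j) =
      if sel (b + Finsupp.single j 1) = some j then
        MvPowerSeries.coeff (b + Finsupp.single j 1) h else 0 := fun _ _ => rfl
    have hsum : h = ∑ j, (MvPowerSeries.X j : MvPowerSeries σ ℂ) • g j := by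
      ext a
      have h1 : ∀ j, MvPowerSeries.coeff a ((MvPowerSeries.X j : MvPowerSeries σ ℂ) • g j) =
          if a j ≠ 0 ∧ sel a = some j then MvPowerSeries.coeff a h else 0 := fun j => by
        rw [Algebra.smul_def, MvPowerSeries.algebraMap_apply'', MvPowerSeries.map_X,
          MvPowerSeries.X, MvPowerSeries.coeff_monomial_mul, one_mul, hg]
        by_cases ha : a j = 0
        · rw [if_neg fun h' => by rw [Finsupp.single_le_iff] at h'; omega, if_neg fun h' => h'.1 ha]
        · have hle : Finsupp.single j 1 ≤ a := by
            rw [Finsupp.single_le_iff]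
            omega
          rw [if_pos hle, tsub_add_cancel_of_le hle]
          exact if_congr ⟨fun h' => ⟨ha, h'⟩, fun h' => h'.2⟩ rfl rfl
      rw [map_sum, Finset.sum_congr rfl fun j _ => h1 j]
      by_cases ha : a = 0
      · rw [hh a (by rw [ha, map_zero]; omega)]
        simp
      · obtain ⟨i, hi, hai⟩ := hsel a ha
        rw [Finset.sum_eq_single i, if_pos ⟨hai, hi⟩]
        · intro j _ hj
          rw [if_neg]
          rintro ⟨-, h'⟩
          rw [hi] at h'
          exact hj (Option.some.inj h').symm
        · simp
    rw [hsum, pow_succ', Submodule.mul_smul]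
    refine Submodule.sum_mem _ fun j _ => Submodule.smul_mem_smul (X_mem_maximalIdeal j)
      (ih _ fun b hb => ?_)
    rw [hg, hh _ (by rw [map_add, Finsupp.degree_single]; omega), ite_self]

theorem latRed_of_mem_maximalIdeal_pow {n : ℕ} {m : Fin (n + 1) → ℕ}
    {F : MvPowerSeries σ (Conv (n + 1))} (hF : MvPowerSeries.constantCoeff F = bp m) (K : ℕ)
    (w : BrieskornLattice F) (hw : w ∈ IsLocalRing.maximalIdeal (MvPowerSeries σ ℂ) ^ K •
      (⊤ : Submodule (MvPowerSeries σ ℂ) (BrieskornLattice F))) (a : σ →₀ ℕ) (ha : a.degree < K) :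
    latRed F hF w a = 0 := by
  classical
  induction K generalizing w a with
  | zero => exact absurd ha (Nat.not_lt_zero _)
  | succ K ih =>
    rw [pow_succ', Submodule.mul_smul] at hw
    refine Submodule.smul_induction_on hw (fun c hc v hv => ?_) fun x y hx hy => ?_
    · ext k ν
      rw [latRed_smul]
      refine Finset.sum_eq_zero fun p hp => ?_
      by_cases h0 : p.1 = 0
      · rw [h0, MvPowerSeries.coeff_zero_eq_constantCoeff_apply,
          constantCoeff_of_mem_maximalIdeal hc, zero_mul]
      · have h1 := congrArg Finsupp.degree (Finset.HasAntidiagonal.mem_antidiagonal.1 hp)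
        have h2 : p.1.degree ≠ 0 := fun h => h0 ((Finsupp.degree_eq_zero_iff _).1 h)
        rw [map_add] at h1
        rw [ih v hv p.2 (by omega)]
        exact mul_zero _
    · rw [map_add, Pi.add_apply, hx, hy, add_zero]

end MaximalIdeal

namespace Laur

variable {N : ℕ}

theorem smul_single (c : ℂ) (j : ℤ) (φ : Conv N) : c • single j φ = single j (c • φ) := by
  refine ext' fun k => ?_
  rw [coeff_smul, coeff_single, coeff_single, smul_ite, smul_zero]

end Laur

/-! ### The Taylor expansion -/

section Taylor

variable {n : ℕ} {m : Fin (n + 1) → ℕ}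

/-- The coefficient `(-1)^{|d|} / d!`. -/
def expFactor (d : Gam m →₀ ℕ) : ℂ :=
  (-1) ^ (∑ ν, d ν) / ((∏ ν, (d ν).factorial : ℕ) : ℂ)

theorem expFactor_zero : expFactor (0 : Gam m →₀ ℕ) = 1 := by
  simp [expFactor]

theorem sum_add_single (d : Gam m →₀ ℕ) (j : Gam m) :
    ∑ ν, (d + Finsupp.single j 1 : Gam m →₀ ℕ) ν = ∑ ν, d ν + 1 := by
  simp only [← Finsupp.degree_eq_sum]
  rw [map_add, Finsupp.degree_single]

theorem expFactor_add_single (d : Gam m →₀ ℕ) (j : Gam m) :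
    ((d j : ℂ) + 1) * expFactor (d + Finsupp.single j 1) = -expFactor d := by
  have h1 : ∏ ν, ((d + Finsupp.single j 1 : Gam m →₀ ℕ) ν).factorial = (d j + 1) * ∏ ν, (d ν).factorial := by
    rw [← Finset.mul_prod_erase _ _ (Finset.mem_univ j),
      ← Finset.mul_prod_erase Finset.univ (fun ν => (d ν).factorial) (Finset.mem_univ j),
      Finsupp.add_apply, Finsupp.single_eq_same, Nat.factorial_succ, mul_assoc]
    congr 2
    refine Finset.prod_congr rfl fun ν hν => ?_
    rw [Finsupp.add_apply, Finsupp.single_eq_of_ne (Finset.ne_of_mem_erase hν), add_zero]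
  have h2 : ((d j : ℂ) + 1) ≠ 0 := by exact_mod_cast Nat.succ_ne_zero (d j)
  have h3 : ((∏ ν, (d ν).factorial : ℕ) : ℂ) ≠ 0 := by
    exact_mod_cast Finset.prod_ne_zero_iff.2 fun ν _ => Nat.factorial_ne_zero _
  rw [expFactor, expFactor, h1, sum_add_single, Nat.cast_mul, Nat.cast_succ]
  field_simp
  ring

theorem pExp_add (a b : Gam m →₀ ℕ) : pExp (a + b) = pExp a + pExp b := by
  ext i
  simp only [pExp, Pi.add_apply, Finsupp.add_apply, mul_add, Finset.sum_add_distrib]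

theorem pExp_zero : pExp (0 : Gam m →₀ ℕ) = 0 := by
  ext i
  simp [pExp]

theorem pExp_single (j : Gam m) : pExp (Finsupp.single j 1) = fun i => (j i : ℕ) := by
  ext i
  rw [pExp, Finset.sum_eq_single j]
  · simp
  · intro ν _ hν
    rw [Finsupp.single_eq_of_ne hν, mul_zero]
  · simp

theorem pderiv_bpDeformation (j : Gam m) :
    MvPowerSeries.pderiv _ j (bpDeformation m) =
      MvPowerSeries.C (xpow fun i => (j i : ℕ)) := by
  rw [bpDeformation, map_add, MvPowerSeries.pderiv_C, zero_add, map_sum, Finset.sum_eq_single j]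
  · rw [Derivation.leibniz, MvPowerSeries.pderiv_C, MvPowerSeries.pderiv_X_self, smul_zero,
      add_zero, smul_eq_mul, mul_one]
  · intro ν _ hν
    rw [Derivation.leibniz, MvPowerSeries.pderiv_C, MvPowerSeries.pderiv_X_of_ne hν, smul_zero,
      smul_zero, add_zero]
  · simp

/-- The derivative of the exponent in s_j is -u⁻¹ x^j, constant in s. The equation ∂_j e^y = (∂_j y)
e^y then determines the coefficients one unit vector at a time, in place of a multinomial expansion.
-/
theorem coeff_expSeries_exponent (d : Gam m →₀ ℕ) :
    MvPowerSeries.coeff d (expSeries (GaussManinSystem.exponent (bpDeformation m) (bp m))) =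
      Laur.single (-(∑ ν, d ν : ℕ)) (expFactor d • xpow (pExp d)) := by
  have hy := GaussManinSystem.constantCoeff_exponent (constantCoeff_bpDeformation m)
  induction d using finsupp_induction_single with
  | h0 =>
    rw [MvPowerSeries.coeff_zero_eq_constantCoeff_apply, constantCoeff_expSeries hy,
      expFactor_zero, one_smul, pExp_zero, Conv.xpow_zero]
    simp only [Finsupp.zero_apply, Finset.sum_const_zero, Nat.cast_zero, neg_zero]
    exact (map_one Laur.C).symm
  | h a j ih =>
    have h1 := congrArg (MvPowerSeries.coeff a) (pderiv_expSeries j hy)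
    have h2 : MvPowerSeries.pderiv _ j (GaussManinSystem.exponent (bpDeformation m) (bp m)) =
        MvPowerSeries.C (Laur.single (-1) ((-1 : ℂ) • xpow fun i => (j i : ℕ))) := by
      have h3 : MvPowerSeries.pderiv _ j (inLaur (bpDeformation m)) =
          MvPowerSeries.C (Laur.C (xpow fun i => (j i : ℕ))) := by
        rw [inLaur, ← map_pderiv, pderiv_bpDeformation, MvPowerSeries.map_C]
      have h4 : Laur.uInv (n + 1) * -Laur.C (xpow fun i => (j i : ℕ)) =
          Laur.single (-1) ((-1 : ℂ) • xpow fun i => (j i : ℕ)) := by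
        refine Laur.ext' fun k => ?_
        rw [Laur.coeff_uInv_mul, Laur.coeff_single, ← map_neg, Laur.C_eq_single,
          Laur.coeff_single, neg_one_smul]
        exact if_congr (by omega) rfl rfl
      rw [GaussManinSystem.exponent, Derivation.leibniz, MvPowerSeries.pderiv_C, smul_zero,
        add_zero, map_sub, h3, inLaur, MvPowerSeries.map_C, MvPowerSeries.pderiv_C, zero_sub,
        smul_eq_mul, ← map_neg, ← map_mul, h4]
    rw [MvPowerSeries.coeff_pderiv, Laur.mul_natCast_add_one, h2, MvPowerSeries.coeff_C_mul, ih,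
      Laur.single_mul_single] at h1
    have h0 : ((a j : ℂ) + 1) ≠ 0 := by exact_mod_cast Nat.succ_ne_zero (a j)
    have h5 := congrArg (fun x => ((a j : ℂ) + 1)⁻¹ • x) h1
    simp only [smul_smul, inv_mul_cancel₀ h0, one_smul] at h5
    rw [h5, Laur.smul_single, sum_add_single, smul_mul_smul_comm, Conv.xpow_mul,
      ← pExp_single, ← pExp_add, add_comm (Finsupp.single j 1), neg_one_mul,
      ← expFactor_add_single a j, smul_smul, inv_mul_cancel_left₀ h0]
    congr 1
    push_cast
    ring

theorem BrieskornLattice.uMul_mk {N : ℕ} {σ : Type} (F : MvPowerSeries σ (Conv N))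
    (h : MvPowerSeries σ (Pow N)) :
    BrieskornLattice.uMul F (Submodule.Quotient.mk h) =
      Submodule.Quotient.mk (MvPowerSeries.C (Pow.u N) * h) := rfl

/-- The condition `e_a ≥ 0`, `r(a) ∈ Γ` defining the index set of the Taylor expansion. -/
def IsTaylorIndex (a : Gam m →₀ ℕ) : Prop := 0 ≤ eExp a ∧ ∃ γ : Gam m, ∀ i, rExp a i = γ i

theorem mem_indexSet_iff (k : ℕ) (a : Gam m →₀ ℕ) :
    a ∈ indexSet m k ↔ a.degree ≤ k ∧ IsTaylorIndex a := by
  rw [mem_indexSet, Finsupp.degree_eq_sum]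
  rfl

open Classical in
/-- The coefficient of `s^a` in `∑ c_a u^{e_a} x^{r(a)} s^a`. -/
def taylorCoeff (c : (Gam m →₀ ℕ) → ℂ) (a : Gam m →₀ ℕ) : Pow (n + 1) :=
  if IsTaylorIndex a then c a • (Pow.u _ ^ (eExp a).toNat * Pow.C (xpow (rExp a))) else 0

/-- The series `∑ c_a u^{e_a} x^{r(a)} s^a` over all indices of the Taylor expansion. -/
def taylorSer (c : (Gam m →₀ ℕ) → ℂ) : MvPowerSeries (Gam m) (Pow (n + 1)) := taylorCoeff c

theorem coeff_taylorSer (c : (Gam m →₀ ℕ) → ℂ) (a : Gam m →₀ ℕ) :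
    MvPowerSeries.coeff a (taylorSer c) = taylorCoeff c a := rfl

theorem taylorSer_sub (c c' : (Gam m →₀ ℕ) → ℂ) :
    taylorSer (c - c') = taylorSer c - taylorSer c' := by
  ext1 a
  rw [map_sub, coeff_taylorSer, coeff_taylorSer, coeff_taylorSer, taylorCoeff, taylorCoeff,
    taylorCoeff]
  split_ifs
  · rw [Pi.sub_apply, sub_smul]
  · rw [sub_self]

open Classical in
theorem ofPow_taylorCoeff (c : (Gam m →₀ ℕ) → ℂ) (a : Gam m →₀ ℕ) :
    Laur.ofPow (taylorCoeff c a) =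
      if IsTaylorIndex a then Laur.single (eExp a) (c a • xpow (rExp a)) else 0 := by
  rw [taylorCoeff]
  split_ifs with h
  · have hu : ∀ k : ℕ, Laur.u (n + 1) ^ k = Laur.single k 1 := fun k => by
      induction k with
      | zero => rfl
      | succ k ih =>
        rw [pow_succ, ih, Laur.u, Laur.single_mul_single, mul_one, Nat.cast_succ]
    rw [← Laur.ofPowLin_apply, map_smul, Laur.ofPowLin_apply, map_mul, map_pow, Laur.ofPow_u,
      Laur.ofPow_C, hu, Laur.C_eq_single, Laur.single_mul_single, one_mul, add_zero,
      Laur.smul_single, Int.toNat_of_nonneg h.1]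
  · rw [map_zero]

open Classical in
/-- The contribution of the indices `b < a` to the coordinate of `s^a`. -/
def lowerSum (c : (Gam m →₀ ℕ) → ℂ) (a : Gam m →₀ ℕ) : ℂ :=
  ∑ p ∈ (Finset.HasAntidiagonal.antidiagonal a).filter (fun p => p.2 < a),
    if IsTaylorIndex p.2 then
      expFactor p.1 * c p.2 * redFactor m (fun i => rExp p.2 i + pExp p.1 i) else 0

theorem lowerSum_congr {c c' : (Gam m →₀ ℕ) → ℂ} {a : Gam m →₀ ℕ}
    (h : ∀ b < a, IsTaylorIndex b → c b = c' b) : lowerSum c a = lowerSum c' a := by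
  refine Finset.sum_congr rfl fun p hp => ?_
  split_ifs with hI
  · rw [h _ (Finset.mem_filter.1 hp).2 hI]
  · rfl

theorem qExp_add (d b : Gam m →₀ ℕ) (hm : ∀ i, 2 ≤ m i) (i : Fin (n + 1)) :
    qExp (d + b) i = qExp b i + (rExp b i + pExp d i) / m i := by
  have h := Nat.mod_add_div (pExp b i) (m i)
  have hmi : 0 < m i := by
    have := hm i
    omega
  rw [qExp, qExp, rExp, pExp_add, Pi.add_apply, ← Nat.mul_add_div hmi]
  congr 1
  omega

theorem rExp_add (d b : Gam m →₀ ℕ) (i : Fin (n + 1)) :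
    (rExp b i + pExp d i) % m i = rExp (d + b) i := by
  rw [rExp, rExp, pExp_add, Pi.add_apply, Nat.mod_add_mod, add_comm]

/-- The product of the s^d-coefficient of the exponential with u^{e_b} x^{r(b)} reduces to the power
u^{e_{d+b}}: the carries of r(b) + p(d) are exactly what q(d + b) gains over q(b). So the target
depends on d + b alone. -/
theorem eExp_add (d b : Gam m →₀ ℕ) (hm : ∀ i, 2 ≤ m i) :
    eExp (d + b) = -(∑ ν, d ν : ℕ) + eExp b + ∑ i, (((rExp b i + pExp d i) / m i : ℕ) : ℤ) := by
  simp only [eExp, qExp_add d b hm, Finsupp.add_apply]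
  push_cast
  simp only [Finset.sum_add_distrib]
  ring

theorem rExp_lt (hm : ∀ i, 2 ≤ m i) (a : Gam m →₀ ℕ) (i : Fin (n + 1)) : rExp a i < m i := by
  have := hm i
  exact Nat.mod_lt _ (by omega)

open Classical in
theorem red_term (hm : ∀ i, 2 ≤ m i) (c : (Gam m →₀ ℕ) → ℂ) (d b : Gam m →₀ ℕ) (k : ℤ)
    (ν : Gam m) :
    red m (MvPowerSeries.coeff d
      (expSeries (GaussManinSystem.exponent (bpDeformation m) (bp m))) *
        Laur.ofPow (taylorCoeff c b)) k ν =
      if k = eExp (d + b) ∧ ∀ i, rExp (d + b) i = ν i then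
        if IsTaylorIndex b then
          expFactor d * c b * redFactor m (fun i => rExp b i + pExp d i) else 0
      else 0 := by
  rw [coeff_expSeries_exponent, ofPow_taylorCoeff]
  by_cases hb : IsTaylorIndex b
  · simp only [if_pos hb]
    have h1 : (xpow (pExp d) * xpow (rExp b) : Conv (n + 1)) =
        xpow (fun i => rExp b i + pExp d i) := by
      rw [mul_comm, Conv.xpow_mul]
      rfl
    rw [Laur.single_mul_single, smul_mul_smul_comm, h1, ← Laur.smul_single, map_smul,
      Pi.smul_apply, Pi.smul_apply, red_single_xpow, ← eExp_add d b hm, smul_ite, smul_zero,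
      smul_eq_mul]
    simp only [rExp_add]
  · simp only [if_neg hb, mul_zero, map_zero, ite_self]
    rfl

open Classical in
-- All b ≤ a contribute to the same coordinate, so the coefficient of s^a has at most one nonzero
-- coordinate. Its value is the diagonal term plus the contribution of the smaller indices.
theorem latRed_taylorSer (hm : ∀ i, 2 ≤ m i) (c : (Gam m →₀ ℕ) → ℂ) (a : Gam m →₀ ℕ) (k : ℤ)
    (ν : Gam m) :
    latRed (bpDeformation m) (constantCoeff_bpDeformation m)
      (Submodule.Quotient.mk (taylorSer c)) a k ν =
      if k = eExp a ∧ ∀ i, rExp a i = ν i then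
        (if IsTaylorIndex a then c a else 0) + lowerSum c a else 0 := by
  have h0 : red m (Laur.ofPow (taylorCoeff c a)) k ν =
      if k = eExp a ∧ ∀ i, rExp a i = ν i then (if IsTaylorIndex a then c a else 0) else 0 := by
    have := red_term hm c 0 a k ν
    rw [MvPowerSeries.coeff_zero_eq_constantCoeff_apply, constantCoeff_expSeries
      (GaussManinSystem.constantCoeff_exponent (constantCoeff_bpDeformation m)), one_mul, zero_add,
      expFactor_zero, one_mul, pExp_zero, redFactor_of_lt _ fun i => by
        rw [Pi.zero_apply, add_zero]; exact rExp_lt hm a i, mul_one] at this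
    exact this
  rw [latRed_mk_eq_add_lower, Pi.add_apply, Pi.add_apply, coeff_taylorSer, h0, map_sum,
    Finset.sum_apply, Finset.sum_apply]
  have h1 : ∀ p ∈ (Finset.HasAntidiagonal.antidiagonal a).filter (fun p => p.2 < a),
      red m (MvPowerSeries.coeff p.1
        (expSeries (GaussManinSystem.exponent (bpDeformation m) (bp m))) *
          Laur.ofPow (MvPowerSeries.coeff p.2 (taylorSer c))) k ν =
      if k = eExp a ∧ ∀ i, rExp a i = ν i then
        if IsTaylorIndex p.2 then
          expFactor p.1 * c p.2 * redFactor m (fun i => rExp p.2 i + pExp p.1 i) else 0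
      else 0 := fun p hp => by
    rw [coeff_taylorSer, red_term hm,
      Finset.HasAntidiagonal.mem_antidiagonal.1 (Finset.mem_filter.1 hp).1]
  refine (congrArg _ (Finset.sum_congr (by congr!) h1)).trans ?_
  by_cases h : k = eExp a ∧ ∀ i, rExp a i = ν i
  · simp only [if_pos h]
    rfl
  · simp only [if_neg h]
    rw [Finset.sum_const_zero, add_zero]

theorem eExp_zero : eExp (0 : Gam m →₀ ℕ) = 0 := by
  simp [eExp, qExp, pExp_zero]

theorem rExp_zero (i : Fin (n + 1)) : rExp (0 : Gam m →₀ ℕ) i = 0 := by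
  simp [rExp, pExp_zero]

theorem isTaylorIndex_zero (hm : ∀ i, 2 ≤ m i) : IsTaylorIndex (0 : Gam m →₀ ℕ) :=
  ⟨eExp_zero.ge, fun i => ⟨0, by have := hm i; omega⟩, rExp_zero⟩

theorem lowerSum_zero (c : (Gam m →₀ ℕ) → ℂ) : lowerSum c 0 = 0 :=
  Finset.sum_eq_zero fun _ hp => absurd (Finset.mem_filter.1 hp).2 not_lt_zero

open Classical in
theorem lowerSum_eq (c : (Gam m →₀ ℕ) → ℂ) (a : Gam m →₀ ℕ) (k : ℕ) (ha : a.degree ≤ k) :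
    lowerSum c a = ∑ b ∈ (indexSet m k).filter (fun b => b < a),
      (-1) ^ (∑ ν, (a - b) ν) * (c b / ((∏ ν, ((a - b) ν).factorial : ℕ) : ℂ)) *
        ∏ i, ∏ l ∈ Finset.Icc 1 (qExp₂ a b i),
          ((rExp b i : ℂ) + (pExp (a - b) i : ℂ) - (l : ℂ) * (m i : ℂ) + 1) / (m i : ℂ) := by
  rw [lowerSum, ← Finset.sum_filter]
  refine Finset.sum_nbij' (fun p => p.2) (fun b => (a - b, b)) ?_ ?_ ?_ ?_ ?_
  · intro p hp
    simp only [Finset.mem_filter] at hp ⊢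
    refine ⟨(mem_indexSet_iff k _).2 ⟨?_, hp.2⟩, hp.1.2⟩
    have := congrArg Finsupp.degree (Finset.HasAntidiagonal.mem_antidiagonal.1 hp.1.1)
    rw [map_add] at this
    omega
  · intro b hb
    simp only [Finset.mem_filter] at hb ⊢
    exact ⟨⟨Finset.HasAntidiagonal.mem_antidiagonal.2 (tsub_add_cancel_of_le hb.2.le), hb.2⟩,
      ((mem_indexSet_iff k _).1 hb.1).2⟩
  · intro p hp
    simp only [Finset.mem_filter] at hp
    refine Prod.ext ?_ rfl
    rw [← Finset.HasAntidiagonal.mem_antidiagonal.1 hp.1.1]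
    exact add_tsub_cancel_right _ _
  · intro b _
    rfl
  · intro p hp
    simp only [Finset.mem_filter] at hp
    have h1 : a - p.2 = p.1 := by
      rw [← Finset.HasAntidiagonal.mem_antidiagonal.1 hp.1.1]
      exact add_tsub_cancel_right _ _
    rw [h1, expFactor, redFactor]
    simp only [qExp₂, h1]
    push_cast
    ring

open Classical in
theorem satisfiesRecursion_iff (hm : ∀ i, 2 ≤ m i) (k : ℕ) (c : (Gam m →₀ ℕ) → ℂ) :
    SatisfiesRecursion k c ↔
      ∀ a ∈ indexSet m k, c a = (if a = 0 then 1 else 0) - lowerSum c a := by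
  rw [SatisfiesRecursion]
  constructor
  · rintro ⟨h0, h⟩ a ha
    split_ifs with ha0
    · rw [ha0, lowerSum_zero, sub_zero, h0]
    · rw [h a ha ha0, lowerSum_eq c a k ((mem_indexSet_iff k a).1 ha).1, zero_sub]
  · intro h
    refine ⟨?_, fun a ha ha0 => ?_⟩
    · rw [h 0 ((mem_indexSet_iff k 0).2 ⟨by simp, isTaylorIndex_zero hm⟩), if_pos rfl,
        lowerSum_zero, sub_zero]
    · rw [h a ha, if_neg ha0, lowerSum_eq c a k ((mem_indexSet_iff k a).1 ha).1, zero_sub]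

/-- The recursion is imposed at every a, without reference to k, so one family serves all
truncations. Values at indices with e_a < 0 or r(a) outside Γ are never used by `lowerSum` or
`taylorSer`. -/
theorem exists_taylorCoefficients :
    ∃ c : (Gam m →₀ ℕ) → ℂ, ∀ a, c a = (open Classical in if a = 0 then 1 else 0) - lowerSum c a := by
  classical
  exact exists_triangular (fun (a : Gam m →₀ ℕ) c => (if a = 0 then 1 else 0) - lowerSum c a)
    fun a c c' h => by
      rw [lowerSum_congr fun b hb _ => h b hb]

open Classical in
-- A Taylor index below an element of A'_k is again in A'_k, because the degree decreases. The
-- recursion thus closes up inside A'_k and has the restriction of `c₁` as its only solution there.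
theorem satisfiesRecursion_iff_eq (hm : ∀ i, 2 ≤ m i) (k : ℕ) {c₁ : (Gam m →₀ ℕ) → ℂ}
    (h₁ : ∀ a, c₁ a = (if a = 0 then 1 else 0) - lowerSum c₁ a) (c : (Gam m →₀ ℕ) → ℂ) :
    SatisfiesRecursion k c ↔ ∀ a ∈ indexSet m k, c₁ a = c a := by
  rw [satisfiesRecursion_iff hm]
  have hlt : ∀ a ∈ indexSet m k, ∀ b < a, IsTaylorIndex b → b ∈ indexSet m k :=
    fun a ha b hb hI => (mem_indexSet_iff k b).2
      ⟨(Finsupp.degree_mono hb.le).trans ((mem_indexSet_iff k a).1 ha).1, hI⟩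
  constructor
  · intro h a
    induction a using WellFoundedLT.induction with | ind a ih =>
    intro ha
    rw [h a ha, h₁ a, lowerSum_congr fun b hb hI => ih b hb (hlt a ha b hb hI)]
  · intro h a ha
    rw [← h a ha, h₁ a, lowerSum_congr fun b hb hI => h b (hlt a ha b hb hI)]

open Classical in
-- Lattice elements are compared at k ≥ 0 only. There the recursion makes the single coordinate at
-- s^a equal to 1 for a = 0 and to 0 for every other Taylor index.
theorem eq_mk_taylorSer (hm : ∀ i, 2 ≤ m i) {c₁ : (Gam m →₀ ℕ) → ℂ}
    (h₁ : ∀ a, c₁ a = (if a = 0 then 1 else 0) - lowerSum c₁ a)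
    {ζ : BrieskornLattice (bpDeformation m)}
    (hζ : ∀ (a : Gam m →₀ ℕ) (k : ℤ), 0 ≤ k → ∀ ν,
      latRed (bpDeformation m) (constantCoeff_bpDeformation m) ζ a k ν =
        if a = 0 then brRed m (bpOmega m) k ν else 0) :
    ζ = Submodule.Quotient.mk (taylorSer c₁) := by
  refine lattice_ext (constantCoeff_bpDeformation m) hm fun a k hk ν => ?_
  have hω : brRed m (bpOmega m) k ν = if k = 0 ∧ ∀ i, 0 = (ν i : ℕ) then 1 else 0 := by
    rw [bpOmega, ← Conv.xpow_zero, brRed_cls_xpow, redFactor_of_lt]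
    · simp only [Pi.zero_apply, Nat.zero_div, Nat.zero_mod, Nat.cast_zero, Finset.sum_const_zero]
    · intro i
      have := hm i
      rw [Pi.zero_apply]
      omega
  rw [hζ a k hk, latRed_taylorSer hm, hω]
  rcases eq_or_ne a 0 with rfl | ha
  · rw [if_pos rfl, eExp_zero, if_pos (isTaylorIndex_zero hm), h₁ 0, if_pos rfl, sub_add_cancel]
    simp only [rExp_zero]
  · rw [if_neg ha]
    split_ifs with h2 h3
    · rw [h₁ a, if_neg ha, sub_add_cancel]
    -- A tested coordinate has k = e_a ≥ 0 and r(a) = ν in Γ, which already makes a a Taylor index.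
    · exact absurd ⟨h2.1 ▸ hk, ν, h2.2⟩ h3
    · rfl

open Classical in
theorem sum_taylorTerm (k : ℕ) (c : (Gam m →₀ ℕ) → ℂ) :
    ∑ a ∈ indexSet m k, (MvPowerSeries.C (c a) : MvPowerSeries (Gam m) ℂ) • taylorTerm a =
      Submodule.Quotient.mk (taylorSer fun a => if a.degree ≤ k then c a else 0) := by
  have hu : ∀ (j : ℕ) (h : MvPowerSeries (Gam m) (Pow (n + 1))),
      (BrieskornLattice.uMul (bpDeformation m) ^ j) (Submodule.Quotient.mk h) =
        Submodule.Quotient.mk (MvPowerSeries.C (Pow.u _ ^ j) * h) := fun j => by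
    induction j with
    | zero =>
      intro h
      rw [pow_zero, pow_zero, map_one, one_mul]
      rfl
    | succ j ih =>
      intro h
      rw [pow_succ', Module.End.mul_apply, ih, BrieskornLattice.uMul_mk, ← mul_assoc, ← map_mul,
        ← pow_succ']
  have h1 : ∀ a : Gam m →₀ ℕ,
      (MvPowerSeries.C (c a) : MvPowerSeries (Gam m) ℂ) • taylorTerm a =
      Submodule.Quotient.mk (MvPowerSeries.monomial a
        (c a • (Pow.u _ ^ (eExp a).toNat * Pow.C (xpow (rExp a))))) := fun a => by
    have h2 : taylorTerm a = Submodule.Quotient.mk (MvPowerSeries.C (Pow.u _ ^ (eExp a).toNat) *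
      inPow (MvPowerSeries.monomial a (xpow (rExp a)))) := hu _ _
    have h3 : inPow (MvPowerSeries.monomial a (xpow (rExp a) : Conv (n + 1))) =
      MvPowerSeries.monomial a (Pow.C (xpow (rExp a))) := MvPowerSeries.map_monomial _ _ _
    rw [h2, h3]
    refine (Submodule.Quotient.mk_smul _ _ _).symm.trans (congrArg _ ?_)
    rw [Algebra.smul_def, MvPowerSeries.algebraMap_apply'', MvPowerSeries.map_C]
    ext1 b
    rw [MvPowerSeries.coeff_C_mul, MvPowerSeries.coeff_C_mul, MvPowerSeries.coeff_monomial,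
      MvPowerSeries.coeff_monomial, Algebra.smul_def]
    split_ifs
    · rfl
    · rw [mul_zero, mul_zero]
  rw [Finset.sum_congr rfl fun a _ => h1 a]
  refine (map_sum (Submodule.mkQ _) _ _).symm.trans (congrArg (Submodule.mkQ _) ?_)
  ext1 b
  rw [map_sum, coeff_taylorSer, taylorCoeff]
  simp only [MvPowerSeries.coeff_monomial]
  rw [Finset.sum_ite_eq]
  by_cases hb : b ∈ indexSet m k
  · have := (mem_indexSet_iff k b).1 hb
    rw [if_pos hb, if_pos this.2, if_pos this.1]
  · rw [if_neg hb]
    split_ifs with h2 h3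
    · exact absurd ((mem_indexSet_iff k b).2 ⟨h3, h2⟩) hb
    · rw [zero_smul]
    · rfl

/-- If the difference lies in 𝔪₀^{k+1} times the lattice, its coordinates vanish up to degree k. By
induction the smaller indices then contribute nothing, which leaves the difference of the two
coefficients at a. Conversely, equal coefficients leave a series without terms of degree at most k,
which `mem_maximalIdeal_pow_smul_top` places in that submodule. -/
theorem hasTaylorExpansion_iff (hm : ∀ i, 2 ≤ m i) (k : ℕ) (c₁ c : (Gam m →₀ ℕ) → ℂ) :
    HasTaylorExpansion (Submodule.Quotient.mk (taylorSer c₁)) k c ↔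
      ∀ a ∈ indexSet m k, c₁ a = c a := by
  classical
  have hsub : ∀ x y : MvPowerSeries (Gam m) (Pow (n + 1)),
      (Submodule.Quotient.mk x - Submodule.Quotient.mk y : BrieskornLattice (bpDeformation m)) =
        Submodule.Quotient.mk (x - y) := fun _ _ => rfl
  rw [HasTaylorExpansion, sum_taylorTerm, SModEq.sub_mem, hsub, ← taylorSer_sub]
  set d : (Gam m →₀ ℕ) → ℂ := c₁ - fun a => if a.degree ≤ k then c a else 0 with hd
  have hdI : ∀ a : Gam m →₀ ℕ, a.degree ≤ k → d a = c₁ a - c a := fun a ha => by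
    rw [hd, Pi.sub_apply, if_pos ha]
  constructor
  · intro h a
    induction a using WellFoundedLT.induction with | ind a ih =>
    intro ha
    obtain ⟨hak, hI⟩ := (mem_indexSet_iff k a).1 ha
    have h1 := latRed_of_mem_maximalIdeal_pow (constantCoeff_bpDeformation m) (k + 1) _ h a
      (by omega)
    obtain ⟨γ, hγ⟩ := hI.2
    have h2 := latRed_taylorSer hm d a (eExp a) γ
    have h3 : lowerSum d a = 0 := by
      refine Finset.sum_eq_zero fun p hp => ?_
      have hp2 := (Finset.mem_filter.1 hp).2
      have hk : p.2.degree ≤ k := (Finsupp.degree_mono hp2.le).trans hak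
      split_ifs with hIp
      · rw [hdI _ hk, ih p.2 hp2 ((mem_indexSet_iff k _).2 ⟨hk, hIp⟩), sub_self, mul_zero, zero_mul]
      · rfl
    rw [h1, if_pos ⟨rfl, hγ⟩, if_pos hI, h3, add_zero, hdI a hak] at h2
    exact sub_eq_zero.1 h2.symm
  · intro h
    have h1 := mem_maximalIdeal_pow_smul_top (k + 1) (taylorSer d) fun a ha => by
      rw [coeff_taylorSer, taylorCoeff]
      split_ifs with hI
      · rw [hdI a (by omega), h a ((mem_indexSet_iff k a).2 ⟨by omega, hI⟩), sub_self, zero_smul]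
      · rfl
    have h2 := Submodule.mem_map_of_mem (f := (Submodule.mkQ _ : _ →ₗ[MvPowerSeries (Gam m) ℂ]
      BrieskornLattice (bpDeformation m))) h1
    rw [Submodule.map_smul''] at h2
    exact Submodule.smul_mono le_rfl le_top h2

end Taylor

end GaussManin

/-! ### The main theorem -/

open GaussManin in
theorem mainTheorem5 (n : ℕ) (m : Fin (n + 1) → ℕ) (hm : ∀ i, 2 ≤ m i) :
    (∃! σ₀, IsCanonicalSection m σ₀) ∧
    ∀ σ₀, IsCanonicalSection m σ₀ →
      IsGoodSection₀ σ₀ ∧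
      (∃! ζ, IsFormalPrimitiveForm (constantCoeff_bpDeformation m) σ₀
        (pr₀ (bp m) (bpOmega m)) ζ) ∧
      ∀ ζ, IsFormalPrimitiveForm (constantCoeff_bpDeformation m) σ₀
          (pr₀ (bp m) (bpOmega m)) ζ →
        (∀ ζ', PhiCongruence (constantCoeff_bpDeformation m) (bpI₀ m) (bpOmega m) ζ' ↔
          ζ' = ζ) ∧
        (∃ c, ∀ k, HasTaylorExpansion ζ k c) ∧
        ∀ k c, HasTaylorExpansion ζ k c ↔ SatisfiesRecursion k c := by
  classical
  refine ⟨existsUnique_canonicalSection hm, fun σ₀ hσ₀ => ⟨hσ₀.isGoodSection₀ hm, ?_, ?_⟩⟩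
  · obtain ⟨ζ, hζ⟩ := exists_isFormalPrimitiveForm (constantCoeff_bpDeformation m) hm hσ₀
    refine ⟨ζ, hζ, fun ζ' hζ' => lattice_ext (constantCoeff_bpDeformation m) hm fun a k hk ν => ?_⟩
    rw [hζ.latRed_eq _ hm hσ₀ a k hk, hζ'.latRed_eq _ hm hσ₀ a k hk]
  · intro ζ hζ
    have hred := hζ.latRed_eq _ hm hσ₀
    obtain ⟨c₁, h₁⟩ := exists_taylorCoefficients (m := m)
    have hζ₁ := eq_mk_taylorSer hm h₁ fun a k hk ν =>
      (hred a k hk ν).trans (by congr)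
    refine ⟨fun ζ' => ?_, ⟨c₁, fun k => ?_⟩, fun k c => ?_⟩
    · rw [phiCongruence_iff _ hm]
      constructor
      · intro h
        refine lattice_ext (constantCoeff_bpDeformation m) hm fun a k hk ν => ?_
        rw [h a k hk, hred a k hk]
      · rintro rfl
        exact hred
    · rw [hζ₁, hasTaylorExpansion_iff hm]
      exact fun _ _ => rfl
    · rw [hζ₁, hasTaylorExpansion_iff hm, satisfiesRecursion_iff_eq hm k h₁]

end
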